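/- Let $\mathbb F_q$ be a finite field with $q$ elements, $A=\mathbb F_q[T]$ and $F=\mathbb F_q(T)$. For a field $L$ with an $A$-algebra structure $\gamma:A\to L$, let $L\{\tau\}$ be the ring of twisted polynomials ($\tau c=c^q\tau$ for $c\in L$). A Drinfeld module of rank $r\ge 1$ over $L$ is an $\mathbb F_q$-algebra homomorphism $\phi:A\to L\{\tau\}$, $a\mapsto\phi_a$, with $\phi_T=\gamma(T)+g_1\tau+\cdots+g_r\tau^r$, $g_r\neq 0$; $\mathrm{End}_L(\phi)$ is the centralizer of $\phi(A)$ in $L\{\tau\}$, an $A$-algebra via $\phi$; $\phi[a]\subset\overline L$ is the kernel of $\phi_a$. Let $\Phi$ be a Drinfeld module of rank $r$ over $F$, $\Phi_T=T+g_1\tau+\cdots+g_r\tau^r$, let $\mathfrak p$ be a nonzero prime ideal of $A$ of good reduction for $\Phi$ (that is, $\mathrm{ord}_{\mathfrak p}(g_i)\ge 0$ for $1\le i\le r-1$ and $\mathrm{ord}_{\mathfrak p}(g_r)=0$), and let $\phi$ be the reduction of $\Phi$ modulo $\mathfrak p$, a Drinfeld module of rank $r$ over $\mathbb F_{\mathfrak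 p}=A/\mathfrak p$. Put $\mathcal E=\mathrm{End}_{\mathbb F_{\mathfrak p}}(\phi)$ and $\pi=\tau^{\deg\mathfrak p}\in\mathcal E$. For a prime $\mathfrak l$ of $A$ with monic generator $\ell$, let $A_{\mathfrak l}$ be the completion of $A$ at $\mathfrak l$, $\mathcal E_{\mathfrak l}=\mathcal E\otimes_A A_{\mathfrak l}$, and $T_{\mathfrak l}(\phi)=\varprojlim_m\phi[\ell^m]$ (with transition maps $\phi_\ell$), an $\mathcal E_{\mathfrak l}$-module. Let $n\in A$ with $n\notin\mathfrak p$ (so $n\ne0$), and let $F(\Phi[n])$ be the field generated over $F$ by $\Phi[n]$. (1) $F(\Phi[n])/F$ is a finite Galois extension that is unramified at $\mathfrak p$. Moreover $\Phi[n]\cong(A/nA)^r$, and for every $A/nA$-basis of $\Phi[n]$ the action on $\Phi[n]$ gives an injective homomorphism $\mathrm{Gal}(F(\Phi[n])/F)\hookrightarrow \mathrm{GL}_r(A/nA)$. (2) There are monic $b_1\mid b_2\mid\cdots\mid b_{r-1}$ in $A$ with $\mathcal E/A[\pi]\cong A/b_1A\times\cdots\times A/b_{r-1}A$ as $A$-modules,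 and monic polynomials $f_i(x)=x^i+\sum_{j<i}a_{ij}x^j\in A[x]$, $1\le i\le r-1$, such that $$1,\ \frac{f_1(\pi)}{b_1},\ \ldots,\ \frac{f_{r-1}(\pi)}{b_{r-1}}$$ is an $A$-basis of $\mathcal E$. For every such choice let $\mathcal F(\mathfrak p)\in\mathrm{Mat}_r(A)$ be the matrix of multiplication by $\pi$ on $\mathcal E$ in this basis (columns are the coordinates of the images of the basis vectors). Then $\mathcal F(\mathfrak p)$ has zero entries below the subdiagonal, subdiagonal entries $b_1, b_2/b_1,\ldots,b_{r-1}/b_{r-2}$ and diagonal entries $-a_{10},\ a_{10}-a_{21},\ \ldots,\ a_{r-1,r-2}-c_{r-1}$, where $x^r+c_{r-1}x^{r-1}+\cdots+c_0$ is the minimal polynomial of $\pi$ over $A$ (for $r=1$ the matrix is $[-c_0]$). (3) Suppose that for every prime $\mathfrak l$ of $A$ dividing $n$ the Tate module $T_{\mathfrak l}(\phi)$ is a free $\mathcal E_{\mathfrak l}$-module of rank $1$. Then, for every choice in (2), $\mathcal F(\mathfrak p)$ reduced modulo $n$ represents the Frobenius class at $\mathfrak p$ in $\mathrm{Gal}(F(\Phi[n])/F)\subseteq\mathrm{GL}_r(A/nA)$: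 for every $A/nA$-basis of $\Phi[n]$, every prime $\mathfrak P$ of the integral closure of $A$ in $F(\Phi[n])$ above $\mathfrak p$, and every $\sigma\in\mathrm{Gal}(F(\Phi[n])/F)$ with $\sigma x\equiv x^{\#(A/\mathfrak p)}\pmod{\mathfrak P}$ for all $x$ in this integral closure, the matrix $\mathcal F(\mathfrak p)\bmod n$ lies in $\mathrm{GL}_r(A/nA)$ and is conjugate there to the matrix of $\sigma$ on $\Phi[n]$. -/

import Mathlib

open Polynomial IsDedekindDomain TensorProduct

/-! Throughout, `𝔽q` is a finite field with `q` elements, `A = 𝔽q[X]` (the indeterminate `X`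
is the usual `T`), and `F` is a field of fractions of `A`.  The primes (nonzero prime ideals) of
`A` are the terms of `HeightOneSpectrum 𝔽q[X]`. -/

noncomputable section

/-! ### The twisted polynomial ring `L{τ}` -/

/-- The action of `ℕ` on an `𝔽q`-algebra `L` by powers of the Frobenius `x ↦ x ^ q`. -/
@[reducible] def frobeniusAction (𝔽q L : Type*) [Field 𝔽q] [Fintype 𝔽q] [CommRing L]
    [Algebra 𝔽q L] : MulSemiringAction (Multiplicative ℕ) L where
  smul m x := x ^ Fintype.card 𝔽q ^ m.toAdd
  one_smul x := by change x ^ Fintype.card 𝔽q ^ 0 = x; simp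
  mul_smul m m' x := by
    change x ^ Fintype.card 𝔽q ^ (m.toAdd + m'.toAdd) =
      (x ^ Fintype.card 𝔽q ^ m'.toAdd) ^ Fintype.card 𝔽q ^ m.toAdd
    rw [← pow_mul, pow_add, mul_comm]
  smul_zero m := zero_pow (pow_ne_zero _ Fintype.card_ne_zero)
  smul_one m := one_pow _
  smul_mul m x y := mul_pow x y _
  smul_add m x y := by
    change (x + y) ^ Fintype.card 𝔽q ^ m.toAdd =
      x ^ Fintype.card 𝔽q ^ m.toAdd + y ^ Fintype.card 𝔽q ^ m.toAdd
    have h : ∀ (j : ℕ) (z : L),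
        z ^ Fintype.card 𝔽q ^ j = (FiniteField.frobeniusAlgHom 𝔽q L)^[j] z := by
      intro j
      induction j with
      | zero => intro z; simp
      | succ j ih =>
        intro z
        rw [Function.iterate_succ_apply, ← ih, FiniteField.coe_frobeniusAlgHom, ← pow_mul,
          pow_succ, mul_comm]
    rw [h, h, h, iterate_map_add]

/-- The ring `L{τ}` of twisted polynomials `∑ cᵢ τⁱ` over an `𝔽q`-algebra `L`, with the
commutation rule `τ c = c ^ q τ`. -/
def TwistedPoly (𝔽q L : Type*) [Field 𝔽q] [Fintype 𝔽q] [CommRing L] [Algebra 𝔽q L] : Type _ :=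
  SkewPolynomial L

namespace TwistedPoly

variable {𝔽q L : Type*} [Field 𝔽q] [Fintype 𝔽q] [CommRing L] [Algebra 𝔽q L]

instance : Ring (TwistedPoly 𝔽q L) :=
  letI := frobeniusAction 𝔽q L
  inferInstanceAs (Ring (SkewPolynomial L))

/-- The coefficient of `τⁱ`. -/
def coeff (u : TwistedPoly 𝔽q L) (i : ℕ) : L := SkewPolynomial.coeff u i

/-- The monomial `c τⁱ`. -/
def monomial (i : ℕ) (c : L) : TwistedPoly 𝔽q L := SkewPolynomial.monomial i c

theorem coeff_monomial (i j : ℕ) (c : L) :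
    (monomial i c : TwistedPoly 𝔽q L).coeff j = if i = j then c else 0 :=
  SkewPolynomial.coeff_monomial

theorem coeff_add (u w : TwistedPoly 𝔽q L) (i : ℕ) : (u + w).coeff i = u.coeff i + w.coeff i :=
  DFunLike.congr_fun
    (SkewMonoidAlgebra.coeff_add (k := L) (G := Multiplicative ℕ) u w) (Multiplicative.ofAdd i)

theorem coeff_zero (i : ℕ) : (0 : TwistedPoly 𝔽q L).coeff i = 0 := rfl

/-- The commutation rule: `c τⁱ · d τʲ = c d^(qⁱ) τ^(i+j)`. -/
theorem monomial_mul_monomial (i j : ℕ) (c d : L) :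
    (monomial i c * monomial j d : TwistedPoly 𝔽q L) =
      monomial (i + j) (c * d ^ Fintype.card 𝔽q ^ i) := by
  let _ := frobeniusAction 𝔽q L
  exact SkewMonoidAlgebra.single_mul_single

theorem monomial_zero_right (i : ℕ) : (monomial i 0 : TwistedPoly 𝔽q L) = 0 :=
  SkewPolynomial.monomial_zero_right i

theorem monomial_add (i : ℕ) (c d : L) :
    (monomial i (c + d) : TwistedPoly 𝔽q L) = monomial i c + monomial i d :=
  SkewPolynomial.monomial_add i c d

theorem monomial_zero_one : (monomial 0 1 : TwistedPoly 𝔽q L) = 1 := rfl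

theorem induction {motive : TwistedPoly 𝔽q L → Prop} (u : TwistedPoly 𝔽q L)
    (h0 : motive 0) (hm : ∀ i c, motive (monomial i c))
    (ha : ∀ u w, motive u → motive w → motive (u + w)) : motive u :=
  SkewPolynomial.induction u h0 fun i c w _ _ hw => ha (monomial i c) w (hm i c) hw

/-- `L{τ}` is an `𝔽q`-algebra: the constants from `𝔽q` are central since `c ^ q = c`. -/
instance : Algebra 𝔽q (TwistedPoly 𝔽q L) :=
  RingHom.toAlgebra'
    { toFun := fun c => monomial 0 (algebraMap 𝔽q L c)
      map_one' := by rw [map_one, monomial_zero_one]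
      map_mul' := fun c d => by
        rw [monomial_mul_monomial, pow_zero, pow_one, map_mul]
      map_zero' := by rw [map_zero, monomial_zero_right]
      map_add' := fun c d => by rw [map_add, monomial_add] }
    (fun c u => by
      change monomial 0 (algebraMap 𝔽q L c) * u = u * monomial 0 (algebraMap 𝔽q L c)
      induction u using TwistedPoly.induction with
      | h0 => rw [mul_zero, zero_mul]
      | hm i d =>
        rw [monomial_mul_monomial, monomial_mul_monomial, ← map_pow, FiniteField.pow_card_pow,
          pow_zero, pow_one, zero_add, add_zero, mul_comm]
      | ha u w hu hw => rw [mul_add, add_mul, hu, hw])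

/-- Evaluation of twisted polynomials at the points of an extension `Ω` of `L`:
`∑ cᵢ τⁱ` acts on `Ω` as `x ↦ ∑ cᵢ x ^ (qⁱ)`. -/
def eval (Ω : Type*) [CommRing Ω] [Algebra 𝔽q Ω] [Algebra L Ω] [IsScalarTower 𝔽q L Ω] :
    TwistedPoly 𝔽q L →+* AddMonoid.End Ω :=
  letI := frobeniusAction 𝔽q L
  letI := frobeniusAction 𝔽q Ω
  SkewMonoidAlgebra.liftNCRingHom (k := L) (G := Multiplicative ℕ) (R := AddMonoid.End Ω)
    { toFun := fun c => AddMonoidHom.mulLeft (algebraMap L Ω c)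
      map_one' := AddMonoidHom.ext fun x => by
        change algebraMap L Ω 1 * x = x
        rw [map_one, one_mul]
      map_mul' := fun a b => AddMonoidHom.ext fun x => by
        change algebraMap L Ω (a * b) * x = algebraMap L Ω a * (algebraMap L Ω b * x)
        rw [map_mul, mul_assoc]
      map_zero' := AddMonoidHom.ext fun x => by
        change algebraMap L Ω 0 * x = 0
        rw [map_zero, zero_mul]
      map_add' := fun a b => AddMonoidHom.ext fun x => by
        change algebraMap L Ω (a + b) * x = algebraMap L Ω a * x + algebraMap L Ω b * x
        rw [map_add, add_mul] }
    (DistribMulAction.toAddMonoidEnd (Multiplicative ℕ) Ω)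
    (by
      intro x m
      ext z
      change algebraMap L Ω (x ^ Fintype.card 𝔽q ^ m.toAdd) * z ^ Fintype.card 𝔽q ^ m.toAdd =
        (algebraMap L Ω x * z) ^ Fintype.card 𝔽q ^ m.toAdd
      rw [mul_pow, map_pow])

theorem eval_monomial (Ω : Type*) [CommRing Ω] [Algebra 𝔽q Ω] [Algebra L Ω]
    [IsScalarTower 𝔽q L Ω] (i : ℕ) (c : L) (x : Ω) :
    eval Ω (monomial i c : TwistedPoly 𝔽q L) x = algebraMap L Ω c * x ^ Fintype.card 𝔽q ^ i := by
  let _ := frobeniusAction 𝔽q L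
  let _ := frobeniusAction 𝔽q Ω
  exact congrArg (fun g : AddMonoid.End Ω => g x) (SkewMonoidAlgebra.liftNC_single _ _ _ _)

/-- Automorphisms of `Ω` over `L` commute with the evaluation of twisted polynomials. -/
theorem eval_algEquiv {Ω Ω' : Type*} [CommRing Ω] [Algebra 𝔽q Ω] [Algebra L Ω]
    [IsScalarTower 𝔽q L Ω] [CommRing Ω'] [Algebra 𝔽q Ω'] [Algebra L Ω'] [IsScalarTower 𝔽q L Ω']
    (σ : Ω →ₐ[L] Ω') (u : TwistedPoly 𝔽q L) (x : Ω) : σ (eval Ω u x) = eval Ω' u (σ x) := by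
  induction u using TwistedPoly.induction with
  | h0 => simp
  | hm i c => simp [eval_monomial]
  | ha u w hu hw =>
    rw [map_add, map_add]
    change σ (eval Ω u x + eval Ω w x) = eval Ω' u (σ x) + eval Ω' w (σ x)
    rw [map_add, hu, hw]

end TwistedPoly

/-! ### Drinfeld modules -/

/-- A Drinfeld `𝔽q[T]`-module of rank `r` over a field `L` with structure map `γ : A → L`:
a homomorphism `φ : A → L{τ}` with `φ_T = γ(T) + g₁ τ + ⋯ + g_r τʳ`, `g_r ≠ 0`, `r ≥ 1`. -/
structure DrinfeldModule (𝔽q L : Type*) [Field 𝔽q] [Fintype 𝔽q] [Field L] [Algebra 𝔽q L]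
    [Algebra 𝔽q[X] L] [IsScalarTower 𝔽q 𝔽q[X] L] (r : ℕ) where
  toAlgHom : 𝔽q[X] →ₐ[𝔽q] TwistedPoly 𝔽q L
  one_le_rank : 1 ≤ r
  coeff_zero : (toAlgHom X).coeff 0 = algebraMap 𝔽q[X] L X
  coeff_rank : (toAlgHom X).coeff r ≠ 0
  coeff_gt : ∀ i, r < i → (toAlgHom X).coeff i = 0

namespace DrinfeldModule

section General

variable {𝔽q L : Type*} [Field 𝔽q] [Fintype 𝔽q] [Field L] [Algebra 𝔽q L]
  [Algebra 𝔽q[X] L] [IsScalarTower 𝔽q 𝔽q[X] L] {r : ℕ} (φ : DrinfeldModule 𝔽q L r)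

/-- The coefficients `gᵢ` of `φ_T = ∑ gᵢ τⁱ`. -/
def g (i : ℕ) : L := (φ.toAlgHom X).coeff i

/-- The endomorphism ring `End_L(φ)`: the centralizer of `φ(A)` in `L{τ}`. -/
def End : Subring (TwistedPoly 𝔽q L) := Subring.centralizer (Set.range φ.toAlgHom)

/-- `End_L(φ)` is an `A`-algebra through `a ↦ φ_a`. -/
instance : Algebra 𝔽q[X] φ.End :=
  RingHom.toAlgebra'
    ((φ.toAlgHom : 𝔽q[X] →+* TwistedPoly 𝔽q L).codRestrict φ.End (by
      intro a
      rw [End, Subring.mem_centralizer_iff]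
      rintro _ ⟨b, rfl⟩
      change φ.toAlgHom b * φ.toAlgHom a = φ.toAlgHom a * φ.toAlgHom b
      rw [← map_mul, ← map_mul, mul_comm]))
    (fun a u => Subtype.ext ((Subring.mem_centralizer_iff.mp u.2) (φ.toAlgHom a) ⟨a, rfl⟩))

theorem coe_algebraMap_end (a : 𝔽q[X]) :
    ((algebraMap 𝔽q[X] φ.End a : φ.End) : TwistedPoly 𝔽q L) = φ.toAlgHom a := rfl

/-- For a finite field `L`, the Frobenius endomorphism `π = τ ^ [L : 𝔽q]` of `φ`. -/
def frob [Finite L] : φ.End :=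
  ⟨TwistedPoly.monomial (Module.finrank 𝔽q L) 1, by
    rw [End, Subring.mem_centralizer_iff]
    rintro _ ⟨b, rfl⟩
    induction φ.toAlgHom b using TwistedPoly.induction with
    | h0 => simp
    | hm i c =>
      have := Fintype.ofFinite L
      rw [TwistedPoly.monomial_mul_monomial, TwistedPoly.monomial_mul_monomial,
        ← Module.card_eq_pow_finrank (K := 𝔽q) (V := L), FiniteField.pow_card, one_pow, mul_one,
        one_mul, add_comm]
    | ha u w hu hw => rw [add_mul, mul_add, hu, hw]⟩

/-! ### Points, torsion, Tate modules -/

/-- The algebraic closure of `L`, as an `L{τ}`-module and, through `φ`, as an `A`-module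
and as an `End_L(φ)`-module. -/
def Points (_φ : DrinfeldModule 𝔽q L r) : Type _ := AlgebraicClosure L

instance : AddCommGroup φ.Points := inferInstanceAs (AddCommGroup (AlgebraicClosure L))

/-- The identification of the additive group of points with the algebraic closure. -/
def toPoints : AlgebraicClosure L ≃+ φ.Points := AddEquiv.refl _

instance : Module (TwistedPoly 𝔽q L) φ.Points :=
  Module.compHom (AlgebraicClosure L) (TwistedPoly.eval (𝔽q := 𝔽q) (L := L) (AlgebraicClosure L))

theorem smul_toPoints (u : TwistedPoly 𝔽q L) (x : AlgebraicClosure L) :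
    u • φ.toPoints x = φ.toPoints (TwistedPoly.eval (AlgebraicClosure L) u x) := rfl

instance : Module 𝔽q[X] φ.Points :=
  Module.compHom φ.Points (φ.toAlgHom : 𝔽q[X] →+* TwistedPoly 𝔽q L)

theorem smul_def (a : 𝔽q[X]) (x : φ.Points) : a • x = φ.toAlgHom a • x := rfl

theorem end_smul_def (u : φ.End) (x : φ.Points) : u • x = (u : TwistedPoly 𝔽q L) • x := rfl

instance : IsScalarTower 𝔽q[X] φ.End φ.Points where
  smul_assoc a u x := by
    rw [Algebra.smul_def, mul_smul]
    rfl

instance : SMulCommClass φ.End 𝔽q[X] φ.Points where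
  smul_comm u a x := by
    rw [← algebraMap_smul φ.End a x, ← mul_smul, ← Algebra.commutes, mul_smul, algebraMap_smul]

/-- The `n`-torsion `φ[n]`, an `A`-module (and an `A/nA`-module). -/
def torsion (n : 𝔽q[X]) : Submodule 𝔽q[X] φ.Points := Submodule.torsionBy 𝔽q[X] φ.Points n

instance (n : 𝔽q[X]) : Module (𝔽q[X] ⧸ Ideal.span {n}) (φ.torsion n) :=
  inferInstanceAs (Module (𝔽q[X] ⧸ Ideal.span {n}) (Submodule.torsionBy 𝔽q[X] φ.Points n))

/-- The `ℓ`-adic completion `A_ℓ` of `A`. -/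
abbrev Completion (ℓ : 𝔽q[X]) : Type _ := AdicCompletion (Ideal.span {ℓ}) 𝔽q[X]

/-- The `ℓ`-adic Tate module `T_ℓ(φ) = lim φ[ℓ^m]`, where the transition maps
`φ[ℓ^(m+1)] → φ[ℓ^m]` are multiplication by `ℓ`. -/
def TateModule (ℓ : 𝔽q[X]) : Submodule 𝔽q[X] (ℕ → φ.Points) where
  carrier := {x | (∀ m, ℓ ^ m • x m = 0) ∧ ∀ m, ℓ • x (m + 1) = x m}
  zero_mem' := by simp
  add_mem' := by
    rintro x y ⟨hx, hx'⟩ ⟨hy, hy'⟩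
    exact ⟨fun m => by simp [hx, hy], fun m => by simp [hx', hy']⟩
  smul_mem' := by
    rintro a x ⟨hx, hx'⟩
    refine ⟨fun m => ?_, fun m => ?_⟩
    · rw [Pi.smul_apply, smul_comm, hx, smul_zero]
    · rw [Pi.smul_apply, smul_comm, hx', Pi.smul_apply]

section Tate

variable {φ} {ℓ : 𝔽q[X]}

theorem TateModule.smul_eq_smul (x : φ.TateModule ℓ) (m : ℕ) {a b : 𝔽q[X]}
    (h : Ideal.Quotient.mk (Ideal.span {ℓ} ^ m) a = Ideal.Quotient.mk (Ideal.span {ℓ} ^ m) b) :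
    a • x.1 m = b • x.1 m := by
  rw [Ideal.Quotient.eq, Ideal.span_singleton_pow, Ideal.mem_span_singleton] at h
  obtain ⟨c, hc⟩ := h
  rw [← sub_eq_zero, ← sub_smul, hc, mul_comm, mul_smul, x.2.1 m, smul_zero]

/-- A representative in `A` of the image of `a ∈ A_ℓ` in `A / ℓ^m`. -/
def approx (a : Completion ℓ) (m : ℕ) : 𝔽q[X] :=
  (Ideal.Quotient.mk_surjective (AdicCompletion.evalₐ (Ideal.span {ℓ}) m a)).choose

theorem mk_approx (a : Completion ℓ) (m : ℕ) :
    Ideal.Quotient.mk (Ideal.span {ℓ} ^ m) (approx a m) =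
      AdicCompletion.evalₐ (Ideal.span {ℓ}) m a :=
  (Ideal.Quotient.mk_surjective (AdicCompletion.evalₐ (Ideal.span {ℓ}) m a)).choose_spec

theorem mk_approx_succ (a : Completion ℓ) (m : ℕ) :
    Ideal.Quotient.mk (Ideal.span {ℓ} ^ m) (approx a (m + 1)) =
      Ideal.Quotient.mk (Ideal.span {ℓ} ^ m) (approx a m) := by
  have h := congrArg (Ideal.Quotient.factor (Ideal.pow_le_pow_right (Nat.le_succ m)))
    (mk_approx a (m + 1))
  rw [Ideal.Quotient.factor_mk] at h
  rw [h, mk_approx]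
  induction a using AdicCompletion.induction_on with
  | _ s =>
    rw [AdicCompletion.evalₐ_mk, AdicCompletion.evalₐ_mk, Ideal.Quotient.factor_mk]
    have h' := (s.2 (Nat.le_succ m)).symm
    rw [SModEq.sub_mem, smul_eq_mul, Ideal.mul_top] at h'
    exact Ideal.Quotient.eq.mpr h'

/-- `A_ℓ` acts on `T_ℓ(φ)`: on the `m`-th component through its quotient `A / ℓ^m`. -/
instance : SMul (Completion ℓ) (φ.TateModule ℓ) where
  smul a x := ⟨fun m => approx a m • x.1 m, fun m => by rw [smul_comm, x.2.1 m, smul_zero],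
    fun m => by
      change ℓ • approx a (m + 1) • x.1 (m + 1) = approx a m • x.1 m
      rw [smul_comm, x.2.2 m]
      exact TateModule.smul_eq_smul x m (mk_approx_succ a m)⟩

theorem TateModule.completion_smul_apply (a : Completion ℓ) (x : φ.TateModule ℓ) (m : ℕ)
    {c : 𝔽q[X]}
    (h : Ideal.Quotient.mk (Ideal.span {ℓ} ^ m) c = AdicCompletion.evalₐ (Ideal.span {ℓ}) m a) :
    (a • x).1 m = c • x.1 m :=
  TateModule.smul_eq_smul x m ((mk_approx a m).trans h.symm)

instance : Module (Completion ℓ) (φ.TateModule ℓ) where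
  one_smul x := by
    ext m
    rw [TateModule.completion_smul_apply 1 x m (c := 1) (by simp), one_smul]
  mul_smul a b x := by
    ext m
    rw [TateModule.completion_smul_apply (a * b) x m (c := approx a m * approx b m)
      (by simp [mk_approx]), mul_smul]
    rfl
  smul_zero a := by
    ext m
    exact smul_zero _
  smul_add a x y := by
    ext m
    exact smul_add _ _ _
  add_smul a b x := by
    ext m
    rw [TateModule.completion_smul_apply (a + b) x m (c := approx a m + approx b m)
      (by simp [mk_approx]), add_smul]
    rfl
  zero_smul x := by
    ext m
    rw [TateModule.completion_smul_apply 0 x m (c := 0) (by simp), zero_smul]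
    rfl

/-- `End_L(φ)` acts on `T_ℓ(φ)` componentwise. -/
instance : SMul φ.End (φ.TateModule ℓ) where
  smul u x := ⟨fun m => u • x.1 m, fun m => by rw [← smul_comm, x.2.1 m, smul_zero],
    fun m => by rw [← smul_comm, x.2.2 m]⟩

theorem TateModule.end_smul_apply (u : φ.End) (x : φ.TateModule ℓ) (m : ℕ) :
    (u • x).1 m = u • x.1 m := rfl

instance : Module φ.End (φ.TateModule ℓ) where
  one_smul x := by ext m; exact one_smul _ _
  mul_smul u w x := by ext m; exact mul_smul _ _ _
  smul_zero u := by ext m; exact smul_zero _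
  smul_add u x y := by ext m; exact smul_add _ _ _
  add_smul u w x := by ext m; exact add_smul _ _ _
  zero_smul x := by ext m; exact zero_smul _ _

instance : IsScalarTower 𝔽q[X] φ.End (φ.TateModule ℓ) where
  smul_assoc a u x := by ext m; exact smul_assoc _ _ _

instance : IsScalarTower 𝔽q[X] (Completion ℓ) (φ.TateModule ℓ) where
  smul_assoc a b x := by
    ext m
    rw [TateModule.completion_smul_apply (a • b) x m (c := a * approx b m)
      (by rw [map_mul, mk_approx, map_smul, Algebra.smul_def]; rfl), mul_smul]
    rfl

instance : SMulCommClass φ.End (Completion ℓ) (φ.TateModule ℓ) where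
  smul_comm u a x := by ext m; exact smul_comm _ _ _

end Tate

/-- The ring `ℰ_ℓ = ℰ ⊗_A A_ℓ` for `ℰ = End_L(φ)`. -/
abbrev EndCompletion (ℓ : 𝔽q[X]) : Type _ := φ.End ⊗[𝔽q[X]] Completion ℓ

/-- The action of `ℰ ⊗_A A_ℓ` on `T_ℓ(φ)`: `(u ⊗ a) x = u (a x)`. -/
instance (ℓ : 𝔽q[X]) : Module (φ.EndCompletion ℓ) (φ.TateModule ℓ) :=
  TensorProduct.Algebra.module

/-- `T_ℓ(φ)` is a free `ℰ_ℓ`-module of rank `1`. -/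
def TateModuleIsFreeOfRankOne (ℓ : 𝔽q[X]) : Prop :=
  letI : Semiring (φ.EndCompletion ℓ) := inferInstance
  Nonempty (φ.TateModule ℓ ≃ₗ[φ.EndCompletion ℓ] φ.EndCompletion ℓ)

/-! ### Division fields and their Galois representations -/

/-- The division field `L(φ[n])`, generated by the `n`-torsion points. -/
def divisionField (n : 𝔽q[X]) : IntermediateField L (AlgebraicClosure L) :=
  IntermediateField.adjoin L {x : AlgebraicClosure L | φ.toPoints x ∈ φ.torsion n}

theorem mem_divisionField {n : 𝔽q[X]} (x : φ.torsion n) :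
    φ.toPoints.symm x ∈ φ.divisionField n :=
  IntermediateField.subset_adjoin _ _ (by simp)

/-- The inclusion of the division field in the points of `φ`. -/
def fieldToPoints (n : 𝔽q[X]) (y : φ.divisionField n) : φ.Points :=
  φ.toPoints (y : AlgebraicClosure L)

theorem fieldToPoints_map {n : 𝔽q[X]} (σ : φ.divisionField n ≃ₐ[L] φ.divisionField n)
    (a : 𝔽q[X]) (y z : φ.divisionField n)
    (h : a • φ.fieldToPoints n y = φ.fieldToPoints n z) :
    a • φ.fieldToPoints n (σ y) = φ.fieldToPoints n (σ z) := by
  have key : ∀ w : φ.divisionField n, a • φ.fieldToPoints n w =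
      φ.fieldToPoints n (TwistedPoly.eval (φ.divisionField n) (φ.toAlgHom a) w) := fun w =>
    (TwistedPoly.eval_algEquiv (φ.divisionField n).val (φ.toAlgHom a) w).symm
  rw [key] at h ⊢
  have h' : TwistedPoly.eval (φ.divisionField n) (φ.toAlgHom a) y = z := Subtype.ext h
  rw [← h']
  exact congrArg _ (TwistedPoly.eval_algEquiv (σ : φ.divisionField n →ₐ[L] φ.divisionField n)
    (φ.toAlgHom a) y).symm

/-- A torsion point, as an element of the division field. -/
def torsionToField {n : 𝔽q[X]} (x : φ.torsion n) : φ.divisionField n :=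
  ⟨φ.toPoints.symm x, φ.mem_divisionField x⟩

/-- The action of `Gal(L(φ[n])/L)` on `φ[n]`, which is `A/nA`-linear. -/
def galRep (n : 𝔽q[X]) : (φ.divisionField n ≃ₐ[L] φ.divisionField n) →*
    Module.End (𝔽q[X] ⧸ Ideal.span {n}) (φ.torsion n) where
  toFun σ :=
    { toFun := fun x => ⟨φ.fieldToPoints n (σ (φ.torsionToField x)), by
        have h := φ.fieldToPoints_map σ n (φ.torsionToField x) 0 (x.2.trans (map_zero _).symm)
        rw [map_zero] at h
        exact h.trans (map_zero _)⟩
      map_add' := fun x y => Subtype.ext (by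
        exact congrArg (φ.fieldToPoints n)
          (map_add σ (φ.torsionToField x) (φ.torsionToField y)))
      map_smul' := fun a x => Subtype.ext (by
        obtain ⟨a, rfl⟩ := Ideal.Quotient.mk_surjective a
        exact (φ.fieldToPoints_map σ a (φ.torsionToField x) (φ.torsionToField (a • x)) rfl).symm) }
  map_one' := rfl
  map_mul' _ _ := rfl

/-- The homomorphism `Gal(L(φ[n])/L) → GL_r(A/nA)` given by the action on `φ[n]` in terms of an
`A/nA`-basis (the columns of a matrix are the coordinates of the images of the basis vectors). -/
def galMatrixRep {n : 𝔽q[X]} (β : Module.Basis (Fin r) (𝔽q[X] ⧸ Ideal.span {n}) (φ.torsion n)) :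
    (φ.divisionField n ≃ₐ[L] φ.divisionField n) →* GL (Fin r) (𝔽q[X] ⧸ Ideal.span {n}) :=
  (Units.map (LinearMap.toMatrixAlgEquiv β : _ →* Matrix (Fin r) (Fin r) _)).comp
    (φ.galRep n).toHomUnits

/-- `σ ∈ Gal(L(φ[n])/L)` is a Frobenius element at the prime `𝔓` of the integral closure of `A`
in `L(φ[n])`: `σ x ≡ x ^ #(A/𝔭) (mod 𝔓)` for all integral `x`, where `𝔭 = 𝔓 ∩ A`. -/
def IsFrobeniusAt {n : 𝔽q[X]} (σ : φ.divisionField n ≃ₐ[L] φ.divisionField n)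
    (𝔓 : Ideal (integralClosure 𝔽q[X] (φ.divisionField n))) : Prop :=
  IsArithFrobAt 𝔽q[X] σ 𝔓

/-! ### The Frobenius index and the matrix of the Frobenius -/

/-- The data that define the matrix of the Frobenius endomorphism `π` of a Drinfeld module over
a finite field `L`, with `ℰ = End_L(φ)`.  Everything is indexed from `0`, with `b₀ = 1`, `f₀ = 1`.
* `b` is the Frobenius index: `b₁ ∣ ⋯ ∣ b_{r-1}` are monic and
  `ℰ / A[π] ≅ A/b₁ × ⋯ × A/b_{r-1}` as `A`-modules;
* `f i` is a monic polynomial of degree `i` over `A`;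
* `1, f₁(π)/b₁, …, f_{r-1}(π)/b_{r-1}` is an `A`-basis of `ℰ`. -/
structure FrobeniusBasis [Finite L] where
  b : Fin r → 𝔽q[X]
  f : Fin r → 𝔽q[X][X]
  basis : Module.Basis (Fin r) 𝔽q[X] φ.End
  b_monic : ∀ i, (b i).Monic
  b_zero : ∀ i : Fin r, (i : ℕ) = 0 → b i = 1
  b_dvd : ∀ i j : Fin r, i ≤ j → b i ∣ b j
  index : Nonempty ((φ.End ⧸ Subalgebra.toSubmodule (Algebra.adjoin 𝔽q[X] {φ.frob})) ≃ₗ[𝔽q[X]]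
    ((i : Fin r) → 𝔽q[X] ⧸ Ideal.span {b i}))
  f_monic : ∀ i, (f i).Monic
  f_natDegree : ∀ i, (f i).natDegree = i
  smul_basis : ∀ i, b i • basis i = aeval φ.frob (f i)

/-- The matrix of multiplication by `π` on `ℰ`, in the basis `1, f₁(π)/b₁, …, f_{r-1}(π)/b_{r-1}`
(the `j`-th column holds the coordinates of `π` times the `j`-th basis vector). -/
def FrobeniusBasis.matrix {φ : DrinfeldModule 𝔽q L r} [Finite L] (D : φ.FrobeniusBasis) :
    Matrix (Fin r) (Fin r) 𝔽q[X] :=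
  LinearMap.toMatrix D.basis D.basis (LinearMap.mulLeft 𝔽q[X] φ.frob)

/-- The polynomial `f_i` for `i < r`, and the minimal polynomial `P` of `π` over `A` for `i = r`. -/
def FrobeniusBasis.poly {φ : DrinfeldModule 𝔽q L r} [Finite L] (D : φ.FrobeniusBasis) (i : ℕ) :
    𝔽q[X][X] :=
  if h : i < r then D.f ⟨i, h⟩ else minpoly 𝔽q[X] φ.frob

/-- The displayed shape of the matrix of `π`: it is upper Hessenberg, with subdiagonal entries
`b₁, b₂/b₁, …, b_{r-1}/b_{r-2}` and diagonal entries
`-a₁₀, a₁₀ - a₂₁, …, a_{r-1,r-2} - c_{r-1}`, where `a_{i,i-1}` and `c_{r-1}` are the second highest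
coefficients of `f_i` and of `P`. -/
def FrobeniusBasis.HasExplicitShape {φ : DrinfeldModule 𝔽q L r} [Finite L]
    (D : φ.FrobeniusBasis) : Prop :=
  ∀ i j : Fin r,
    ((j : ℕ) + 1 < i → D.matrix i j = 0) ∧
    ((i : ℕ) = j + 1 → D.b j * D.matrix i j = D.b i) ∧
    (i = j → D.matrix i j = (D.poly j).nextCoeff - (D.poly (j + 1)).nextCoeff)

end General

/-! ### Reduction at a prime -/

section Reduction

variable {𝔽q : Type*} [Field 𝔽q] [Fintype 𝔽q] (v : HeightOneSpectrum 𝔽q[X])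

/-- The residue field `𝔽_𝔭 = A/𝔭`. -/
instance : Field (𝔽q[X] ⧸ v.asIdeal) := Ideal.Quotient.field v.asIdeal

instance : Finite (𝔽q[X] ⧸ v.asIdeal) := by
  obtain ⟨a, ha⟩ := (IsPrincipalIdealRing.principal v.asIdeal).principal
  have ha0 : a ≠ 0 := by
    rintro rfl
    exact v.ne_bot (by rw [ha]; simp)
  have : Module.Finite 𝔽q (AdjoinRoot a) := (AdjoinRoot.powerBasis ha0).finite
  have : Finite (AdjoinRoot a) := Module.finite_of_finite 𝔽q
  exact Finite.of_equiv (AdjoinRoot a) (Ideal.quotEquivOfEq ha.symm).toEquiv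

variable {F : Type*} [Field F] [Algebra 𝔽q F] [Algebra 𝔽q[X] F] [IsScalarTower 𝔽q 𝔽q[X] F]
  [IsFractionRing 𝔽q[X] F] {r : ℕ}

/-- The reduction modulo `𝔭` of an element `x` of `F` that is integral at `𝔭`: if `x = a/b` in
lowest terms, then `b ∉ 𝔭` and the reduction of `x` is `(a mod 𝔭)/(b mod 𝔭)`. -/
def reduceElt (x : F) : 𝔽q[X] ⧸ v.asIdeal :=
  Ideal.Quotient.mk v.asIdeal (IsFractionRing.num 𝔽q[X] x) /
    Ideal.Quotient.mk v.asIdeal (IsFractionRing.den 𝔽q[X] x : 𝔽q[X])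

theorem reduceElt_algebraMap (a : 𝔽q[X]) :
    reduceElt v (algebraMap 𝔽q[X] F a) = Ideal.Quotient.mk v.asIdeal a := by
  set x := algebraMap 𝔽q[X] F a with hx
  have hmul : IsFractionRing.num 𝔽q[X] x = a * (IsFractionRing.den 𝔽q[X] x : 𝔽q[X]) := by
    apply IsFractionRing.injective 𝔽q[X] F
    rw [map_mul, ← hx]
    exact (IsFractionRing.num_mul_den_eq_num_iff_eq.mpr rfl).symm
  have hu : IsUnit (IsFractionRing.den 𝔽q[X] x : 𝔽q[X]) :=
    IsFractionRing.num_den_reduced 𝔽q[X] x (hmul ▸ dvd_mul_left _ _) dvd_rfl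
  rw [reduceElt, div_eq_iff (hu.map (Ideal.Quotient.mk v.asIdeal)).ne_zero, ← map_mul, ← hmul]

theorem reduceElt_ne_zero {x : F} (hx : v.valuation F x = 1) : reduceElt v x ≠ 0 := by
  have hmul : algebraMap 𝔽q[X] F (IsFractionRing.num 𝔽q[X] x) =
      x * algebraMap 𝔽q[X] F (IsFractionRing.den 𝔽q[X] x : 𝔽q[X]) :=
    (IsFractionRing.num_mul_den_eq_num_iff_eq.mpr rfl).symm
  have hval := congrArg (v.valuation F) hmul
  rw [map_mul, hx, one_mul] at hval
  have hiff : IsFractionRing.num 𝔽q[X] x ∈ v.asIdeal ↔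
      (IsFractionRing.den 𝔽q[X] x : 𝔽q[X]) ∈ v.asIdeal := by
    rw [← v.valuation_lt_one_iff_mem (K := F), ← v.valuation_lt_one_iff_mem (K := F), hval]
  have hden : (IsFractionRing.den 𝔽q[X] x : 𝔽q[X]) ∉ v.asIdeal := by
    intro hd
    have hn := hiff.mpr hd
    obtain ⟨a, ha⟩ := (IsPrincipalIdealRing.principal v.asIdeal).principal
    have hau : IsUnit a := by
      rw [ha] at hn hd
      exact IsFractionRing.num_den_reduced 𝔽q[X] x (Ideal.mem_span_singleton.mp hn)
        (Ideal.mem_span_singleton.mp hd)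
    exact v.isPrime.ne_top (ha.trans (Ideal.span_singleton_eq_top.mpr hau))
  rw [reduceElt]
  refine div_ne_zero ?_ ?_
  · rwa [Ne, Ideal.Quotient.eq_zero_iff_mem, hiff]
  · rwa [Ne, Ideal.Quotient.eq_zero_iff_mem]

/-- `𝔭` is a prime of good reduction for `Φ`: `ord_𝔭(gᵢ) ≥ 0` for `1 ≤ i ≤ r - 1` and
`ord_𝔭(g_r) = 0`. -/
def HasGoodReduction (Φ : DrinfeldModule 𝔽q F r) : Prop :=
  (∀ i, 1 ≤ i → i < r → v.valuation F (Φ.g i) ≤ 1) ∧ v.valuation F (Φ.g r) = 1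

/-- The reduction of `Φ` at a prime `𝔭` of good reduction: the Drinfeld module over `A/𝔭` whose
value at `T` is obtained from `Φ_T` by reducing the coefficients modulo `𝔭`. -/
def reduction (Φ : DrinfeldModule 𝔽q F r) (h : HasGoodReduction v Φ) :
    DrinfeldModule 𝔽q (𝔽q[X] ⧸ v.asIdeal) r :=
  have hc : ∀ j, (aeval (∑ i ∈ Finset.range (r + 1),
      (TwistedPoly.monomial i (reduceElt v (Φ.g i)) :
        TwistedPoly 𝔽q (𝔽q[X] ⧸ v.asIdeal))) (X : 𝔽q[X])).coeff j =
      if j < r + 1 then reduceElt v (Φ.g j) else 0 := by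
    intro j
    rw [aeval_X]
    have hs : ∀ s : Finset ℕ, (∑ i ∈ s, (TwistedPoly.monomial i (reduceElt v (Φ.g i)) :
        TwistedPoly 𝔽q (𝔽q[X] ⧸ v.asIdeal))).coeff j =
        if j ∈ s then reduceElt v (Φ.g j) else 0 := by
      intro s
      induction s using Finset.induction_on with
      | empty => simp [TwistedPoly.coeff_zero]
      | insert i s hi ih =>
        rw [Finset.sum_insert hi, TwistedPoly.coeff_add, ih, TwistedPoly.coeff_monomial]
        by_cases hij : i = j
        · subst hij; simp [hi]
        · simp [hij, Ne.symm hij]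
    simpa using hs (Finset.range (r + 1))
  { toAlgHom := aeval (∑ i ∈ Finset.range (r + 1), TwistedPoly.monomial i (reduceElt v (Φ.g i)))
    one_le_rank := Φ.one_le_rank
    coeff_zero := by
      rw [hc, if_pos (Nat.succ_pos r), g, Φ.coeff_zero]
      exact reduceElt_algebraMap v X
    coeff_rank := by
      rw [hc, if_pos (Nat.lt_succ_self r)]
      exact reduceElt_ne_zero v h.2
    coeff_gt := fun i hi => by
      rw [hc, if_neg (by omega)] }

end Reduction

end DrinfeldModule

end

/-! Everything rests on degrees in `L{τ}`, on counting, and on the fact that `φ_n` corresponds to an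
additive polynomial with constant derivative `γ(n)`.

Torsion. If `γ(n) ≠ 0`, that polynomial is separable of degree `q ^ (r deg n)`, so `φ[n]` has
`#(A/n) ^ r` elements. For irreducible `ℓ` this fixes the dimension of `φ[ℓ]` over `A/ℓ`.
Divisibility of the points and coprime splitting then give `r` independent points in `φ[n]`
(`exists_independent_torsion`). The division field is the splitting field of a separable polynomial,
hence Galois, and it is generated by the points on which the Galois group acts.

Endomorphisms. Over `𝔽_𝔭 = A/𝔭`, comparing lowest coefficients in `φ_T u = u φ_T` shows that an
endomorphism without constant term is divisible by `π`; hence `ℰ = A + ℰπ`. Iteration makes every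
commutator divisible by all powers of `π`, so `ℰ` is commutative. Counting endomorphisms of bounded
degree, once through `ℰ/πℰ` and once through `ℰ/Tℰ`, gives rank `r` (`finrank_end`). Nakayama's
lemma gives a nonzero `D ∈ A` with `Dℰ ⊆ A[π]`. Choosing elements of `ℰ` with minimal leading
coefficient in `π` then yields the triangular basis (`exists_triangular_basis`), and comparing
coefficients of `π e_j` yields the shape of the matrix (`hessenberg_of_triangular`).

Reduction. A prime `𝔓` above `𝔭` is the kernel of a map `ψ` to an algebraic closure of `𝔽_𝔭`. It
extends to fractions with denominator outside `𝔓`, among them the torsion points, because good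
reduction preserves the degree of `Φ_n`. Reduction is injective on `Φ[n]` since `n ∉ 𝔭`, and
bijective by counting (`exists_torsion_reduction`). It turns an automorphism that is the `q^j`-th
power modulo `𝔓` into `τ^j` on `φ[n]`. With `j = 0` the inertia group is trivial, so `𝔓` is
unramified; with `j = deg 𝔭` a Frobenius element acts as `π`.

Matrix. If the Tate modules are free of rank one, `φ[n]` is generated by one point `w` over `ℰ`
(`exists_end_generator`). Applying an `A`-basis of `ℰ` to `w` gives a basis of `φ[n]`, in which `π`
has the matrix of multiplication by `π` on `ℰ`. A change of basis is a conjugation. -/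

set_option linter.unusedSectionVars false

noncomputable section

/-! ### Coefficients, degrees and additive polynomials of twisted polynomials. -/

namespace TwistedPoly

variable {𝔽q L : Type*} [Field 𝔽q] [Fintype 𝔽q] [CommRing L] [Algebra 𝔽q L]

variable (𝔽q) in
theorem add_pow_card_pow (x y : L) (i : ℕ) :
    (x + y) ^ Fintype.card 𝔽q ^ i = x ^ Fintype.card 𝔽q ^ i + y ^ Fintype.card 𝔽q ^ i :=
  (frobeniusAction 𝔽q L).smul_add (Multiplicative.ofAdd i) x y

variable (𝔽q) in
theorem zero_pow_card_pow {L : Type*} [CommRing L] (i : ℕ) : (0 : L) ^ Fintype.card 𝔽q ^ i = 0 :=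
  zero_pow (pow_ne_zero _ Fintype.card_ne_zero)

/-- The coefficient of `τⁱ`, as an additive map. -/
def coeffHom (i : ℕ) : TwistedPoly 𝔽q L →+ L where
  toFun u := u.coeff i
  map_zero' := coeff_zero i
  map_add' u w := coeff_add u w i

theorem coeff_neg (u : TwistedPoly 𝔽q L) (i : ℕ) : (-u).coeff i = -u.coeff i :=
  map_neg (coeffHom i) u

theorem coeff_sub (u w : TwistedPoly 𝔽q L) (i : ℕ) : (u - w).coeff i = u.coeff i - w.coeff i :=
  map_sub (coeffHom i) u w

theorem coeff_sum {ι : Type*} (s : Finset ι) (u : ι → TwistedPoly 𝔽q L) (i : ℕ) :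
    (∑ j ∈ s, u j).coeff i = ∑ j ∈ s, (u j).coeff i :=
  map_sum (coeffHom i) u s

theorem ext {u w : TwistedPoly 𝔽q L} (h : ∀ i, u.coeff i = w.coeff i) : u = w :=
  SkewMonoidAlgebra.ext fun a => h a.toAdd

theorem coeff_monomial_mul (i j : ℕ) (c : L) (w : TwistedPoly 𝔽q L) :
    (monomial i c * w).coeff (i + j) = c * w.coeff j ^ Fintype.card 𝔽q ^ i := by
  induction w using TwistedPoly.induction with
  | h0 => rw [mul_zero, coeff_zero, coeff_zero, zero_pow_card_pow, mul_zero]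
  | hm k d =>
    rw [monomial_mul_monomial, coeff_monomial, coeff_monomial]
    by_cases h : k = j
    · simp [h]
    · simp [h]
  | ha u w hu hw => rw [mul_add, coeff_add, hu, hw, coeff_add, add_pow_card_pow, mul_add]

theorem coeff_monomial_mul_of_lt {i j : ℕ} (h : j < i) (c : L) (w : TwistedPoly 𝔽q L) :
    (monomial i c * w).coeff j = 0 := by
  induction w using TwistedPoly.induction with
  | h0 => rw [mul_zero, coeff_zero]
  | hm k d => rw [monomial_mul_monomial, coeff_monomial, if_neg (by omega)]
  | ha u w hu hw => rw [mul_add, coeff_add, hu, hw, add_zero]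

theorem coeff_mul (u w : TwistedPoly 𝔽q L) (n : ℕ) :
    (u * w).coeff n = ∑ p ∈ Finset.HasAntidiagonal.antidiagonal n,
      u.coeff p.1 * w.coeff p.2 ^ Fintype.card 𝔽q ^ p.1 := by
  induction u using TwistedPoly.induction with
  | h0 => simp [coeff_zero]
  | hm i c =>
    simp only [coeff_monomial, ite_mul, zero_mul]
    rw [← Finset.sum_filter]
    by_cases hi : i ≤ n
    · obtain ⟨j, rfl⟩ := Nat.exists_eq_add_of_le hi
      rw [coeff_monomial_mul, Finset.sum_eq_single (i, j)]
      · rintro ⟨a, b⟩ hab hne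
        simp only [Finset.mem_filter, Finset.HasAntidiagonal.mem_antidiagonal] at hab
        exact absurd (Prod.ext (by simp; omega) (by simp; omega)) hne
      · intro h
        simp at h
    · rw [coeff_monomial_mul_of_lt (by omega), Finset.sum_eq_zero]
      rintro ⟨a, b⟩ hab
      simp only [Finset.mem_filter, Finset.HasAntidiagonal.mem_antidiagonal] at hab
      omega
  | ha u v hu hv =>
    rw [add_mul, coeff_add, hu, hv, ← Finset.sum_add_distrib]
    exact Finset.sum_congr rfl fun p _ => by rw [coeff_add, add_mul]

theorem coeff_one (i : ℕ) : (1 : TwistedPoly 𝔽q L).coeff i = if 0 = i then 1 else 0 := by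
  rw [← monomial_zero_one, coeff_monomial]

theorem coeff_algebraMap (c : 𝔽q) (i : ℕ) :
    (algebraMap 𝔽q (TwistedPoly 𝔽q L) c).coeff i = if 0 = i then algebraMap 𝔽q L c else 0 :=
  coeff_monomial _ _ _

/-- The constant coefficient, as a ring homomorphism. -/
def constCoeff : TwistedPoly 𝔽q L →ₐ[𝔽q] L where
  toFun u := u.coeff 0
  map_zero' := coeff_zero 0
  map_add' u w := coeff_add u w 0
  map_one' := by rw [coeff_one, if_pos rfl]
  map_mul' u w := by rw [coeff_mul]; simp
  commutes' c := by rw [coeff_algebraMap, if_pos rfl]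

/-- The twisted polynomials of degree at most `N`. -/
def degreeLE (𝔽q L : Type*) [Field 𝔽q] [Fintype 𝔽q] [CommRing L] [Algebra 𝔽q L] (N : ℕ) :
    AddSubgroup (TwistedPoly 𝔽q L) where
  carrier := {u | ∀ i, N < i → u.coeff i = 0}
  zero_mem' i _ := coeff_zero i
  add_mem' hu hw i hi := by rw [coeff_add, hu i hi, hw i hi, add_zero]
  neg_mem' hu i hi := by rw [coeff_neg, hu i hi, neg_zero]

theorem degreeLE_mono {M N : ℕ} (h : M ≤ N) : degreeLE 𝔽q L M ≤ degreeLE 𝔽q L N :=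
  fun _ hu i hi => hu i (by omega)

theorem monomial_mem_degreeLE {i N : ℕ} (h : i ≤ N) (c : L) :
    (monomial i c : TwistedPoly 𝔽q L) ∈ degreeLE 𝔽q L N := fun j hj => by
  rw [coeff_monomial, if_neg (by omega)]

theorem exists_mem_degreeLE (u : TwistedPoly 𝔽q L) : ∃ N, u ∈ degreeLE 𝔽q L N := by
  induction u using TwistedPoly.induction with
  | h0 => exact ⟨0, zero_mem _⟩
  | hm i c => exact ⟨i, monomial_mem_degreeLE le_rfl c⟩
  | ha u w hu hw =>
    obtain ⟨M, hM⟩ := hu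
    obtain ⟨N, hN⟩ := hw
    exact ⟨max M N, add_mem (degreeLE_mono (le_max_left _ _) hM)
      (degreeLE_mono (le_max_right _ _) hN)⟩

theorem eq_sum_monomial {u : TwistedPoly 𝔽q L} {N : ℕ} (hu : u ∈ degreeLE 𝔽q L N) :
    u = ∑ i ∈ Finset.range (N + 1), monomial i (u.coeff i) := by
  refine ext fun j => ?_
  simp only [coeff_sum, coeff_monomial, Finset.sum_ite_eq', Finset.mem_range]
  split_ifs with h
  · rfl
  · exact hu j (by omega)

instance [Finite L] (N : ℕ) : Finite (degreeLE 𝔽q L N) := by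
  refine Finite.of_injective (fun u : degreeLE 𝔽q L N => fun i : Fin (N + 1) => u.1.coeff i) ?_
  intro u w h
  refine Subtype.ext (ext fun i => ?_)
  by_cases hi : i < N + 1
  · exact congrFun h ⟨i, hi⟩
  · rw [u.2 i (by omega), w.2 i (by omega)]

theorem mul_mem_degreeLE {u w : TwistedPoly 𝔽q L} {M N : ℕ} (hu : u ∈ degreeLE 𝔽q L M)
    (hw : w ∈ degreeLE 𝔽q L N) : u * w ∈ degreeLE 𝔽q L (M + N) := by
  intro i hi
  rw [coeff_mul]
  refine Finset.sum_eq_zero fun p hp => ?_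
  rw [Finset.HasAntidiagonal.mem_antidiagonal] at hp
  by_cases h : M < p.1
  · rw [hu _ h, zero_mul]
  · rw [hw _ (by omega), zero_pow_card_pow, mul_zero]

theorem coeff_mul_degree {u w : TwistedPoly 𝔽q L} {M N : ℕ} (hu : u ∈ degreeLE 𝔽q L M)
    (hw : w ∈ degreeLE 𝔽q L N) :
    (u * w).coeff (M + N) = u.coeff M * w.coeff N ^ Fintype.card 𝔽q ^ M := by
  rw [coeff_mul]
  refine Finset.sum_eq_single (M, N) ?_ (fun h => by simp at h)
  rintro ⟨a, b⟩ hab hne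
  simp only [Finset.HasAntidiagonal.mem_antidiagonal] at hab
  rcases lt_trichotomy M a with h | h | h
  · simp [hu _ h]
  · exact absurd (Prod.ext h.symm (by simp; omega)) hne
  · simp [hw b (by omega)]

/-- `u` has degree exactly `m`. -/
def HasDegree (u : TwistedPoly 𝔽q L) (m : ℕ) : Prop :=
  u ∈ degreeLE 𝔽q L m ∧ u.coeff m ≠ 0

theorem HasDegree.ne_zero {u : TwistedPoly 𝔽q L} {m : ℕ} (h : u.HasDegree m) : u ≠ 0 := by
  rintro rfl
  exact h.2 (coeff_zero m)

theorem exists_hasDegree {u : TwistedPoly 𝔽q L} (hu : u ≠ 0) : ∃ m, u.HasDegree m := by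
  classical
  have h := exists_mem_degreeLE u
  refine ⟨Nat.find h, Nat.find_spec h, fun h0 => ?_⟩
  rcases Nat.eq_zero_or_pos (Nat.find h) with hz | hz
  · refine hu (ext fun i => ?_)
    rw [coeff_zero]
    rcases Nat.eq_zero_or_pos i with rfl | hi
    · rwa [hz] at h0
    · exact Nat.find_spec h i (by omega)
  · refine Nat.find_min h (m := Nat.find h - 1) (by omega) fun i hi => ?_
    rcases (show Nat.find h ≤ i by omega).eq_or_lt with h' | h'
    · rwa [← h']
    · exact Nat.find_spec h i h'

theorem HasDegree.mul [IsDomain L] {u w : TwistedPoly 𝔽q L} {M N : ℕ} (hu : u.HasDegree M)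
    (hw : w.HasDegree N) : (u * w).HasDegree (M + N) :=
  ⟨mul_mem_degreeLE hu.1 hw.1, by
    rw [coeff_mul_degree hu.1 hw.1]
    exact mul_ne_zero hu.2 (pow_ne_zero _ hw.2)⟩

theorem hasDegree_one [Nontrivial L] : (1 : TwistedPoly 𝔽q L).HasDegree 0 :=
  ⟨fun i hi => by rw [coeff_one, if_neg (by omega)], by simp [coeff_one]⟩

theorem HasDegree.pow [IsDomain L] {u : TwistedPoly 𝔽q L} {M : ℕ} (hu : u.HasDegree M) (k : ℕ) :
    (u ^ k).HasDegree (k * M) := by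
  induction k with
  | zero => simpa using hasDegree_one
  | succ k ih =>
    rw [pow_succ, add_mul, one_mul]
    exact ih.mul hu

theorem HasDegree.eq {u : TwistedPoly 𝔽q L} {M N : ℕ} (h : u.HasDegree M) (h' : u.HasDegree N) :
    M = N := by
  rcases lt_trichotomy M N with hlt | he | hlt
  · exact absurd (h.1 _ hlt) h'.2
  · exact he
  · exact absurd (h'.1 _ hlt) h.2

theorem HasDegree.mem_of_mul_mem [IsDomain L] {u w : TwistedPoly 𝔽q L} {M N : ℕ}
    (hu : u.HasDegree M) (h : u * w ∈ degreeLE 𝔽q L (N + M)) : w ∈ degreeLE 𝔽q L N := by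
  by_cases hw : w = 0
  · rw [hw]; exact zero_mem _
  obtain ⟨k, hk⟩ := exists_hasDegree hw
  refine degreeLE_mono ?_ hk.1
  by_contra hlt
  exact (hu.mul hk).2 (h _ (by omega))

instance [Nontrivial L] : Nontrivial (TwistedPoly 𝔽q L) := ⟨⟨1, 0, hasDegree_one.ne_zero⟩⟩

instance [IsDomain L] : NoZeroDivisors (TwistedPoly 𝔽q L) where
  eq_zero_or_eq_zero_of_mul_eq_zero {u w} h := by
    by_contra! hn
    obtain ⟨M, hM⟩ := exists_hasDegree hn.1
    obtain ⟨N, hN⟩ := exists_hasDegree hn.2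
    exact (hM.mul hN).ne_zero h

instance [IsDomain L] : IsDomain (TwistedPoly 𝔽q L) := NoZeroDivisors.to_isDomain _

theorem HasDegree.add_of_mem {u w : TwistedPoly 𝔽q L} {M N : ℕ} (hu : u.HasDegree M)
    (hw : w ∈ degreeLE 𝔽q L N) (h : N < M) : (u + w).HasDegree M :=
  ⟨add_mem hu.1 (degreeLE_mono h.le hw), by rw [coeff_add, hw _ h, add_zero]; exact hu.2⟩

/-- If `u` has degree `m ≥ 1`, then substituting `u` in a polynomial multiplies degrees by `m`. -/
theorem HasDegree.aeval [IsDomain L] {u : TwistedPoly 𝔽q L} {m : ℕ} (hu : u.HasDegree m)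
    (hm : 0 < m) {a : 𝔽q[X]} (ha : a ≠ 0) : (aeval u a).HasDegree (a.natDegree * m) := by
  have key : ∀ (d : ℕ) (a : 𝔽q[X]), a.natDegree = d → a ≠ 0 →
      (Polynomial.aeval u a).HasDegree (d * m) := by
    intro d
    induction d using Nat.strong_induction_on with
    | _ d ih =>
      intro a hd ha
      have hlead : (Polynomial.aeval u (Polynomial.C a.leadingCoeff * X ^ d)).HasDegree
          (d * m) := by
        rw [map_mul, aeval_C, map_pow, aeval_X]
        have hc : (algebraMap 𝔽q (TwistedPoly 𝔽q L) a.leadingCoeff).HasDegree 0 := by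
          refine ⟨fun i hi => by rw [coeff_algebraMap, if_neg (by omega)], ?_⟩
          rw [coeff_algebraMap, if_pos rfl]
          simpa using ha
        simpa using hc.mul (hu.pow d)
      rw [← eraseLead_add_C_mul_X_pow a, hd, map_add, add_comm]
      by_cases he : a.eraseLead = 0
      · rwa [he, map_zero, add_zero]
      · have hlt : a.eraseLead.natDegree < d := by
          have h2 := eraseLead_natDegree_le a
          have : d ≠ 0 := by
            rintro rfl
            rw [natDegree_eq_zero] at hd
            obtain ⟨c, rfl⟩ := hd
            simp at he
          omega
        exact hlead.add_of_mem (ih _ hlt _ rfl he).1 (Nat.mul_lt_mul_of_pos_right hlt hm)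
  exact key _ a rfl ha

/-- The ordinary polynomial `∑ cᵢ X ^ (qⁱ)` attached to a twisted polynomial `∑ cᵢ τⁱ` of
degree at most `N`. -/
def toPolynomial (N : ℕ) (u : TwistedPoly 𝔽q L) : L[X] :=
  ∑ i ∈ Finset.range (N + 1), C (u.coeff i) * X ^ Fintype.card 𝔽q ^ i

/-- Evaluation at a point, as an additive map. -/
def evalAt {Ω : Type*} [CommRing Ω] [Algebra 𝔽q Ω] [Algebra L Ω] [IsScalarTower 𝔽q L Ω] (x : Ω) :
    TwistedPoly 𝔽q L →+ Ω where
  toFun u := eval Ω u x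
  map_zero' := by rw [map_zero]; rfl
  map_add' u w := by rw [map_add]; rfl

theorem eval_eq_sum {Ω : Type*} [CommRing Ω] [Algebra 𝔽q Ω] [Algebra L Ω] [IsScalarTower 𝔽q L Ω]
    {N : ℕ} {u : TwistedPoly 𝔽q L} (hu : u ∈ degreeLE 𝔽q L N) (x : Ω) :
    eval Ω u x = ∑ i ∈ Finset.range (N + 1),
      algebraMap L Ω (u.coeff i) * x ^ Fintype.card 𝔽q ^ i := by
  change evalAt x u = _
  conv_lhs => rw [eq_sum_monomial hu, map_sum]
  exact Finset.sum_congr rfl fun i _ => eval_monomial Ω i _ x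

theorem aeval_toPolynomial {Ω : Type*} [CommRing Ω] [Algebra 𝔽q Ω] [Algebra L Ω]
    [IsScalarTower 𝔽q L Ω] {N : ℕ} {u : TwistedPoly 𝔽q L} (hu : u ∈ degreeLE 𝔽q L N) (x : Ω) :
    aeval x (toPolynomial N u) = eval Ω u x := by
  rw [eval_eq_sum hu, toPolynomial, map_sum]
  exact Finset.sum_congr rfl fun i _ => by simp

theorem natDegree_toPolynomial {N : ℕ} {u : TwistedPoly 𝔽q L} (h : u.coeff N ≠ 0) :
    (toPolynomial N u).natDegree = Fintype.card 𝔽q ^ N := by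
  have hq : 1 < Fintype.card 𝔽q := Fintype.one_lt_card
  have : Nontrivial L := ⟨⟨_, _, h⟩⟩
  rw [toPolynomial, Finset.sum_range_succ, add_comm]
  rw [natDegree_add_eq_left_of_natDegree_lt, natDegree_C_mul_X_pow _ _ h]
  rw [natDegree_C_mul_X_pow _ _ h]
  refine lt_of_le_of_lt (natDegree_sum_le_of_forall_le (n := Fintype.card 𝔽q ^ N - 1) _ _
    fun i hi => ?_) (Nat.sub_lt (pow_pos (by omega) _) one_pos)
  refine (natDegree_C_mul_X_pow_le _ _).trans (Nat.le_sub_one_of_lt ?_)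
  exact Nat.pow_lt_pow_right hq (Finset.mem_range.mp hi)

/-- The exponents `q ^ i` with `i > 0` vanish in `L`, so only the linear term survives. This is the
source of the separability of the torsion. -/
theorem derivative_toPolynomial (N : ℕ) (u : TwistedPoly 𝔽q L) :
    derivative (toPolynomial N u) = C (u.coeff 0) := by
  have hq : ((Fintype.card 𝔽q : ℕ) : L) = 0 := by
    rw [← map_natCast (algebraMap 𝔽q L), FiniteField.cast_card_eq_zero, map_zero]
  rw [toPolynomial, derivative_sum, Finset.sum_range_succ', Finset.sum_eq_zero]
  · simp
  · intro i _
    rw [derivative_C_mul_X_pow, Nat.cast_pow, hq]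
    simp

end TwistedPoly

/-! ### Degrees of the `φ_a`. -/

namespace DrinfeldModule

open TwistedPoly

section General

variable {𝔽q L : Type*} [Field 𝔽q] [Fintype 𝔽q] [Field L] [Algebra 𝔽q L]
  [Algebra 𝔽q[X] L] [IsScalarTower 𝔽q 𝔽q[X] L] {r : ℕ} (φ : DrinfeldModule 𝔽q L r)

theorem hasDegree_X : (φ.toAlgHom X).HasDegree r := ⟨φ.coeff_gt, φ.coeff_rank⟩

theorem toAlgHom_eq_aeval (a : 𝔽q[X]) : φ.toAlgHom a = aeval (φ.toAlgHom X) a := by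
  rw [aeval_algHom_apply, aeval_X_left_apply]

theorem hasDegree_toAlgHom {a : 𝔽q[X]} (ha : a ≠ 0) :
    (φ.toAlgHom a).HasDegree (a.natDegree * r) := by
  rw [toAlgHom_eq_aeval]
  exact φ.hasDegree_X.aeval φ.one_le_rank ha

/-- Taking the constant coefficient is an algebra homomorphism, so it is enough to compare at `X`.
-/
theorem coeff_zero_toAlgHom (a : 𝔽q[X]) : (φ.toAlgHom a).coeff 0 = algebraMap 𝔽q[X] L a := by
  have h : constCoeff.comp φ.toAlgHom = IsScalarTower.toAlgHom 𝔽q 𝔽q[X] L :=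
    Polynomial.algHom_ext φ.coeff_zero
  exact DFunLike.congr_fun h a

theorem mem_end_iff {u : TwistedPoly 𝔽q L} :
    u ∈ φ.End ↔ ∀ a, φ.toAlgHom a * u = u * φ.toAlgHom a := by
  rw [End, Subring.mem_centralizer_iff, Set.forall_mem_range]

theorem commute_end (a : 𝔽q[X]) (u : φ.End) :
    φ.toAlgHom a * (u : TwistedPoly 𝔽q L) = u * φ.toAlgHom a :=
  φ.mem_end_iff.mp u.2 a

/-- `a ∈ A` acts on `L{τ}` by right multiplication by `φ_a`. -/
@[reducible] def rightModule : Module 𝔽q[X] (TwistedPoly 𝔽q L) :=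
  Module.compHom (TwistedPoly 𝔽q L)
    ((φ.toAlgHom : 𝔽q[X] →+* TwistedPoly 𝔽q L).toOpposite fun a b => by
      change φ.toAlgHom a * φ.toAlgHom b = φ.toAlgHom b * φ.toAlgHom a
      rw [← map_mul, ← map_mul, mul_comm])

theorem rightModule_smul (a : 𝔽q[X]) (u : TwistedPoly 𝔽q L) :
    (letI := φ.rightModule; a • u) = u * φ.toAlgHom a := rfl

theorem algebraMap_end_injective : Function.Injective (algebraMap 𝔽q[X] φ.End) := by
  rw [injective_iff_map_eq_zero]
  intro a ha
  by_contra h0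
  exact (φ.hasDegree_toAlgHom h0).ne_zero (congrArg Subtype.val ha)

/-- The endomorphisms of degree at most `N`. -/
def endDegreeLE (N : ℕ) : AddSubgroup φ.End :=
  (degreeLE 𝔽q L N).comap φ.End.subtype.toAddMonoidHom

theorem mem_endDegreeLE {N : ℕ} {u : φ.End} :
    u ∈ φ.endDegreeLE N ↔ (u : TwistedPoly 𝔽q L) ∈ degreeLE 𝔽q L N := Iff.rfl

end General

/-! ### The endomorphism ring over a finite field: finiteness, commutativity, rank. -/

section FiniteField

variable {𝔽q L : Type*} [Field 𝔽q] [Fintype 𝔽q] [Field L] [Finite L] [Algebra 𝔽q L]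
  [Algebra 𝔽q[X] L] [IsScalarTower 𝔽q 𝔽q[X] L] {r : ℕ} (φ : DrinfeldModule 𝔽q L r)

theorem moduleFinite_rightModule :
    letI := φ.rightModule
    Module.Finite 𝔽q[X] (TwistedPoly 𝔽q L) := by
  let := φ.rightModule
  have hr := φ.one_le_rank
  let s : Set (TwistedPoly 𝔽q L) := Set.range fun p : Fin r × L => TwistedPoly.monomial p.1 p.2
  have key : ∀ N, ∀ u ∈ degreeLE 𝔽q L N, u ∈ Submodule.span 𝔽q[X] s := by
    intro N
    induction N using Nat.strong_induction_on with
    | _ N ih =>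
      intro u hu
      by_cases hN : N < r
      · rw [eq_sum_monomial hu]
        refine Submodule.sum_mem _ fun i hi => Submodule.subset_span ⟨(⟨i, ?_⟩, u.coeff i), rfl⟩
        rw [Finset.mem_range] at hi
        omega
      · obtain ⟨k, rfl⟩ := Nat.exists_eq_add_of_le (not_lt.mp hN)
        -- Right division by `φ_T`: the leading coefficient of `τ^k φ_T` is `g_r ^ (q^k)`, so this
        -- `c` makes `c τ^k φ_T` cancel the top term of `u`.
        set c : L := u.coeff (r + k) / φ.g r ^ Fintype.card 𝔽q ^ k with hc
        set v : TwistedPoly 𝔽q L := TwistedPoly.monomial k c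
        have hv : v ∈ Submodule.span 𝔽q[X] s :=
          ih k (by omega) v (monomial_mem_degreeLE le_rfl c)
        have hw : u - v * φ.toAlgHom X ∈ degreeLE 𝔽q L (r + k - 1) := by
          intro i hi
          have hmem : v * φ.toAlgHom X ∈ degreeLE 𝔽q L (k + r) :=
            mul_mem_degreeLE (monomial_mem_degreeLE le_rfl c) φ.hasDegree_X.1
          rcases (show r + k ≤ i by omega).eq_or_lt with rfl | h
          · rw [TwistedPoly.coeff_sub, add_comm r k,
              coeff_mul_degree (monomial_mem_degreeLE le_rfl c) φ.hasDegree_X.1,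
                TwistedPoly.coeff_monomial,
              if_pos rfl, hc, g, add_comm r k,
              div_mul_cancel₀ _ (pow_ne_zero _ φ.coeff_rank), sub_self]
          · rw [TwistedPoly.coeff_sub, hu i h, hmem i (by omega), sub_zero]
        have := ih _ (by omega) _ hw
        rw [← sub_add_cancel u (v * φ.toAlgHom X)]
        exact add_mem this (Submodule.smul_mem _ X hv)
  refine ⟨⟨(Set.finite_range fun p : Fin r × L =>
    (TwistedPoly.monomial p.1 p.2 : TwistedPoly 𝔽q L)).toFinset, ?_⟩⟩
  rw [Set.Finite.coe_toFinset, eq_top_iff]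
  rintro u -
  obtain ⟨N, hN⟩ := exists_mem_degreeLE u
  exact key N u hN

instance : Module.Finite 𝔽q[X] φ.End := by
  let := φ.rightModule
  have := φ.moduleFinite_rightModule
  have : IsNoetherian 𝔽q[X] (TwistedPoly 𝔽q L) := isNoetherian_of_isNoetherianRing_of_finite _ _
  -- Endomorphisms commute with `φ_a`, so right multiplication restricts to the algebra structure of
  -- `End`, which becomes a submodule of a noetherian module.
  let f : φ.End →ₗ[𝔽q[X]] TwistedPoly 𝔽q L :=
    { toFun := Subtype.val
      map_add' := fun _ _ => rfl
      map_smul' := fun a u => by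
        rw [RingHom.id_apply, rightModule_smul, Algebra.smul_def]
        exact φ.commute_end a u }
  exact Module.Finite.of_injective f Subtype.val_injective

instance : Module.IsTorsionFree 𝔽q[X] φ.End := by
  refine Module.IsTorsionFree.of_smul_eq_zero fun a u h => ?_
  rw [Algebra.smul_def] at h
  exact (mul_eq_zero.mp h).imp_left fun h' =>
    φ.algebraMap_end_injective (h'.trans (map_zero _).symm)

instance : Module.Free 𝔽q[X] φ.End := Module.free_of_finite_type_torsion_free'

instance (N : ℕ) : Finite (φ.endDegreeLE N) :=
  Finite.of_injective (fun u : φ.endDegreeLE N => (⟨u.1.1, u.2⟩ : degreeLE 𝔽q L N))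
    fun _ _ h => Subtype.ext (Subtype.ext (congrArg (fun z : degreeLE 𝔽q L N => z.1) h))

/-- If `E / wE ≅ Q` is finite, then the number of endomorphisms of bounded degree is multiplied
by `#Q` when the bound increases by `deg w`. -/
theorem card_endDegreeLE_add {w : φ.End} {m : ℕ} (hw : (w : TwistedPoly 𝔽q L).HasDegree m)
    {Q : Type*} [AddCommGroup Q] [Finite Q] (f : φ.End →+ Q) (hf : Function.Surjective f)
    (hker : ∀ u, f u = 0 ↔ ∃ v, u = w * v) :
    ∃ N₀, ∀ N, N₀ ≤ N →
      Nat.card (φ.endDegreeLE (N + m)) = Nat.card Q * Nat.card (φ.endDegreeLE N) := by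
  have := Fintype.ofFinite Q
  have hb : ∀ x : Q, ∃ N, ∃ u ∈ φ.endDegreeLE N, f u = x := fun x => by
    obtain ⟨u, hu⟩ := hf x
    obtain ⟨N, hN⟩ := exists_mem_degreeLE (u : TwistedPoly 𝔽q L)
    exact ⟨N, u, hN, hu⟩
  choose B u hu hfu using hb
  -- From this bound on, representatives of all elements of `Q` are available, so `f` stays
  -- surjective on bounded degree. The kernel is then `w` times the endomorphisms of degree at most
  -- `N`, because degrees add.
  refine ⟨Finset.univ.sup B, fun N hN => ?_⟩
  let g : φ.endDegreeLE (N + m) →+ Q := f.comp (φ.endDegreeLE (N + m)).subtype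
  have hg : Function.Surjective g := fun x =>
    ⟨⟨u x, degreeLE_mono (((Finset.le_sup (Finset.mem_univ x)).trans hN).trans
      (Nat.le_add_right N m)) (hu x)⟩, hfu x⟩
  let e : φ.endDegreeLE N → g.ker := fun v =>
    ⟨⟨w * v.1, by
      rw [mem_endDegreeLE, add_comm]
      exact mul_mem_degreeLE hw.1 v.2⟩, (hker _).mpr ⟨v.1, rfl⟩⟩
  have he : Function.Bijective e := by
    constructor
    · intro v v' h
      have h1 : (w : TwistedPoly 𝔽q L) * v.1 = w * v'.1 :=
        congrArg (fun z : g.ker => (z.1.1 : TwistedPoly 𝔽q L)) h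
      exact Subtype.ext (Subtype.ext (mul_left_cancel₀ hw.ne_zero h1))
    · rintro ⟨⟨x, hx⟩, hx'⟩
      obtain ⟨v, rfl⟩ := (hker x).mp hx'
      exact ⟨⟨v, hw.mem_of_mul_mem hx⟩, rfl⟩
  rw [Nat.card_congr (Equiv.ofBijective e he),
    AddSubgroup.card_eq_card_quotient_mul_card_addSubgroup g.ker,
    Nat.card_congr (QuotientAddGroup.quotientKerEquivOfSurjective g hg).toEquiv]

theorem finrank_pos : 0 < Module.finrank 𝔽q L :=
  have : Module.Finite 𝔽q L := Module.Finite.of_finite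
  Module.finrank_pos

theorem coe_frob : (φ.frob : TwistedPoly 𝔽q L) = TwistedPoly.monomial (Module.finrank 𝔽q L) 1 := rfl

theorem hasDegree_frob : (φ.frob : TwistedPoly 𝔽q L).HasDegree (Module.finrank 𝔽q L) :=
  ⟨monomial_mem_degreeLE le_rfl 1, by
    rw [coe_frob, TwistedPoly.coeff_monomial, if_pos rfl]
    exact one_ne_zero⟩

theorem card_eq_pow : Nat.card L = Fintype.card 𝔽q ^ Module.finrank 𝔽q L := by
  have := Fintype.ofFinite L
  rw [Nat.card_eq_fintype_card, Module.card_eq_pow_finrank (K := 𝔽q)]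

theorem commute_frob (u : TwistedPoly 𝔽q L) :
    (φ.frob : TwistedPoly 𝔽q L) * u = u * φ.frob := by
  have := Fintype.ofFinite L
  rw [coe_frob]
  induction u using TwistedPoly.induction with
  | h0 => simp
  | hm i c =>
    rw [TwistedPoly.monomial_mul_monomial, TwistedPoly.monomial_mul_monomial,
      ← Module.card_eq_pow_finrank (K := 𝔽q),
      FiniteField.pow_card, one_pow, mul_one, one_mul, add_comm]
  | ha u w hu hw => rw [add_mul, mul_add, hu, hw]

theorem eq_mul_frob {u : TwistedPoly 𝔽q L} (h : ∀ i < Module.finrank 𝔽q L, u.coeff i = 0) :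
    ∃ w, u = w * φ.frob := by
  obtain ⟨N, hN⟩ := exists_mem_degreeLE u
  refine ⟨∑ i ∈ Finset.range (N + 1),
    TwistedPoly.monomial i (u.coeff (Module.finrank 𝔽q L + i)), ?_⟩
  rw [← φ.commute_frob, coe_frob]
  refine TwistedPoly.ext fun j => ?_
  by_cases hj : j < Module.finrank 𝔽q L
  · rw [TwistedPoly.coeff_monomial_mul_of_lt hj, h j hj]
  · obtain ⟨k, rfl⟩ := Nat.exists_eq_add_of_le (not_lt.mp hj)
    rw [TwistedPoly.coeff_monomial_mul, TwistedPoly.coeff_sum]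
    have hL : ∀ c : L, c ^ Fintype.card 𝔽q ^ Module.finrank 𝔽q L = c := fun c => by
      have := Fintype.ofFinite L
      rw [← Module.card_eq_pow_finrank (K := 𝔽q), FiniteField.pow_card]
    rw [hL, one_mul]
    simp only [TwistedPoly.coeff_monomial, Finset.sum_ite_eq', Finset.mem_range]
    split_ifs with hk
    · rfl
    · exact hN _ (by omega)

variable (hA : Function.Surjective (algebraMap 𝔽q[X] L))

-- Since `A → L` is onto, the image of `T` generates `L` over `𝔽q`. If it is fixed by the `q^i`-th
-- power, so is all of `L`, and `X ^ (q^i) - X` has at least `q ^ [L : 𝔽q]` roots.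
include hA in
theorem finrank_le_of_pow_eq {i : ℕ} (hi : 0 < i)
    (h : (algebraMap 𝔽q[X] L X) ^ Fintype.card 𝔽q ^ i = algebraMap 𝔽q[X] L X) :
    Module.finrank 𝔽q L ≤ i := by
  have := Fintype.ofFinite L
  have hq : 1 < Fintype.card 𝔽q := Fintype.one_lt_card
  have hall : ∀ x : L, x ^ Fintype.card 𝔽q ^ i = x := by
    intro x
    obtain ⟨a, rfl⟩ := hA x
    induction a using Polynomial.induction_on' with
    | add a b ha hb => rw [map_add, add_pow_card_pow, ha, hb]
    | monomial n c =>
      have hc : algebraMap 𝔽q[X] L (C c) = algebraMap 𝔽q L c :=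
        (IsScalarTower.algebraMap_apply 𝔽q 𝔽q[X] L c).symm
      rw [← C_mul_X_pow_eq_monomial, map_mul, map_pow, mul_pow, pow_right_comm, h, hc,
        ← map_pow, FiniteField.pow_card_pow]
  by_contra hlt
  have h1 : 1 < Fintype.card 𝔽q ^ i := Nat.one_lt_pow hi.ne' hq
  refine FiniteField.X_pow_card_sub_X_ne_zero L h1 ?_
  refine eq_zero_of_natDegree_lt_card_of_eval_eq_zero _ Function.injective_id
    (fun x => by simp [hall x]) ?_
  rw [FiniteField.X_pow_card_sub_X_natDegree_eq L h1, Module.card_eq_pow_finrank (K := 𝔽q) (V := L)]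
  exact Nat.pow_lt_pow_right hq (by omega)

include hA in
/-- An endomorphism without constant term is divisible by the Frobenius. -/
theorem exists_eq_mul_frob {u : φ.End} (h0 : (u : TwistedPoly 𝔽q L).coeff 0 = 0) :
    ∃ w, u = w * φ.frob := by
  have hlow : ∀ i < Module.finrank 𝔽q L, (u : TwistedPoly 𝔽q L).coeff i = 0 := by
    intro i
    induction i using Nat.strong_induction_on with
    | _ i ih =>
      intro hi
      by_contra hne
      have hpos : 0 < i := Nat.pos_of_ne_zero fun h => hne (h ▸ h0)
      -- With `u_i` the lowest nonzero coefficient, the coefficient of `τ^i` in `φ_T u = u φ_T`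
      -- reads `γ(T) u_i = u_i γ(T) ^ (q^i)`, which forces `i ≥ [L : 𝔽q]`.
      have hc := congrArg (fun z => TwistedPoly.coeff z i) (φ.commute_end X u)
      simp only [TwistedPoly.coeff_mul] at hc
      rw [Finset.sum_eq_single (0, i), Finset.sum_eq_single (i, 0)] at hc
      · simp only [pow_zero, pow_one] at hc
        rw [φ.coeff_zero, mul_comm] at hc
        have := finrank_le_of_pow_eq hA hpos (mul_left_cancel₀ hne hc).symm
        omega
      · rintro ⟨a, b⟩ hab hne'
        have hab' : a + b = i := by simpa using hab
        have : a ≠ i := fun h => hne' (Prod.ext h (by simp; omega))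
        simp [ih a (by omega) (by omega)]
      · intro h
        simp at h
      · rintro ⟨a, b⟩ hab hne'
        have hab' : a + b = i := by simpa using hab
        have : b ≠ i := fun h => hne' (Prod.ext (by simp; omega) h)
        simp [ih b (by omega) (by omega)]
      · intro h
        simp at h
  obtain ⟨w, hw⟩ := φ.eq_mul_frob hlow
  refine ⟨⟨w, φ.mem_end_iff.mpr fun a => ?_⟩, Subtype.ext hw⟩
  -- The quotient `w` is again an endomorphism, because `π` is central in `L{τ}` and can be
  -- cancelled.
  refine mul_right_cancel₀ φ.hasDegree_frob.ne_zero ?_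
  rw [mul_assoc, ← hw, φ.commute_end, hw, mul_assoc, mul_assoc, φ.commute_frob]

-- Some `φ_a` has the same constant coefficient as `u`, and the difference is divisible by `π`. The
-- decomposition `ℰ = A + ℰπ` gives both the commutativity of `ℰ` and the finite index of `A[π]`.
include hA in
theorem exists_eq_algebraMap_add (u : φ.End) :
    ∃ (a : 𝔽q[X]) (w : φ.End), u = algebraMap 𝔽q[X] φ.End a + w * φ.frob := by
  obtain ⟨a, ha⟩ := hA ((u : TwistedPoly 𝔽q L).coeff 0)
  obtain ⟨w, hw⟩ := φ.exists_eq_mul_frob hA (u := u - algebraMap 𝔽q[X] φ.End a) (by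
    change ((u : TwistedPoly 𝔽q L) - φ.toAlgHom a).coeff 0 = 0
    rw [TwistedPoly.coeff_sub, coeff_zero_toAlgHom, ha, sub_self])
  exact ⟨a, w, by rw [← hw]; abel⟩

theorem frob_mul_comm (u : φ.End) : φ.frob * u = u * φ.frob := Subtype.ext (φ.commute_frob u)

include hA in
/-- When `A → L` is surjective, the endomorphism ring is commutative. -/
theorem end_mul_comm (u w : φ.End) : u * w = w * u := by
  -- For `u = a + u'π` and `w = b + w'π` the commutator is `[u, w] = [u', w'] π²`. By induction
  -- every commutator is divisible by every power of `π`, while a nonzero twisted polynomial has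
  -- finite degree.
  have key : ∀ (j : ℕ) (u w : φ.End), ∃ v, u * w - w * u = v * φ.frob ^ j := by
    intro j
    induction j with
    | zero => exact fun u w => ⟨u * w - w * u, by rw [pow_zero, mul_one]⟩
    | succ j ih =>
      intro u w
      obtain ⟨a, u', rfl⟩ := φ.exists_eq_algebraMap_add hA u
      obtain ⟨b, w', rfl⟩ := φ.exists_eq_algebraMap_add hA w
      obtain ⟨v, hv⟩ := ih u' w'
      refine ⟨v * φ.frob, ?_⟩
      have h1 : ∀ z : φ.End, Commute (algebraMap 𝔽q[X] φ.End a) z := Algebra.commutes a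
      have h2 : ∀ z : φ.End, Commute (algebraMap 𝔽q[X] φ.End b) z := Algebra.commutes b
      have h3 : ∀ x y : φ.End, x * φ.frob * (y * φ.frob) = x * y * φ.frob * φ.frob := by
        intro x y
        rw [mul_assoc x, ← mul_assoc φ.frob y, φ.frob_mul_comm y]
        simp only [mul_assoc]
      have h4 : (algebraMap 𝔽q[X] φ.End a + u' * φ.frob) * (algebraMap 𝔽q[X] φ.End b + w' * φ.frob)
          - (algebraMap 𝔽q[X] φ.End b + w' * φ.frob) * (algebraMap 𝔽q[X] φ.End a + u' * φ.frob) =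
          (u' * w' - w' * u') * φ.frob * φ.frob := by
        rw [add_mul, add_mul, mul_add, mul_add, mul_add, mul_add, h3, h3, (h1 _).eq, (h1 _).eq,
          (h2 (u' * φ.frob)).eq, sub_mul, sub_mul]
        abel
      rw [h4, hv, mul_assoc v, ← pow_succ, mul_assoc v, ← pow_succ, mul_assoc v, ← pow_succ']
  by_contra hne
  have hne' : ((u * w - w * u : φ.End) : TwistedPoly 𝔽q L) ≠ 0 := fun h =>
    hne (sub_eq_zero.mp (Subtype.ext h))
  obtain ⟨m, hm⟩ := exists_hasDegree hne'
  obtain ⟨v, hv⟩ := key (m + 1) u w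
  have hv0 : (v : TwistedPoly 𝔽q L) ≠ 0 := fun h => hne' (by
    rw [hv, show v = 0 from Subtype.ext h, zero_mul]; rfl)
  obtain ⟨k, hk⟩ := exists_hasDegree hv0
  have h1 := hk.mul (φ.hasDegree_frob.pow (m + 1))
  have h2 : m = k + (m + 1) * Module.finrank 𝔽q L := hm.eq (by rw [hv]; exact h1)
  have h3 := finrank_pos (𝔽q := 𝔽q) (L := L)
  nlinarith

include hA in
/-- The endomorphism ring has rank `r` over `A`. -/
theorem finrank_end : Module.finrank 𝔽q[X] φ.End = r := by
  set s := Module.finrank 𝔽q[X] φ.End with hs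
  set d := Module.finrank 𝔽q L with hd
  set q := Fintype.card 𝔽q with hq
  have hq1 : 1 < q := Fintype.one_lt_card
  -- `H` has two growth laws: `ℰ/πℰ ≅ L` has `q ^ d` elements and `π` has degree `d`, while `ℰ/Tℰ ≅
  -- 𝔽q ^ s` and `φ_T` has degree `r`. A shift by `r d` therefore multiplies `H` by `q ^ (d r)` and
  -- also by `q ^ (s d)`.
  set H : ℕ → ℕ := fun N => Nat.card (φ.endDegreeLE N) with hH
  have hHpos : ∀ N, 0 < H N := fun N => Nat.card_pos
  -- growth along the Frobenius
  obtain ⟨N₁, h₁⟩ : ∃ N₀, ∀ N, N₀ ≤ N → H (N + d) = q ^ d * H N := by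
    have := φ.card_endDegreeLE_add φ.hasDegree_frob
      ((constCoeff (𝔽q := 𝔽q) (L := L)).toRingHom.toAddMonoidHom.comp
        φ.End.subtype.toAddMonoidHom)
      (fun x => by
        obtain ⟨a, rfl⟩ := hA x
        exact ⟨algebraMap 𝔽q[X] φ.End a, φ.coeff_zero_toAlgHom a⟩)
      (fun u => by
        constructor
        · intro h
          obtain ⟨w, hw⟩ := φ.exists_eq_mul_frob hA h
          exact ⟨w, by rw [hw, frob_mul_comm]⟩
        · rintro ⟨v, rfl⟩
          change ((φ.frob : TwistedPoly 𝔽q L) * v).coeff 0 = 0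
          exact TwistedPoly.coeff_monomial_mul_of_lt finrank_pos _ _)
    rwa [card_eq_pow (𝔽q := 𝔽q)] at this
  -- growth along `φ_T`
  obtain ⟨N₂, h₂⟩ : ∃ N₀, ∀ N, N₀ ≤ N → H (N + r) = q ^ s * H N := by
    let B := Module.finBasis 𝔽q[X] φ.End
    let f : φ.End →+ (Fin s → 𝔽q) :=
      { toFun := fun u i => (B.repr u i).coeff 0
        map_zero' := by ext i; simp
        map_add' := fun u w => by ext i; simp }
    have := φ.card_endDegreeLE_add (w := algebraMap 𝔽q[X] φ.End X) φ.hasDegree_X f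
      (fun x => ⟨∑ i, C (x i) • B i, by
        ext j
        simp [f, Finsupp.single_apply, apply_ite (fun p : 𝔽q[X] => p.coeff 0)]⟩)
      (fun u => by
        constructor
        · intro h
          have : ∀ i, ∃ c, B.repr u i = X * c := fun i =>
            X_dvd_iff.mpr (congrFun h i)
          choose c hc using this
          refine ⟨∑ i, c i • B i, ?_⟩
          rw [← Algebra.smul_def, Finset.smul_sum]
          conv_lhs => rw [← B.sum_repr u]
          exact Finset.sum_congr rfl fun i _ => by rw [hc, mul_smul]
        · rintro ⟨v, rfl⟩
          ext i
          rw [← Algebra.smul_def]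
          simp [f])
    have hcard : Nat.card (Fin s → 𝔽q) = q ^ s := by simp [hq]
    rwa [hcard] at this
  have it : ∀ {m Q N₀ : ℕ}, (∀ N, N₀ ≤ N → H (N + m) = Q * H N) → ∀ k N, N₀ ≤ N →
      H (N + k * m) = Q ^ k * H N := by
    intro m Q N₀ h k
    induction k with
    | zero => intro N _; simp
    | succ k ih =>
      intro N hN
      rw [add_mul, one_mul, ← add_assoc, h _ (by omega), ih N hN, pow_succ]
      ring
  have e₁ := it h₁ r (max N₁ N₂) (le_max_left _ _)
  have e₂ := it h₂ d (max N₁ N₂) (le_max_right _ _)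
  rw [mul_comm r d, e₂] at e₁
  have e := Nat.eq_of_mul_eq_mul_right (hHpos _) e₁
  rw [← pow_mul, ← pow_mul] at e
  have := Nat.pow_right_injective hq1 e
  rw [mul_comm s d] at this
  exact Nat.eq_of_mul_eq_mul_left finrank_pos this

end FiniteField

end DrinfeldModule

/-! ### The order `A[π]` inside `E`: finite index and minimal polynomial. -/

section FrobeniusOrder

variable {A E : Type*} [CommRing A] [IsDomain A] [IsPrincipalIdealRing A] [CommRing E] [IsDomain E]
  [Algebra A E] [Module.Free A E] [Module.Finite A E] {π : E}

/-- If `E = A + Eπ` and no `1 + cπ` vanishes, then `A[π]` has finite index in `E`. -/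
theorem exists_smul_mem_adjoin (h : ∀ u : E, ∃ (a : A) (w : E), u = algebraMap A E a + w * π)
    (h1 : ∀ c : E, 1 + c * π ≠ 0) :
    ∃ D : A, D ≠ 0 ∧ ∀ u : E, D • u ∈ Algebra.adjoin A {π} := by
  set S := Algebra.adjoin A {π} with hS
  have : Module.Finite S E := Module.Finite.of_restrictScalars_finite A S E
  let π' : S := ⟨π, Algebra.self_mem_adjoin_singleton A π⟩
  let N : Submodule S E := Submodule.span S {1}
  -- Nakayama's lemma: with `S = A[π]`, the hypothesis says `E/S = π (E/S)`, so some `s ∈ 1 + πS`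
  -- kills `E/S`.
  obtain ⟨s, hs1, hs2⟩ := Submodule.exists_sub_one_mem_and_smul_eq_zero_of_fg_of_le_smul
    (Ideal.span {π'}) (⊤ : Submodule S (E ⧸ N)) Module.Finite.fg_top (by
      rintro q -
      obtain ⟨u, rfl⟩ := Submodule.mkQ_surjective N q
      obtain ⟨a, w, rfl⟩ := h u
      have ha : N.mkQ (algebraMap A E a) = 0 := by
        rw [Submodule.mkQ_apply, Submodule.Quotient.mk_eq_zero, Submodule.mem_span_singleton]
        exact ⟨algebraMap A S a, by rw [Algebra.smul_def, mul_one]; rfl⟩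
      have hw : w * π = π' • w := by rw [mul_comm]; rfl
      rw [map_add, ha, zero_add, hw, map_smul]
      exact Submodule.smul_mem_smul (Ideal.mem_span_singleton_self π') trivial)
  have hs : (s : E) ≠ 0 := by
    obtain ⟨c, hc⟩ := Ideal.mem_span_singleton'.mp hs1
    have h2 : (s : E) = 1 + c * π := by
      have := congrArg (fun z : S => (z : E)) hc
      simp only [Subalgebra.coe_mul, Subalgebra.coe_sub, Subalgebra.coe_one, π'] at this
      rw [this]
      ring
    rw [h2]
    exact h1 _
  -- A nonzero multiple `D = s t` of `s` lies in `A`, and `D u = s (t u)` lies in `S`.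
  obtain ⟨D, hD, t, ht⟩ := (Algebra.IsAlgebraic.isAlgebraic (R := A) (s : E)).exists_nonzero_dvd
    (mem_nonZeroDivisors_of_ne_zero hs)
  refine ⟨D, hD, fun u => ?_⟩
  have h3 := hs2 (N.mkQ (t * u)) trivial
  rw [← map_smul, Submodule.mkQ_apply, Submodule.Quotient.mk_eq_zero,
    Submodule.mem_span_singleton] at h3
  obtain ⟨c, hc⟩ := h3
  have h4 : D • u = c := by
    rw [Algebra.smul_def, ht, mul_assoc]
    exact (hc.symm.trans (mul_one (c : E)))
  rw [h4]
  exact c.2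

-- Cayley–Hamilton for multiplication by `π`.
variable (A π) in
theorem exists_monic_aeval_eq_zero :
    ∃ χ : A[X], χ.Monic ∧ χ.natDegree = Module.finrank A E ∧ aeval π χ = 0 := by
  refine ⟨(LinearMap.mulLeft A π).charpoly, LinearMap.charpoly_monic _,
    LinearMap.charpoly_natDegree _, ?_⟩
  have h := LinearMap.aeval_self_charpoly (LinearMap.mulLeft A π)
  have h2 : ∀ p : A[X], aeval (LinearMap.mulLeft A π) p = LinearMap.mulLeft A (aeval π p) := by
    intro p
    exact aeval_algHom_apply (Algebra.lmul A E) π p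
  rw [h2] at h
  simpa using congrArg (fun g : E →ₗ[A] E => g 1) h

theorem exists_natDegree_lt_of_mem_adjoin {r : ℕ} (hr : Module.finrank A E = r) {x : E}
    (hx : x ∈ Algebra.adjoin A {π}) : ∃ p : A[X], p.degree < r ∧ aeval π p = x := by
  obtain ⟨χ, hχ, hdeg, h0⟩ := exists_monic_aeval_eq_zero A π
  rw [Algebra.adjoin_singleton_eq_range_aeval] at hx
  obtain ⟨p, rfl⟩ := hx
  refine ⟨p %ₘ χ, ?_, ?_⟩
  · have := degree_modByMonic_lt p hχ
    rwa [degree_eq_natDegree hχ.ne_zero, hdeg, hr] at this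
  · conv_rhs => rw [← modByMonic_add_div p χ]
    simp [h0]

theorem aeval_eq_sum_fin {r : ℕ} {p : A[X]} (hp : p.degree < r) :
    aeval π p = ∑ i : Fin r, p.coeff i • π ^ (i : ℕ) := by
  by_cases h0 : p = 0
  · simp [h0]
  · rw [aeval_eq_sum_range' ((natDegree_lt_iff_degree_lt h0).mpr hp) π,
      Fin.sum_univ_eq_sum_range (fun i => p.coeff i • π ^ i)]

/-- Multiplication by `D` embeds `E` in the span of `1, π, …, π^(r-1)`. That span has rank at least
`r`, so its `r` generators are independent. -/
theorem eq_zero_of_aeval_eq_zero {r : ℕ} (hr : Module.finrank A E = r) {D : A} (hD : D ≠ 0)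
    (hmem : ∀ u : E, D • u ∈ Algebra.adjoin A {π}) {p : A[X]} (hp : p.degree < r)
    (h0 : aeval π p = 0) : p = 0 := by
  set v : Fin r → E := fun i => π ^ (i : ℕ)
  have hli : LinearIndependent A v := by
    rw [linearIndependent_iff_card_le_finrank_span, Fintype.card_fin]
    refine hr.symm.le.trans ?_
    let g : E →ₗ[A] Submodule.span A (Set.range v) :=
      LinearMap.codRestrict _ (D • LinearMap.id) fun u => by
        obtain ⟨p, hp, hpu⟩ := exists_natDegree_lt_of_mem_adjoin hr (hmem u)
        change D • u ∈ _
        rw [← hpu, aeval_eq_sum_fin hp]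
        exact Submodule.sum_mem _ fun i _ =>
          Submodule.smul_mem _ _ (Submodule.subset_span ⟨i, rfl⟩)
    refine LinearMap.finrank_le_finrank_of_injective (f := g) ?_
    intro u w huw
    exact smul_right_injective E hD (congrArg Subtype.val huw)
  rw [aeval_eq_sum_fin hp] at h0
  have := Fintype.linearIndependent_iff.mp hli _ h0
  ext i
  rw [coeff_zero]
  by_cases hi : i < r
  · exact this ⟨i, hi⟩
  · exact coeff_eq_zero_of_degree_lt (hp.trans_le (by exact_mod_cast not_lt.mp hi))

/-- The characteristic polynomial bounds the degree above, and the independence of the powers of `π`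
bounds it below. -/
theorem natDegree_minpoly_of_index {r : ℕ} (hr : Module.finrank A E = r) {D : A} (hD : D ≠ 0)
    (hmem : ∀ u : E, D • u ∈ Algebra.adjoin A {π}) : (minpoly A π).natDegree = r := by
  obtain ⟨χ, hχ, hdeg, h0⟩ := exists_monic_aeval_eq_zero A π
  have hm : (minpoly A π).Monic := minpoly.monic ⟨χ, hχ, h0⟩
  refine le_antisymm (natDegree_le_of_degree_le ?_) ?_
  · rw [← hr, ← hdeg, ← degree_eq_natDegree hχ.ne_zero]
    exact minpoly.min A π hχ h0
  · by_contra hlt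
    refine hm.ne_zero (eq_zero_of_aeval_eq_zero hr hD hmem ?_ (minpoly.aeval A π))
    rw [degree_eq_natDegree hm.ne_zero]
    exact_mod_cast not_le.mp hlt

end FrobeniusOrder

/-! ### Combinations of monic polynomials of degrees `0, …, r - 1`. -/

section Triangular

variable {A : Type*} [CommRing A] {r : ℕ} {f : Fin r → A[X]}

theorem coeff_sum_monic (hf : ∀ i, (f i).Monic) (hd : ∀ i, (f i).natDegree = i) (m : Fin r → A)
    (i : Fin r) (h : ∀ k, i < k → m k = 0) : (∑ k, C (m k) * f k).coeff i = m i := by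
  rw [finsetSum_coeff, Finset.sum_eq_single i]
  · rw [coeff_C_mul]
    conv_lhs => rw [← hd i, (hf i).coeff_natDegree, mul_one]
  · intro k _ hk
    rcases lt_or_gt_of_ne hk with hlt | hlt
    · rw [coeff_C_mul, coeff_eq_zero_of_natDegree_lt (by rw [hd]; exact hlt), mul_zero]
    · rw [h k hlt, C_0, zero_mul, coeff_zero]
  · exact fun h => absurd (Finset.mem_univ i) h

theorem eq_zero_of_natDegree_sum_monic_le (hf : ∀ i, (f i).Monic) (hd : ∀ i, (f i).natDegree = i)
    (m : Fin r → A) (N : ℕ) (hN : (∑ k, C (m k) * f k).natDegree ≤ N) (i : Fin r) (hi : N < i) :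
    m i = 0 := by
  -- Induction on `r - i`, downwards from the top index: once the larger ones vanish, `m i` is the
  -- coefficient of index `i` of the sum.
  have key : ∀ (n : ℕ) (i : Fin r), r - i = n → N < i → m i = 0 := by
    intro n
    induction n using Nat.strong_induction_on with
    | _ n ih =>
      intro i hn hi
      rw [← coeff_sum_monic hf hd m i fun k hk => ih (r - k) (by omega) k rfl (by omega)]
      exact coeff_eq_zero_of_natDegree_lt (by omega)
  exact key _ i rfl hi

/-- A polynomial of degree less than `r` is a combination of monic polynomials of degrees
`0, …, r - 1`. -/
theorem exists_eq_sum_monic (hf : ∀ i, (f i).Monic) (hd : ∀ i, (f i).natDegree = i) {p : A[X]}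
    (hp : p.degree < r) : ∃ m : Fin r → A, p = ∑ k, C (m k) * f k := by
  have key : ∀ (n : ℕ) (p : A[X]), n ≤ r → p.degree < n →
      ∃ m : Fin r → A, p = ∑ k, C (m k) * f k := by
    intro n
    induction n with
    | zero =>
      intro p _ hp
      refine ⟨0, ?_⟩
      have : p = 0 := by simpa using hp
      simp [this]
    | succ n ih =>
      intro p hn hp
      let i : Fin r := ⟨n, by omega⟩
      have hlt : (p - C (p.coeff n) * f i).degree < n := by
        rw [degree_lt_iff_coeff_zero]
        intro j hj
        rw [coeff_sub, coeff_C_mul]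
        rcases hj.eq_or_lt with rfl | hj
        · have : (f i).coeff n = 1 := by
            have := (hf i).coeff_natDegree
            rwa [hd i] at this
          rw [this, mul_one, sub_self]
        · rw [coeff_eq_zero_of_degree_lt (hp.trans_le (by exact_mod_cast hj)),
            coeff_eq_zero_of_natDegree_lt (p := f i) (by rw [hd i]; exact hj), mul_zero, sub_zero]
      obtain ⟨m, hm⟩ := ih _ (by omega) hlt
      refine ⟨m + Pi.single i (p.coeff n), ?_⟩
      rw [sub_eq_iff_eq_add] at hm
      conv_lhs => rw [hm]
      simp only [Pi.add_apply, C_add, add_mul, Finset.sum_add_distrib]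
      congr 1
      rw [Finset.sum_eq_single i]
      · simp
      · intro k _ hk
        simp [hk]
      · simp
  exact key r p le_rfl hp

end Triangular

/-! ### Existence of the triangular basis `f_i(π)/b_i`. -/

section FrobeniusBasisExistence

variable {K E : Type*} [Field K] [CommRing E] [IsDomain E] [Algebra K[X] E] [Module.Free K[X] E]
  [Module.Finite K[X] E] {π : E}

theorem exists_monic_mul_eq {c D : K[X]} (hD : D ≠ 0) (h : c ∣ D) :
    ∃ γ b : K[X], b.Monic ∧ D = γ * b ∧ Associated γ c := by
  obtain ⟨b, hb⟩ := h
  have hb0 : b ≠ 0 := by rintro rfl; exact hD (by rw [hb, mul_zero])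
  have hl : b.leadingCoeff ≠ 0 := leadingCoeff_ne_zero.mpr hb0
  have hu : IsUnit (C b.leadingCoeff) := isUnit_C.mpr (isUnit_iff_ne_zero.mpr hl)
  refine ⟨c * C b.leadingCoeff, b * C b.leadingCoeff⁻¹, monic_mul_leadingCoeff_inv hb0, ?_,
    (associated_mul_unit_left c _ hu)⟩
  rw [hb, mul_mul_mul_comm, mul_comm c b, ← C_mul, mul_inv_cancel₀ hl, C_1, mul_one, mul_comm]

set_option maxHeartbeats 1000000 in
/-- An order `E` of rank `r` over `K[X]` that contains `K[X][π]` with finite index has a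
triangular basis `f_i(π) / b_i`. -/
theorem exists_triangular_basis {r : ℕ} (hr : Module.finrank K[X] E = r) {D : K[X]} (hD : D ≠ 0)
    (hmem : ∀ u : E, D • u ∈ Algebra.adjoin K[X] {π}) :
    ∃ (b : Fin r → K[X]) (f : Fin r → K[X][X]) (B : Module.Basis (Fin r) K[X] E),
      (∀ i, (b i).Monic) ∧ (∀ i : Fin r, (i : ℕ) = 0 → b i = 1) ∧ (∀ i j, i ≤ j → b i ∣ b j) ∧
      (∀ i, (f i).Monic) ∧ (∀ i, (f i).natDegree = i) ∧ ∀ i, b i • B i = aeval π (f i) := by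
  have : Module.IsTorsionFree K[X] E := inferInstance
  -- coordinates with respect to the powers of `π`
  have hy : ∀ u : E, ∃ p : K[X][X], p.degree < r ∧ aeval π p = D • u := fun u =>
    exists_natDegree_lt_of_mem_adjoin hr (hmem u)
  choose y hydeg hyu using hy
  have huniq : ∀ (u : E) (p : K[X][X]), p.degree < r → aeval π p = D • u → y u = p := by
    intro u p hp hpu
    rw [← sub_eq_zero]
    refine eq_zero_of_aeval_eq_zero hr hD hmem ((degree_sub_le _ _).trans_lt
      (max_lt (hydeg u) hp)) ?_
    rw [map_sub, hyu, hpu, sub_self]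
  have hyadd : ∀ u w, y (u + w) = y u + y w := fun u w =>
    huniq _ _ ((degree_add_le _ _).trans_lt (max_lt (hydeg u) (hydeg w)))
      (by rw [map_add, hyu, hyu, smul_add])
  have hysub : ∀ u w, y (u - w) = y u - y w := fun u w =>
    huniq _ _ ((degree_sub_le _ _).trans_lt (max_lt (hydeg u) (hydeg w)))
      (by rw [map_sub, hyu, hyu, smul_sub])
  have hysmul : ∀ (c : K[X]) u, y (c • u) = C c * y u := fun c u =>
    huniq _ _ ((degree_mul_le _ _).trans_lt
      ((add_le_of_nonpos_left degree_C_le).trans_lt (hydeg u)))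
      (by rw [map_mul, aeval_C, hyu, ← Algebra.smul_def, smul_comm])
  have hyinj : ∀ u, y u = 0 → u = 0 := fun u hu => by
    have := hyu u
    rw [hu, map_zero] at this
    exact (smul_eq_zero.mp this.symm).resolve_left hD
  -- Multiplication by `π` is multiplication by `X` on coordinates as long as the degree stays below
  -- `r`.
  have hypi : ∀ (u : E) (i : ℕ), (y u).natDegree ≤ i → i + 1 < r → y (π * u) = X * y u := by
    intro u i hi hir
    refine huniq _ _ ?_ (by rw [map_mul, aeval_X, hyu, mul_smul_comm])
    refine (degree_mul_le _ _).trans_lt ?_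
    rw [degree_X]
    have : (y u).degree ≤ i := natDegree_le_iff_degree_le.mp hi
    calc (1 : WithBot ℕ) + (y u).degree ≤ 1 + i := by gcongr
      _ = ((1 + i : ℕ) : WithBot ℕ) := by push_cast; rfl
      _ < r := by exact_mod_cast (by omega)
  have hypow : ∀ i : ℕ, i < r → y (π ^ i) = C D * X ^ i := fun i hi =>
    huniq _ _ ((degree_C_mul_X_pow_le _ _).trans_lt (by exact_mod_cast hi))
      (by rw [map_mul, aeval_C, map_pow, aeval_X, Algebra.smul_def])
  -- elements with minimal leading coefficients
  have hex : ∀ i : ℕ, ∃ (e : E) (γ b : K[X]), i < r → b.Monic ∧ D = γ * b ∧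
      (y e).natDegree ≤ i ∧ (y e).coeff i = γ ∧
      ∀ u, (y u).natDegree ≤ i → γ ∣ (y u).coeff i := by
    intro i
    by_cases hi : i < r
    swap
    · exact ⟨0, 0, 0, fun h => absurd h hi⟩
    -- The ideal of coefficients of index `i` of those `y u` of degree at most `i`. It contains `D`,
    -- through `π ^ i`, so its generator divides `D`; the generator `γ` is scaled by a unit so that
    -- `b = D/γ` is monic.
    let J : Ideal K[X] :=
      { carrier := {c | ∃ u, (y u).natDegree ≤ i ∧ (y u).coeff i = c}
        zero_mem' := ⟨0, by
          have : y 0 = 0 := by simpa using hysmul 0 0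
          simp [this]⟩
        add_mem' := by
          rintro _ _ ⟨u, hu, rfl⟩ ⟨w, hw, rfl⟩
          exact ⟨u + w, by rw [hyadd]; exact natDegree_add_le_of_degree_le hu hw,
            by rw [hyadd, coeff_add]⟩
        smul_mem' := by
          rintro c _ ⟨u, hu, rfl⟩
          exact ⟨c • u, by rw [hysmul]; exact (natDegree_C_mul_le _ _).trans hu,
            by rw [hysmul, coeff_C_mul, smul_eq_mul]⟩ }
    obtain ⟨c, hc⟩ := (IsPrincipalIdealRing.principal J).principal
    have hDJ : D ∈ J := ⟨π ^ i, by rw [hypow i hi]; exact natDegree_C_mul_X_pow_le _ _,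
      by rw [hypow i hi]; simp⟩
    have hcD : c ∣ D := Ideal.mem_span_singleton.mp (hc.le hDJ)
    obtain ⟨γ, b, hb, hDb, has⟩ := exists_monic_mul_eq hD hcD
    have hJγ : J = Ideal.span {γ} := hc.trans (Ideal.span_singleton_eq_span_singleton.mpr has.symm)
    obtain ⟨e, he1, he2⟩ : γ ∈ J := hJγ ▸ Ideal.mem_span_singleton_self γ
    refine ⟨e, γ, b, fun _ => ⟨hb, hDb, he1, he2, fun u hu => ?_⟩⟩
    have : (y u).coeff i ∈ J := ⟨u, hu, rfl⟩
    rwa [hJγ, Ideal.mem_span_singleton] at this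
  choose e γ b hall using hex
  have hγ0 : ∀ i < r, γ i ≠ 0 := fun i hi h => hD (by rw [(hall i hi).2.1, h, zero_mul])
  -- consecutive leading coefficients divide each other
  have hstep : ∀ i, i + 1 < r → ∃ c, γ i = γ (i + 1) * c ∧ b (i + 1) = c * b i := by
    intro i hi
    obtain ⟨hb, hDb, he1, he2, -⟩ := hall i (by omega)
    obtain ⟨hb', hDb', -, -, h3⟩ := hall (i + 1) hi
    have hX := hypi (e i) i he1 hi
    -- `π e_i` has degree at most `i + 1` with coefficient `γ_i` there, so `γ_(i+1)` divides `γ_i`.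
    obtain ⟨c, hc⟩ := h3 (π * e i) (by
      rw [hX]
      refine natDegree_mul_le.trans ?_
      rw [natDegree_X]; omega)
    rw [hX, coeff_X_mul, he2] at hc
    refine ⟨c, hc, mul_left_cancel₀ (hγ0 _ hi) ?_⟩
    rw [← hDb', hDb, hc, mul_assoc]
  -- The crucial point: `γ_i` divides every coefficient of `y u`, not only the top one, so that `f_i
  -- = y(e_i)/γ_i` is defined over `K[X]`. With `γ_i = γ_(i+1) c`, the element `c e_(i+1) - π e_i`
  -- drops to degree at most `i`. Hence `γ_(i+1) c` divides `c y(e_(i+1))`, and `c` cancels. A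
  -- general `u` is reduced to degree at most `i` by subtracting a multiple of `e_(i+1)`.
  have hdvdC : ∀ i, i < r → ∀ u, (y u).natDegree ≤ i → C (γ i) ∣ y u := by
    intro i
    induction i with
    | zero =>
      intro hi u hu
      rw [eq_C_of_natDegree_le_zero hu]
      exact _root_.map_dvd C ((hall 0 hi).2.2.2.2 u hu)
    | succ i ih =>
      intro hi u hu
      obtain ⟨c, hc, -⟩ := hstep i hi
      obtain ⟨-, -, he1, he2, -⟩ := hall i (by omega)
      obtain ⟨-, -, he1', he2', h3'⟩ := hall (i + 1) hi
      have hX := hypi (e i) i he1 hi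
      have hdrop : ∀ p : K[X][X], p.natDegree ≤ i + 1 → p.coeff (i + 1) = 0 → p.natDegree ≤ i := by
        intro p hp hp0
        rw [natDegree_le_iff_coeff_eq_zero] at hp ⊢
        intro N hN
        rcases (show i + 1 ≤ N by omega).eq_or_lt with rfl | h
        · exact hp0
        · exact hp N h
      have hz : y (c • e (i + 1) - π * e i) = C c * y (e (i + 1)) - X * y (e i) := by
        rw [hysub, hysmul, hX]
      have h1 : C (γ i) ∣ y (c • e (i + 1) - π * e i) := by
        refine ih (by omega) _ (hdrop _ ?_ ?_)
        · rw [hz]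
          refine (natDegree_sub_le _ _).trans (max_le ((natDegree_C_mul_le _ _).trans he1') ?_)
          refine natDegree_mul_le.trans ?_
          rw [natDegree_X]; omega
        · rw [hz, coeff_sub, coeff_C_mul, coeff_X_mul, he2, he2', hc]
          ring
      have h2 : C (γ (i + 1)) ∣ y (e (i + 1)) := by
        have h3 : C (γ i) ∣ C c * y (e (i + 1)) := by
          have := dvd_add h1 ((ih (by omega) (e i) he1).mul_left X)
          rwa [hz, sub_add_cancel] at this
        have hc0 : C c ≠ (0 : K[X][X]) := by
          rw [Ne, C_eq_zero]
          rintro rfl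
          exact hγ0 i (by omega) (by rw [hc, mul_zero])
        rw [hc, mul_comm, C_mul] at h3
        exact (mul_dvd_mul_iff_left hc0).mp h3
      obtain ⟨k, hk⟩ := h3' u hu
      have h4 : C (γ i) ∣ y (u - k • e (i + 1)) := by
        refine ih (by omega) _ (hdrop _ ?_ ?_)
        · rw [hysub, hysmul]
          exact (natDegree_sub_le _ _).trans (max_le hu ((natDegree_C_mul_le _ _).trans he1'))
        · rw [hysub, hysmul, coeff_sub, coeff_C_mul, he2', hk]
          ring
      rw [hysub, hysmul] at h4
      have h5 : C (γ (i + 1)) ∣ y u - C k * y (e (i + 1)) :=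
        (_root_.map_dvd C ⟨c, hc⟩).trans h4
      exact (dvd_sub_left (h2.mul_left _)).mp h5
  have hf : ∀ i : Fin r, ∃ f : K[X][X], y (e i) = C (γ i) * f := fun i =>
    hdvdC i i.2 (e i) (hall i i.2).2.2.1
  choose f hf using hf
  have hfd : ∀ i : Fin r, (f i).natDegree ≤ i := fun i => by
    have := (hall i i.2).2.2.1
    rwa [hf, natDegree_C_mul (hγ0 i i.2)] at this
  have hfc : ∀ i : Fin r, (f i).coeff i = 1 := fun i => by
    have := (hall i i.2).2.2.2.1
    rw [hf, coeff_C_mul] at this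
    exact mul_left_cancel₀ (hγ0 i i.2) (by rw [this, mul_one])
  have hfm : ∀ i, (f i).Monic := fun i => monic_of_natDegree_le_of_coeff_eq_one i (hfd i) (hfc i)
  -- The `e_j` generate: the top coefficient of `y u` is a multiple of `γ_i`, and subtracting that
  -- multiple of `e_i` lowers the degree.
  have hspan : ∀ i, i < r → ∀ u, (y u).natDegree ≤ i →
      u ∈ Submodule.span K[X] (Set.range fun j : Fin r => e j) := by
    intro i
    induction i with
    | zero =>
      intro hi u hu
      obtain ⟨-, -, he1, he2, h3⟩ := hall 0 hi
      obtain ⟨k, hk⟩ := h3 u hu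
      have : u - k • e 0 = 0 := hyinj _ (by
        rw [hysub, hysmul, eq_C_of_natDegree_le_zero hu, eq_C_of_natDegree_le_zero he1, he2, hk,
          ← C_mul, mul_comm, sub_self])
      rw [sub_eq_zero.mp this]
      exact Submodule.smul_mem _ _ (Submodule.subset_span ⟨⟨0, hi⟩, rfl⟩)
    | succ i ih =>
      intro hi u hu
      obtain ⟨-, -, he1, he2, h3⟩ := hall (i + 1) hi
      obtain ⟨k, hk⟩ := h3 u hu
      rw [← sub_add_cancel u (k • e (i + 1))]
      refine add_mem (ih (by omega) _ ?_)
        (Submodule.smul_mem _ _ (Submodule.subset_span ⟨⟨i + 1, hi⟩, rfl⟩))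
      rw [natDegree_le_iff_coeff_eq_zero]
      intro N hN
      rw [hysub, hysmul, coeff_sub, coeff_C_mul]
      rcases (show i + 1 ≤ N by omega).eq_or_lt with rfl | h
      · rw [he2, hk]
        ring
      · rw [coeff_eq_zero_of_natDegree_lt (hu.trans_lt h),
          coeff_eq_zero_of_natDegree_lt (he1.trans_lt h), mul_zero, sub_zero]
  have hr0 : 0 < r := by
    rw [← hr]
    exact Module.finrank_pos
  have htop : ⊤ ≤ Submodule.span K[X] (Set.range fun j : Fin r => e j) := fun u _ =>
    hspan (r - 1) (by omega) u (by
      by_cases h0 : y u = 0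
      · simp [h0]
      · have := (natDegree_lt_iff_degree_lt h0).mpr (hydeg u)
        omega)
  let B := basisOfTopLeSpanOfCardEqFinrank (fun j : Fin r => e j) htop (by simp [hr])
  have hB : ∀ i, B i = e i := fun i => by simp [B]
  have hbe : ∀ i : Fin r, b i • e i = aeval π (f i) := by
    intro i
    refine smul_right_injective E (hγ0 i i.2) ?_
    change γ i • b i • e i = γ i • aeval π (f i)
    rw [smul_smul, ← (hall i i.2).2.1, ← hyu, hf, map_mul, aeval_C, Algebra.smul_def]
  refine ⟨fun i => b i, f, B, fun i => (hall i i.2).1, ?_, ?_, hfm, fun i =>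
    le_antisymm (hfd i) (le_natDegree_of_ne_zero (by rw [hfc]; exact one_ne_zero)), fun i => by
    rw [hB, hbe]⟩
  · intro i hi
    have h1 : f i = 1 := (hfm i).natDegree_eq_zero.mp (by have := hfd i; omega)
    have h2 := hbe i
    rw [h1, map_one, Algebra.smul_def] at h2
    -- Here `b_0 e_0 = 1`, so `b_0` is a unit of `E`. By integrality it is a unit of `K[X]`, and a
    -- monic unit is `1`.
    have hu : IsUnit (algebraMap K[X] E (b i)) := IsUnit.of_mul_eq_one _ h2
    have hu' : IsUnit (b i) := by
      have := Algebra.IsIntegral.of_finite K[X] E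
      exact (isUnit_map_iff (algebraMap K[X] E) (b i)).mp hu
    exact (hall i i.2).1.eq_one_of_isUnit hu'
  · intro i j hij
    have key : ∀ k, ∀ i, i + k < r → b i ∣ b (i + k) := by
      intro k
      induction k with
      | zero => exact fun i _ => dvd_rfl
      | succ k ih =>
        intro i hi
        obtain ⟨c, -, hc⟩ := hstep (i + k) hi
        exact (ih i (by omega)).trans ⟨c, by rw [← add_assoc, hc, mul_comm]⟩
    have := key (j - i) i (by have := j.2; omega)
    rwa [Nat.add_sub_cancel' (show (i : ℕ) ≤ j from hij)] at this

/-- The quotient by `K[X][π]` is read off a triangular basis. -/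
theorem nonempty_quotient_adjoin_equiv {r : ℕ} (hr : Module.finrank K[X] E = r)
    {b : Fin r → K[X]} {f : Fin r → K[X][X]} (B : Module.Basis (Fin r) K[X] E)
    (hf : ∀ i, (f i).Monic) (hd : ∀ i, (f i).natDegree = i)
    (hB : ∀ i, b i • B i = aeval π (f i)) :
    Nonempty ((E ⧸ Subalgebra.toSubmodule (Algebra.adjoin K[X] {π})) ≃ₗ[K[X]]
      ((i : Fin r) → K[X] ⧸ Ideal.span {b i})) := by
  let g : E →ₗ[K[X]] ((i : Fin r) → K[X] ⧸ Ideal.span {b i}) :=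
    LinearMap.pi fun i => (Ideal.span {b i}).mkQ.comp (B.coord i)
  have hg : Function.Surjective g := by
    intro x
    choose c hc using fun i => Ideal.Quotient.mk_surjective (x i)
    refine ⟨∑ i, c i • B i, ?_⟩
    ext i
    rw [← hc i]
    have h1 : B.repr (∑ i, c i • B i) i = c i := by simp [Finsupp.single_apply]
    exact congrArg (Ideal.span {b i}).mkQ h1
  -- The kernel is spanned by the `b_i B_i = f_i(π)`. These span `K[X][π]`, since the `f_i` generate
  -- the polynomials of degree less than `r`.
  have hker : LinearMap.ker g = Subalgebra.toSubmodule (Algebra.adjoin K[X] {π}) := by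
    ext u
    rw [LinearMap.mem_ker, Subalgebra.mem_toSubmodule]
    constructor
    · intro h
      have h1 : ∀ i, ∃ c, B.repr u i = b i * c := fun i => by
        have h2 := congrFun h i
        have h3 : B.repr u i ∈ Ideal.span {b i} := (Submodule.Quotient.mk_eq_zero _).mp h2
        exact Ideal.mem_span_singleton.mp h3
      choose c hc using h1
      rw [← B.sum_repr u]
      refine sum_mem fun i _ => ?_
      rw [hc, mul_comm, mul_smul, hB]
      refine Subalgebra.smul_mem _ ?_ _
      rw [Algebra.adjoin_singleton_eq_range_aeval]
      exact ⟨f i, rfl⟩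
    · intro h
      obtain ⟨p, hp, rfl⟩ := exists_natDegree_lt_of_mem_adjoin hr h
      obtain ⟨m, rfl⟩ := exists_eq_sum_monic hf hd hp
      rw [map_sum, map_sum]
      refine Finset.sum_eq_zero fun k _ => ?_
      rw [map_mul, aeval_C, ← Algebra.smul_def, ← hB, map_smul, map_smul]
      ext i
      have : (Ideal.span {b i}).mkQ (b k * B.repr (B k) i) = 0 := by
        rw [Submodule.mkQ_apply, Submodule.Quotient.mk_eq_zero, B.repr_self,
          Finsupp.single_apply]
        split_ifs with hki
        · subst hki
          exact Ideal.mul_mem_right _ _ (Ideal.mem_span_singleton_self _)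
        · rw [mul_zero]
          exact zero_mem _
      have h2 : b k • g (B k) = fun i => (Ideal.span {b i}).mkQ (b k * B.repr (B k) i) := rfl
      rw [Pi.smul_apply, h2]
      exact (congrArg (m k • ·) this).trans (smul_zero _)
  rw [← hker]
  exact ⟨g.quotKerEquivOfSurjective hg⟩

end FrobeniusBasisExistence

/-! ### The shape of the matrix of multiplication by `π`. -/

section Hessenberg

/-- Comparison of coefficients: the coordinates of `πe_j` in a basis `e_i = f_i(π)/b_i`. -/
theorem hessenberg_of_triangular {A E : Type*} [CommRing A] [IsDomain A] [Ring E] [Algebra A E]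
    {π : E} {r : ℕ} (hind : ∀ p : A[X], p.degree < r → aeval π p = 0 → p = 0)
    {b : Fin r → A} (hb : ∀ i, b i ≠ 0) {f : Fin r → A[X]} {e : Fin r → E}
    (hf : ∀ i, (f i).Monic) (hd : ∀ i, (f i).natDegree = i)
    (he : ∀ i, b i • e i = aeval π (f i)) (j : Fin r) (P : A[X]) (hP : P.Monic)
    (hPd : P.natDegree = j + 1) (hPf : ∀ h : (j : ℕ) + 1 < r, P = f ⟨j + 1, h⟩)
    (hP0 : (j : ℕ) + 1 = r → aeval π P = 0) {M : Fin r → A} (hM : π * e j = ∑ i, M i • e i) :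
    (∀ i : Fin r, (j : ℕ) + 1 < i → M i = 0) ∧
    (∀ i : Fin r, (i : ℕ) = j + 1 → b j * M i = b i) ∧
    M j = (f j).nextCoeff - P.nextCoeff := by
  classical
  have hr0 : 0 < r := j.pos
  -- A common denominator: with `B = c_i b_i`, the vector `B e_i` equals `c_i f_i(π)`.
  set B : A := ∏ i, b i with hB
  have hB0 : B ≠ 0 := Finset.prod_ne_zero_iff.mpr fun i _ => hb i
  have hc : ∀ i, ∃ c, B = c * b i := fun i =>
    (Finset.dvd_prod_of_mem b (Finset.mem_univ i)).imp fun c hc => hc.trans (mul_comm _ _)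
  choose c hc using hc
  have hc0 : ∀ i, c i ≠ 0 := fun i h => hB0 (by rw [hc i, h, zero_mul])
  have hnext : ∀ p : A[X], ∀ N, p.natDegree = N + 1 → p.nextCoeff = p.coeff N := by
    intro p N h
    rw [nextCoeff_of_natDegree_pos (by omega), h, Nat.add_sub_cancel]
  -- the difference of two monic polynomials of degree `j + 1`
  set G : A[X] := X * f j - P with hG
  have hXd : (X * f j).natDegree = (j : ℕ) + 1 := by
    rw [natDegree_X_mul (hf j).ne_zero, hd]
  have hXm : (X * f j).Monic := monic_X.mul (hf j)
  have hGd : G.natDegree ≤ j := by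
    rw [natDegree_le_iff_coeff_eq_zero]
    intro N hN
    rw [hG, coeff_sub]
    rcases (show (j : ℕ) + 1 ≤ N by omega).eq_or_lt with rfl | h
    · have h1 := hXm.coeff_natDegree
      have h2 := hP.coeff_natDegree
      rw [hXd] at h1
      rw [hPd] at h2
      rw [h1, h2, sub_self]
    · rw [coeff_eq_zero_of_natDegree_lt (by omega), coeff_eq_zero_of_natDegree_lt (by omega),
        sub_self]
  have hGc : G.coeff j = (f j).nextCoeff - P.nextCoeff := by
    rw [hG, coeff_sub, hnext P j hPd]
    congr 1
    -- For `j = 0` one has `f_0 = 1`, whose `nextCoeff` is `0` by convention. This agrees with the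
    -- constant coefficient of `X * f_0`.
    rcases Nat.eq_zero_or_pos (j : ℕ) with h | h
    · have h1 : (f j) = 1 := (hf j).natDegree_eq_zero.mp (by rw [hd, h])
      rw [h1, h, nextCoeff, if_pos natDegree_one, coeff_X_mul_zero]
    · obtain ⟨k, hk⟩ := Nat.exists_eq_add_of_lt h
      rw [zero_add] at hk
      rw [hk, coeff_X_mul, hnext (f j) k (by rw [hd, hk])]
  have hlt : ∀ p : A[X], p.natDegree < r → p.degree < r := fun p hp =>
    (degree_le_natDegree).trans_lt (by exact_mod_cast hp)
  -- the coordinates of `B b_j π e_j - B P(π)`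
  let δ : Fin r → A := fun i => if (i : ℕ) = j + 1 then B else 0
  have hδ : aeval π (∑ i, C (δ i) * f i) = aeval π (C B * P) := by
    by_cases h : (j : ℕ) + 1 < r
    · rw [Finset.sum_eq_single ⟨j + 1, h⟩]
      · simp [δ, ← hPf h]
      · intro i _ hi
        have : (i : ℕ) ≠ j + 1 := fun h' => hi (Fin.ext h')
        simp [δ, this]
      · simp
    · rw [Finset.sum_eq_zero, map_zero, map_mul, hP0 (by have := j.2; omega), mul_zero]
      intro i _
      have : (i : ℕ) ≠ j + 1 := by have := i.2; omega
      simp [δ, this]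
  have hmain : aeval π (∑ i, C (M i * b j * c i) * f i) = aeval π (C B * (X * f j)) := by
    rw [map_mul, map_mul, aeval_X, ← he j, mul_smul_comm, hM, aeval_C, ← Algebra.smul_def,
      map_sum, Finset.smul_sum, Finset.smul_sum]
    refine Finset.sum_congr rfl fun i _ => ?_
    rw [map_mul, aeval_C, ← Algebra.smul_def, ← he i, smul_smul, smul_smul, smul_smul, hc i]
    congr 1
    ring
  -- Both sides have degree less than `r` and the same value at `π`, so they agree as polynomials.
  -- Since `G` has degree at most `j`, the coordinates beyond `j` vanish, and its coefficient of
  -- index `j` gives the diagonal entry.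
  have hcoord : ∑ i, C (M i * b j * c i - δ i) * f i = C B * G := by
    rw [← sub_eq_zero]
    refine hind _ (hlt _ ?_) ?_
    · refine lt_of_le_of_lt (natDegree_sub_le _ _) (max_lt ?_ ?_)
      · refine lt_of_le_of_lt (natDegree_sum_le_of_forall_le (n := r - 1) _ _ fun i _ => ?_)
          (by omega)
        refine (natDegree_C_mul_le _ _).trans ?_
        rw [hd]
        have := i.2
        omega
      · exact lt_of_le_of_lt ((natDegree_C_mul_le _ _).trans hGd) j.2
    · simp only [C_sub, sub_mul, Finset.sum_sub_distrib]
      rw [map_sub, map_sub, hmain, hδ, hG, mul_sub, map_sub, sub_self]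
  have hzero := eq_zero_of_natDegree_sum_monic_le hf hd _ j
    (by rw [hcoord]; exact (natDegree_C_mul_le _ _).trans hGd)
  refine And.intro (fun i hi => ?_) (And.intro (fun i hi => ?_) ?_)
  · have h := hzero i (by omega)
    have h1 : δ i = 0 := if_neg (by omega)
    rw [h1, sub_zero] at h
    exact (mul_eq_zero.mp ((mul_eq_zero.mp h).resolve_right (hc0 i))).resolve_right (hb j)
  · have h := hzero i (by omega)
    have h1 : δ i = B := if_pos hi
    rw [h1, sub_eq_zero, hc i, mul_comm (c i)] at h
    rw [mul_comm]
    exact mul_right_cancel₀ (hc0 i) h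
  · have h := coeff_sum_monic hf hd _ j fun k hk => hzero k hk
    have h1 : δ j = 0 := if_neg (by omega)
    rw [hcoord, coeff_C_mul, hGc, h1, sub_zero, mul_assoc, mul_comm (b j), ← hc j,
      mul_comm B] at h
    exact (mul_right_cancel₀ hB0 h).symm

end Hessenberg

/-! ### The Frobenius basis of a Drinfeld module over a quotient of `A`. -/

namespace DrinfeldModule

open TwistedPoly

variable {𝔽q L : Type*} [Field 𝔽q] [Fintype 𝔽q] [Field L] [Finite L] [Algebra 𝔽q L]
  [Algebra 𝔽q[X] L] [IsScalarTower 𝔽q 𝔽q[X] L] {r : ℕ} (φ : DrinfeldModule 𝔽q L r)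
  (hA : Function.Surjective (algebraMap 𝔽q[X] L))

/-- The commutative ring structure of the endomorphism ring when `A → L` is surjective. -/
@[reducible] def endCommRing : CommRing φ.End :=
  { (inferInstance : Ring φ.End) with mul_comm := φ.end_mul_comm hA }

-- `1 + cπ` has constant coefficient `1`, so it cannot vanish, and `exists_smul_mem_adjoin` applies.
include hA in
theorem exists_smul_mem_adjoin_frob :
    ∃ D : 𝔽q[X], D ≠ 0 ∧ ∀ u : φ.End, D • u ∈ Algebra.adjoin 𝔽q[X] {φ.frob} := by
  let := φ.endCommRing hA
  refine exists_smul_mem_adjoin (φ.exists_eq_algebraMap_add hA) fun c h => ?_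
  have h1 : ((1 : TwistedPoly 𝔽q L) + c * φ.frob).coeff 0 = (0 : TwistedPoly 𝔽q L).coeff 0 :=
    congrArg (fun z : φ.End => (z : TwistedPoly 𝔽q L).coeff 0) h
  rw [TwistedPoly.coeff_add, TwistedPoly.coeff_one, if_pos rfl, TwistedPoly.coeff_zero,
    ← φ.commute_frob,
    coe_frob, coeff_monomial_mul_of_lt finrank_pos, add_zero] at h1
  exact one_ne_zero h1

include hA in
theorem eq_zero_of_aeval_frob_eq_zero {p : 𝔽q[X][X]} (hp : p.degree < r)
    (h0 : aeval φ.frob p = 0) : p = 0 := by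
  let := φ.endCommRing hA
  obtain ⟨D, hD, hmem⟩ := φ.exists_smul_mem_adjoin_frob hA
  exact eq_zero_of_aeval_eq_zero (φ.finrank_end hA) hD hmem hp h0

include hA in
theorem natDegree_minpoly_frob : (minpoly 𝔽q[X] φ.frob).natDegree = r := by
  let := φ.endCommRing hA
  obtain ⟨D, hD, hmem⟩ := φ.exists_smul_mem_adjoin_frob hA
  exact natDegree_minpoly_of_index (φ.finrank_end hA) hD hmem

include hA in
theorem nonempty_frobeniusBasis : Nonempty φ.FrobeniusBasis := by
  let := φ.endCommRing hA
  obtain ⟨D, hD, hmem⟩ := φ.exists_smul_mem_adjoin_frob hA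
  obtain ⟨b, f, B, h1, h2, h3, h4, h5, h6⟩ := exists_triangular_basis (φ.finrank_end hA) hD hmem
  exact ⟨⟨b, f, B, h1, h2, h3,
    nonempty_quotient_adjoin_equiv (φ.finrank_end hA) B h4 h5 h6, h4, h5, h6⟩⟩

theorem FrobeniusBasis.frob_mul_basis {φ : DrinfeldModule 𝔽q L r} (D : φ.FrobeniusBasis)
    (j : Fin r) : φ.frob * D.basis j = ∑ i, D.matrix i j • D.basis i := by
  conv_lhs => rw [← D.basis.sum_repr (φ.frob * D.basis j)]
  refine Finset.sum_congr rfl fun i _ => ?_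
  rw [FrobeniusBasis.matrix, LinearMap.toMatrix_apply, LinearMap.mulLeft_apply]

-- In the last column the minimal polynomial of `π`, of degree `r` and zero at `π`, plays the role
-- of the missing `f_r`.
include hA in
theorem FrobeniusBasis.hasExplicitShape {φ : DrinfeldModule 𝔽q L r} (D : φ.FrobeniusBasis) :
    D.HasExplicitShape := by
  intro i j
  have hint : IsIntegral 𝔽q[X] φ.frob := by
    let := φ.endCommRing hA
    exact Algebra.IsIntegral.isIntegral (R := 𝔽q[X]) φ.frob
  have hpoly : ∀ i : Fin r, D.poly i = D.f i := fun i => dif_pos i.2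
  obtain ⟨h1, h2, h3⟩ := hessenberg_of_triangular (M := fun i => D.matrix i j)
    (fun p hp h0 => φ.eq_zero_of_aeval_frob_eq_zero hA hp h0) (fun i => (D.b_monic i).ne_zero)
    D.f_monic D.f_natDegree D.smul_basis j (D.poly (j + 1))
    (by
      unfold FrobeniusBasis.poly
      split_ifs
      · exact D.f_monic _
      · exact minpoly.monic hint)
    (by
      unfold FrobeniusBasis.poly
      split_ifs
      · exact D.f_natDegree _
      · rw [φ.natDegree_minpoly_frob hA]
        have := j.2
        omega)
    (fun h => dif_pos h)
    (fun h => by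
      unfold FrobeniusBasis.poly
      rw [dif_neg (by omega)]
      exact minpoly.aeval _ _)
    (D.frob_mul_basis j)
  refine ⟨h1 i, h2 i, ?_⟩
  rintro rfl
  rw [h3, hpoly]

end DrinfeldModule

/-! ### Structure of the torsion and the division field. -/

theorem exists_basis_of_card_eq_pow {R M : Type*} [Ring R] [AddCommGroup M] [Module R M]
    [Finite R] [Finite M] {r : ℕ} (hcard : Nat.card M = Nat.card R ^ r) (v : Fin r → M)
    (h : Function.Injective (fun c : Fin r → R => ∑ i, c i • v i) ∨
      Function.Surjective (fun c : Fin r → R => ∑ i, c i • v i)) :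
    ∃ B : Module.Basis (Fin r) R M, ⇑B = v := by
  let g : (Fin r → R) →ₗ[R] M :=
    { toFun := fun c => ∑ i, c i • v i
      map_add' := fun c d => by simp [add_smul, Finset.sum_add_distrib]
      map_smul' := fun c d => by
        change ∑ i, (c * d i) • v i = c • ∑ i, d i • v i
        rw [Finset.smul_sum]
        exact Finset.sum_congr rfl fun i _ => mul_smul _ _ _ }
  -- The two finite modules have the same size, so independence or generation alone gives a basis.
  have hc : Nat.card (Fin r → R) = Nat.card M := by rw [hcard, Nat.card_fun, Nat.card_fin]
  have hg : Function.Bijective g := by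
    rcases h with h | h
    · exact (Nat.bijective_iff_injective_and_card g).mpr ⟨h, hc⟩
    · exact (Nat.bijective_iff_surjective_and_card g).mpr ⟨h, hc⟩
  refine ⟨Module.Basis.ofEquivFun (LinearEquiv.ofBijective g hg).symm, ?_⟩
  ext i
  rw [Module.Basis.coe_ofEquivFun, LinearEquiv.symm_symm]
  change ∑ j, _ • v j = v i
  rw [Finset.sum_eq_single i]
  · simp
  · intro j _ hj
    rw [Pi.single_eq_of_ne hj, zero_smul]
  · simp

theorem card_quotient_span_singleton {K : Type*} [Field K] [Fintype K] {n : K[X]} (hn : n ≠ 0) :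
    Nat.card (K[X] ⧸ Ideal.span {n}) = Fintype.card K ^ n.natDegree := by
  have h1 : Module.finrank K (AdjoinRoot n) = n.natDegree := by
    rw [(AdjoinRoot.powerBasis hn).finrank, AdjoinRoot.powerBasis_dim]
  have : Module.Finite K (AdjoinRoot n) := (AdjoinRoot.powerBasis hn).finite
  rw [← h1, ← Nat.card_eq_fintype_card]
  exact Module.natCard_eq_pow_finrank (K := K) (V := AdjoinRoot n)

theorem finite_quotient_span_singleton {K : Type*} [Field K] [Fintype K] {n : K[X]} (hn : n ≠ 0) :
    Finite (K[X] ⧸ Ideal.span {n}) :=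
  Nat.finite_of_card_ne_zero (by
    rw [card_quotient_span_singleton hn]
    exact pow_ne_zero _ Fintype.card_ne_zero)

namespace DrinfeldModule

open TwistedPoly

variable {𝔽q L : Type*} [Field 𝔽q] [Fintype 𝔽q] [Field L] [Algebra 𝔽q L]
  [Algebra 𝔽q[X] L] [IsScalarTower 𝔽q 𝔽q[X] L] {r : ℕ} (φ : DrinfeldModule 𝔽q L r)

/-- The ordinary polynomial with roots `φ[n]`. -/
def torsionPolynomial (n : 𝔽q[X]) : L[X] := toPolynomial (n.natDegree * r) (φ.toAlgHom n)

theorem aeval_torsionPolynomial {n : 𝔽q[X]} (hn : n ≠ 0) (x : AlgebraicClosure L) :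
    φ.toPoints (aeval x (φ.torsionPolynomial n)) = n • φ.toPoints x := by
  rw [torsionPolynomial, aeval_toPolynomial (φ.hasDegree_toAlgHom hn).1]
  rfl

theorem natDegree_torsionPolynomial {n : 𝔽q[X]} (hn : n ≠ 0) :
    (φ.torsionPolynomial n).natDegree = Fintype.card 𝔽q ^ (n.natDegree * r) :=
  natDegree_toPolynomial (φ.hasDegree_toAlgHom hn).2

theorem torsionPolynomial_ne_zero {n : 𝔽q[X]} (hn : n ≠ 0) : φ.torsionPolynomial n ≠ 0 := by
  intro h
  have := φ.natDegree_torsionPolynomial hn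
  rw [h, natDegree_zero] at this
  exact pow_ne_zero _ Fintype.card_ne_zero this.symm

theorem ne_zero_of_algebraMap_ne_zero {n : 𝔽q[X]} (hn : algebraMap 𝔽q[X] L n ≠ 0) : n ≠ 0 := by
  rintro rfl
  exact hn (map_zero _)

/-- The derivative is the nonzero constant `γ(n)`. Hence the number of torsion points equals the
degree of the polynomial. -/
theorem separable_torsionPolynomial {n : 𝔽q[X]} (hn : algebraMap 𝔽q[X] L n ≠ 0) :
    (φ.torsionPolynomial n).Separable := by
  rw [Separable, torsionPolynomial, derivative_toPolynomial, coeff_zero_toAlgHom]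
  exact ⟨0, C (algebraMap 𝔽q[X] L n)⁻¹, by
    rw [zero_mul, zero_add, ← C_mul, inv_mul_cancel₀ hn, C_1]⟩

theorem mem_torsion_iff {n : 𝔽q[X]} {x : φ.Points} : x ∈ φ.torsion n ↔ n • x = 0 :=
  Submodule.mem_torsionBy_iff n x

theorem mem_rootSet_torsionPolynomial {n : 𝔽q[X]} (hn : n ≠ 0) (x : AlgebraicClosure L) :
    x ∈ (φ.torsionPolynomial n).rootSet (AlgebraicClosure L) ↔ φ.toPoints x ∈ φ.torsion n := by
  rw [mem_rootSet, mem_torsion_iff, ← aeval_torsionPolynomial φ hn]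
  simp [torsionPolynomial_ne_zero φ hn]

theorem card_torsion {n : 𝔽q[X]} (hn : algebraMap 𝔽q[X] L n ≠ 0) :
    Nat.card (φ.torsion n) = Fintype.card 𝔽q ^ (n.natDegree * r) := by
  have hn0 := ne_zero_of_algebraMap_ne_zero hn
  rw [← φ.natDegree_torsionPolynomial hn0, ← card_rootSet_eq_natDegree (K := AlgebraicClosure L)
    (φ.separable_torsionPolynomial hn) (IsAlgClosed.splits _), ← Nat.card_eq_fintype_card]
  refine Nat.card_congr (φ.toPoints.toEquiv.subtypeEquiv fun x => ?_).symm
  exact φ.mem_rootSet_torsionPolynomial hn0 x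

theorem finite_torsion {n : 𝔽q[X]} (hn : algebraMap 𝔽q[X] L n ≠ 0) : Finite (φ.torsion n) :=
  Nat.finite_of_card_ne_zero (by
    rw [φ.card_torsion hn]
    exact pow_ne_zero _ Fintype.card_ne_zero)

theorem card_torsion_eq_card_quotient_pow {n : 𝔽q[X]} (hn : algebraMap 𝔽q[X] L n ≠ 0) :
    Nat.card (φ.torsion n) = Nat.card (𝔽q[X] ⧸ Ideal.span {n}) ^ r := by
  rw [φ.card_torsion hn, card_quotient_span_singleton (ne_zero_of_algebraMap_ne_zero hn), pow_mul]

/-- The points of `φ` are divisible. -/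
theorem exists_smul_eq {n : 𝔽q[X]} (hn : n ≠ 0) (y : φ.Points) : ∃ x : φ.Points, n • x = y := by
  have hdeg : ((φ.torsionPolynomial n).map (algebraMap L (AlgebraicClosure L)) -
      C (φ.toPoints.symm y)).degree ≠ 0 := by
    have h1 : 0 < ((φ.torsionPolynomial n).map (algebraMap L (AlgebraicClosure L))).natDegree := by
      rw [natDegree_map, φ.natDegree_torsionPolynomial hn]
      exact pow_pos Fintype.card_pos _
    have h2 := natDegree_sub_C (p := (φ.torsionPolynomial n).map
      (algebraMap L (AlgebraicClosure L))) (a := φ.toPoints.symm y)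
    intro h
    have := natDegree_eq_zero_iff_degree_le_zero.mpr h.le
    omega
  obtain ⟨x, hx⟩ := IsAlgClosed.exists_root _ hdeg
  refine ⟨φ.toPoints x, ?_⟩
  rw [← φ.aeval_torsionPolynomial hn]
  rw [IsRoot, eval_sub, eval_C, eval_map_algebraMap, sub_eq_zero] at hx
  rw [hx]
  rfl

theorem mk_smul_torsion {n : 𝔽q[X]} (a : 𝔽q[X]) (x : φ.torsion n) :
    (Ideal.Quotient.mk (Ideal.span {n}) a) • x = a • x := rfl

/-- `φ[ℓ]` is a vector space over the field `A/ℓ`, and its cardinality forces dimension `r`. -/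
theorem exists_independent_torsion_of_irreducible {ℓ : 𝔽q[X]} (hℓ : Irreducible ℓ)
    (hγ : algebraMap 𝔽q[X] L ℓ ≠ 0) :
    ∃ z : Fin r → φ.Points, (∀ i, ℓ • z i = 0) ∧
      ∀ a : Fin r → 𝔽q[X], ∑ i, a i • z i = 0 → ∀ i, ℓ ∣ a i := by
  have hmax : (Ideal.span {ℓ}).IsMaximal := PrincipalIdealRing.isMaximal_of_irreducible hℓ
  let := Ideal.Quotient.field (Ideal.span {ℓ})
  have := φ.finite_torsion hγ
  have := finite_quotient_span_singleton hℓ.ne_zero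
  have : Module.Finite (𝔽q[X] ⧸ Ideal.span {ℓ}) (φ.torsion ℓ) := Module.Finite.of_finite
  have hrank : Module.finrank (𝔽q[X] ⧸ Ideal.span {ℓ}) (φ.torsion ℓ) = r := by
    have h1 := Module.natCard_eq_pow_finrank (K := 𝔽q[X] ⧸ Ideal.span {ℓ}) (V := φ.torsion ℓ)
    rw [φ.card_torsion_eq_card_quotient_pow hγ] at h1
    exact (Nat.pow_right_injective (Nat.succ_le_of_lt Finite.one_lt_card) h1).symm
  let B := Module.finBasisOfFinrankEq _ _ hrank
  refine ⟨fun i => (B i : φ.Points), fun i => φ.mem_torsion_iff.mp (B i).2, fun a ha i => ?_⟩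
  have h1 : ∑ i, Ideal.Quotient.mk (Ideal.span {ℓ}) (a i) • B i = 0 := by
    refine Subtype.ext ?_
    simpa [mk_smul_torsion] using ha
  have h2 := Fintype.linearIndependent_iff.mp B.linearIndependent _ h1 i
  rwa [Ideal.Quotient.eq_zero_iff_mem, Ideal.mem_span_singleton] at h2

/-- Induction on the prime factors. If `ℓ ∣ n`, points `y_i` with `ℓ y_i = x_i` work: a relation
multiplied by `ℓ` gives `n ∣ a_i`, so `a_i = ℓ c_i`, and the original relation becomes `∑ c_i x_i =
0`, whence `n ∣ c_i`. If `ℓ` is prime to `n`, the sums of independent points of orders `n` and `ℓ`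
work. -/
theorem exists_independent_torsion {n : 𝔽q[X]} (hn : algebraMap 𝔽q[X] L n ≠ 0) :
    ∃ x : Fin r → φ.Points, (∀ i, n • x i = 0) ∧
      ∀ a : Fin r → 𝔽q[X], ∑ i, a i • x i = 0 → ∀ i, n ∣ a i := by
  induction n using UniqueFactorizationMonoid.induction_on_prime with
  | h₁ => exact absurd (map_zero _) hn
  | h₂ u hu => exact ⟨0, fun i => smul_zero _, fun a _ i => hu.dvd⟩
  | h₃ n ℓ hn0 hℓ ih =>
    rw [map_mul] at hn
    obtain ⟨x, hx, hx'⟩ := ih (right_ne_zero_of_mul hn)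
    by_cases hdvd : ℓ ∣ n
    · choose y hy using fun i => φ.exists_smul_eq hℓ.ne_zero (x i)
      refine ⟨y, fun i => by rw [mul_comm, mul_smul, hy, hx], fun a ha i => ?_⟩
      have h1 : ∀ i, n ∣ a i := hx' a (by
        have := congrArg (ℓ • ·) ha
        simp only [Finset.smul_sum, smul_zero] at this
        rw [← this]
        exact Finset.sum_congr rfl fun i _ => by rw [smul_comm ℓ, hy])
      choose c hc using fun i => hdvd.trans (h1 i)
      have h2 := hx' c (by
        rw [← ha]
        exact Finset.sum_congr rfl fun i _ => by rw [hc, mul_comm, mul_smul, hy])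
      rw [hc]
      exact mul_dvd_mul_left ℓ (h2 i)
    · obtain ⟨z, hz, hz'⟩ := φ.exists_independent_torsion_of_irreducible hℓ.irreducible
        (left_ne_zero_of_mul hn)
      have hcop : IsCoprime ℓ n := (hℓ.irreducible.coprime_iff_not_dvd).mpr hdvd
      refine ⟨fun i => x i + z i, fun i => ?_, fun a ha i => ?_⟩
      · rw [smul_add, mul_smul, hx, smul_zero, zero_add, mul_comm, mul_smul, hz, smul_zero]
      · have h1 : n ∣ ℓ * a i := hx' (fun i => ℓ * a i) (by
          have := congrArg (ℓ • ·) ha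
          simp only [Finset.smul_sum, smul_zero] at this
          rw [← this]
          exact Finset.sum_congr rfl fun i _ => by
            rw [smul_comm ℓ (a i), smul_add, hz, add_zero, mul_comm, mul_smul]) i
        have h2 : ℓ ∣ n * a i := hz' (fun i => n * a i) (by
          have := congrArg (n • ·) ha
          simp only [Finset.smul_sum, smul_zero] at this
          rw [← this]
          exact Finset.sum_congr rfl fun i _ => by
            rw [smul_comm n (a i), smul_add, hx, zero_add, mul_comm, mul_smul]) i
        exact hcop.mul_dvd (hcop.dvd_of_dvd_mul_left h2) (hcop.symm.dvd_of_dvd_mul_left h1)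

theorem nonempty_basis_torsion {n : 𝔽q[X]} (hn : algebraMap 𝔽q[X] L n ≠ 0) :
    Nonempty (Module.Basis (Fin r) (𝔽q[X] ⧸ Ideal.span {n}) (φ.torsion n)) := by
  have := φ.finite_torsion hn
  have := finite_quotient_span_singleton (ne_zero_of_algebraMap_ne_zero hn)
  obtain ⟨x, hx, hx'⟩ := φ.exists_independent_torsion hn
  obtain ⟨B, -⟩ := exists_basis_of_card_eq_pow (φ.card_torsion_eq_card_quotient_pow hn)
    (fun i => (⟨x i, φ.mem_torsion_iff.mpr (hx i)⟩ : φ.torsion n)) (Or.inl (by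
      intro c d hcd
      choose a ha using fun i => Ideal.Quotient.mk_surjective (c i - d i)
      have h1 : ∑ i, (c i - d i) • (⟨x i, φ.mem_torsion_iff.mpr (hx i)⟩ : φ.torsion n) = 0 := by
        simp only [sub_smul, Finset.sum_sub_distrib]
        exact sub_eq_zero.mpr hcd
      have h2 := hx' a (by
        have := congrArg (fun z : φ.torsion n => (z : φ.Points)) h1
        simpa [← ha, mk_smul_torsion] using this)
      funext i
      rw [← sub_eq_zero, ← ha, Ideal.Quotient.eq_zero_iff_mem, Ideal.mem_span_singleton]
      exact h2 i))
  exact ⟨B⟩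

theorem divisionField_eq_adjoin_rootSet {n : 𝔽q[X]} (hn : n ≠ 0) : φ.divisionField n =
    IntermediateField.adjoin L ((φ.torsionPolynomial n).rootSet (AlgebraicClosure L)) := by
  rw [divisionField]
  congr 1
  ext x
  exact (φ.mem_rootSet_torsionPolynomial hn x).symm

theorem isSplittingField_divisionField {n : 𝔽q[X]} (hn : n ≠ 0) :
    (φ.torsionPolynomial n).IsSplittingField L (φ.divisionField n) := by
  rw [φ.divisionField_eq_adjoin_rootSet hn]
  exact IntermediateField.adjoin_rootSet_isSplittingField (IsAlgClosed.splits _)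

theorem finiteDimensional_divisionField {n : 𝔽q[X]} (hn : n ≠ 0) :
    FiniteDimensional L (φ.divisionField n) :=
  have := φ.isSplittingField_divisionField hn
  IsSplittingField.finiteDimensional _ (φ.torsionPolynomial n)

theorem isGalois_divisionField {n : 𝔽q[X]} (hn : algebraMap 𝔽q[X] L n ≠ 0) :
    IsGalois L (φ.divisionField n) :=
  have := φ.isSplittingField_divisionField (ne_zero_of_algebraMap_ne_zero hn)
  IsGalois.of_separable_splitting_field (φ.separable_torsionPolynomial hn)

/-- An automorphism of the division field that fixes the torsion points is trivial. -/
theorem eq_one_of_torsion_fixed {n : 𝔽q[X]} {σ : φ.divisionField n ≃ₐ[L] φ.divisionField n}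
    (h : ∀ x : φ.torsion n, σ (φ.torsionToField x) = φ.torsionToField x) : σ = 1 := by
  have key : ∀ (y : AlgebraicClosure L) (hy : y ∈ φ.divisionField n), σ ⟨y, hy⟩ = ⟨y, hy⟩ := by
    intro y hy
    refine IntermediateField.adjoin_induction L
      (p := fun y hy => σ ⟨y, hy⟩ = ⟨y, hy⟩) ?_ ?_ ?_ ?_ ?_ hy
    · intro x hx
      exact h ⟨φ.toPoints x, hx⟩
    · exact fun c => σ.commutes c
    · intro x y hx hy h1 h2
      exact (map_add σ ⟨x, hx⟩ ⟨y, hy⟩).trans (by rw [h1, h2])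
    · intro x hx h1
      exact (map_inv₀ σ ⟨x, hx⟩).trans (by rw [h1])
    · intro x y hx hy h1 h2
      exact (map_mul σ ⟨x, hx⟩ ⟨y, hy⟩).trans (by rw [h1, h2])
  exact AlgEquiv.ext fun y => key y y.2

theorem galMatrixRep_injective {n : 𝔽q[X]}
    (β : Module.Basis (Fin r) (𝔽q[X] ⧸ Ideal.span {n}) (φ.torsion n)) :
    Function.Injective (φ.galMatrixRep β) := by
  rw [injective_iff_map_eq_one]
  intro σ hσ
  have h1 : LinearMap.toMatrixAlgEquiv β (φ.galRep n σ) = 1 :=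
    congrArg (fun M : GL (Fin r) (𝔽q[X] ⧸ Ideal.span {n}) =>
      (M : Matrix (Fin r) (Fin r) (𝔽q[X] ⧸ Ideal.span {n}))) hσ
  have h2 : φ.galRep n σ = 1 := (LinearMap.toMatrixAlgEquiv β).injective (h1.trans (map_one _).symm)
  refine φ.eq_one_of_torsion_fixed fun x => ?_
  have h3 := congrArg Subtype.val (DFunLike.congr_fun h2 x)
  exact Subtype.ext h3

end DrinfeldModule

/-! ### From free Tate modules to a cyclic torsion module. -/

namespace DrinfeldModule

open TwistedPoly

section General

variable {𝔽q L : Type*} [Field 𝔽q] [Fintype 𝔽q] [Field L] [Algebra 𝔽q L]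
  [Algebra 𝔽q[X] L] [IsScalarTower 𝔽q 𝔽q[X] L] {r : ℕ} (φ : DrinfeldModule 𝔽q L r)

/-- A torsion point of order `ℓ` lifts to the Tate module. -/
theorem exists_tateModule_lift {ℓ : 𝔽q[X]} (hℓ : ℓ ≠ 0) {x : φ.Points} (hx : ℓ • x = 0) :
    ∃ t : φ.TateModule ℓ, t.1 1 = x := by
  choose g hg using φ.exists_smul_eq hℓ
  have hs : ∀ m, ℓ • (g^[m + 1] (ℓ • x)) = g^[m] (ℓ • x) := fun m => by
    rw [Function.iterate_succ_apply', hg]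
  -- The component of index `0` is killed by `ℓ ^ 0 = 1`, so it must be `0`; the point `x` sits at
  -- index `1`, followed by iterated division by `ℓ`.
  let t : ℕ → φ.Points := fun m => if m = 0 then 0 else g^[m - 1] x
  have ht : ∀ m, ℓ • t (m + 1) = t m := by
    intro m
    rcases m with _ | m
    · simpa [t] using hx
    · simp only [t, Nat.add_eq_zero_iff, one_ne_zero, and_false, if_false, Nat.add_sub_cancel]
      rw [Function.iterate_succ_apply', hg]
  refine ⟨⟨t, fun m => ?_, ht⟩, rfl⟩
  induction m with
  | zero => simp [t]
  | succ m ih => rw [pow_succ, mul_smul, ht, ih]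

/-- The first component of a generator of `T_ℓ(φ)` generates `φ[ℓ]`, because every `ℓ`-torsion point
lifts. At that level `A_ℓ` acts through `A/ℓ`, so the completed ring can be replaced by `End`. -/
theorem exists_end_generator_of_tateModule {ℓ : 𝔽q[X]} (hℓ : ℓ ≠ 0)
    (h : φ.TateModuleIsFreeOfRankOne ℓ) :
    ∃ z : φ.Points, ℓ • z = 0 ∧ ∀ x : φ.Points, ℓ • x = 0 → ∃ u : φ.End, x = u • z := by
  obtain ⟨θ⟩ := h
  let t := θ.symm 1
  refine ⟨t.1 1, by simpa using t.2.1 1, fun x hx => ?_⟩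
  obtain ⟨s, rfl⟩ := φ.exists_tateModule_lift hℓ hx
  have hs : s = θ s • t := by
    have h1 : θ s • (1 : φ.EndCompletion ℓ) = θ s := mul_one (θ s)
    rw [← map_smul, h1, LinearEquiv.symm_apply_apply]
  have key : ∀ Y : φ.EndCompletion ℓ, ∃ u : φ.End, (Y • t).1 1 = u • t.1 1 := by
    intro Y
    induction Y using TensorProduct.induction_on with
    | zero =>
      have h1 := add_smul (0 : φ.EndCompletion ℓ) 0 t
      rw [add_zero, left_eq_add] at h1
      exact ⟨0, (congrArg (fun s : φ.TateModule ℓ => s.1 1) h1).trans (zero_smul _ _).symm⟩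
    | tmul u a =>
      refine ⟨u * algebraMap 𝔽q[X] φ.End (approx a 1), ?_⟩
      rw [mul_smul, algebraMap_smul]
      rfl
    | add Y Z hY hZ =>
      obtain ⟨u, hu⟩ := hY
      obtain ⟨w, hw⟩ := hZ
      refine ⟨u + w, ?_⟩
      rw [add_smul, ← hu, ← hw]
      exact congrArg (fun s : φ.TateModule ℓ => s.1 1) (add_smul (Y : φ.EndCompletion ℓ) Z t)
  obtain ⟨u, hu⟩ := key (θ s)
  exact ⟨u, by rw [← hu, ← hs]⟩

/-- If the Tate modules at the primes dividing `n` are free of rank one, then `φ[n]` is a cyclic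
module over the endomorphism ring. -/
theorem exists_end_generator {n : 𝔽q[X]} (hn : n ≠ 0)
    (h : ∀ ℓ : 𝔽q[X], ℓ.Monic → Irreducible ℓ → ℓ ∣ n → φ.TateModuleIsFreeOfRankOne ℓ) :
    ∃ w : φ.Points, n • w = 0 ∧ ∀ x : φ.Points, n • x = 0 → ∃ u : φ.End, x = u • w := by
  have hirr : ∀ ℓ : 𝔽q[X], Prime ℓ → ℓ ∣ n → ∃ z : φ.Points, ℓ • z = 0 ∧
      ∀ x : φ.Points, ℓ • x = 0 → ∃ u : φ.End, x = u • z := by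
    intro ℓ hℓ hd
    have hl : ℓ.leadingCoeff ≠ 0 := leadingCoeff_ne_zero.mpr hℓ.ne_zero
    have has : Associated ℓ (ℓ * C ℓ.leadingCoeff⁻¹) :=
      (associated_mul_unit_right ℓ _ (isUnit_C.mpr (isUnit_iff_ne_zero.mpr (inv_ne_zero hl))))
    obtain ⟨z, hz, hz'⟩ := φ.exists_end_generator_of_tateModule
      (monic_mul_leadingCoeff_inv hℓ.ne_zero).ne_zero
      (h _ (monic_mul_leadingCoeff_inv hℓ.ne_zero) (has.irreducible hℓ.irreducible)
        (has.symm.dvd.trans hd))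
    have h1 : ∀ {a b : 𝔽q[X]} {x : φ.Points}, a ∣ b → a • x = 0 → b • x = 0 := by
      rintro a _ x ⟨c, rfl⟩ hx
      rw [mul_comm, mul_smul, hx, smul_zero]
    exact ⟨z, h1 has.symm.dvd hz, fun x hx => hz' x (h1 has.dvd hx)⟩
  clear h
  induction n using UniqueFactorizationMonoid.induction_on_prime with
  | h₁ => exact absurd rfl hn
  | h₂ c hc =>
    refine ⟨0, smul_zero _, fun x hx => ⟨0, ?_⟩⟩
    obtain ⟨d, hd⟩ := hc.exists_left_inv
    rw [smul_zero, ← one_smul 𝔽q[X] x, ← hd, mul_smul, hx, smul_zero]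
  | h₃ n ℓ hn0 hℓ ih =>
    obtain ⟨w, hw, hw'⟩ := ih hn0 fun l hl hd => hirr l hl (hd.mul_left ℓ)
    obtain ⟨z, hz, hz'⟩ := hirr ℓ hℓ (dvd_mul_right ℓ n)
    -- If `ℓ ∣ n`, take `v` with `ℓ v = w`. Subtracting a suitable `u v` from `x` leaves an
    -- `ℓ`-torsion point, hence an `n`-torsion point, of the form `u' w = u' ℓ v`.
    by_cases hdvd : ℓ ∣ n
    · obtain ⟨v, hv⟩ := φ.exists_smul_eq hℓ.ne_zero w
      refine ⟨v, by rw [mul_comm, mul_smul, hv, hw], fun x hx => ?_⟩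
      obtain ⟨u, hu⟩ := hw' (ℓ • x) (by rw [← mul_smul, mul_comm, hx])
      have h1 : ℓ • (x - u • v) = 0 := by
        rw [smul_sub, hu, smul_comm, hv, sub_self]
      obtain ⟨u', hu'⟩ := hw' (x - u • v) (by
        obtain ⟨c, rfl⟩ := hdvd
        rw [mul_comm, mul_smul, h1, smul_zero])
      refine ⟨u + u' * algebraMap 𝔽q[X] φ.End ℓ, ?_⟩
      rw [add_smul, mul_smul, algebraMap_smul, hv, ← hu']
      abel
    -- If `a ℓ + b n = 1`, then `a ℓ` and `b n` project `w + z` to `w` and `z`, and `x = a (ℓ x) + b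
    -- (n x)` splits in the same way.
    · obtain ⟨a, b, hab⟩ := (hℓ.irreducible.coprime_iff_not_dvd).mpr hdvd
      refine ⟨w + z, ?_, fun x hx => ?_⟩
      · rw [smul_add, mul_smul, hw, smul_zero, zero_add, mul_comm, mul_smul, hz, smul_zero]
      · obtain ⟨u, hu⟩ := hw' (ℓ • x) (by rw [← mul_smul, mul_comm, hx])
        obtain ⟨u', hu'⟩ := hz' (n • x) (by rw [← mul_smul, hx])
        have h1 : (a * ℓ) • (w + z) = w := by
          rw [smul_add, mul_smul a ℓ z, hz, smul_zero, add_zero]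
          conv_rhs => rw [← one_smul 𝔽q[X] w, ← hab, add_smul, mul_smul b, hw, smul_zero, add_zero]
        have h2 : (b * n) • (w + z) = z := by
          rw [smul_add, mul_smul b n w, hw, smul_zero, zero_add]
          conv_rhs => rw [← one_smul 𝔽q[X] z, ← hab, add_smul, mul_smul a, hz, smul_zero, zero_add]
        refine ⟨algebraMap 𝔽q[X] φ.End a * u * algebraMap 𝔽q[X] φ.End (a * ℓ) +
          algebraMap 𝔽q[X] φ.End b * u' * algebraMap 𝔽q[X] φ.End (b * n), ?_⟩
        rw [add_smul, mul_smul, mul_smul, mul_smul, mul_smul, algebraMap_smul, algebraMap_smul,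
          algebraMap_smul, algebraMap_smul, h1, h2, ← hu, ← hu', ← mul_smul, ← mul_smul,
          ← add_smul, hab, one_smul]

end General

end DrinfeldModule

theorem TwistedPoly.leadingCoeff_toPolynomial {𝔽q L : Type*} [Field 𝔽q] [Fintype 𝔽q] [CommRing L]
    [Algebra 𝔽q L] {N : ℕ} {u : TwistedPoly 𝔽q L} (h : u.coeff N ≠ 0) :
    (TwistedPoly.toPolynomial N u).leadingCoeff = u.coeff N := by
  have hq : 1 < Fintype.card 𝔽q := Fintype.one_lt_card
  rw [leadingCoeff, natDegree_toPolynomial h, TwistedPoly.toPolynomial, finsetSum_coeff,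
    Finset.sum_eq_single N]
  · simp
  · intro i _ hi
    have : Fintype.card 𝔽q ^ N ≠ Fintype.card 𝔽q ^ i := fun h' =>
      hi (Nat.pow_right_injective hq h').symm
    rw [coeff_C_mul, coeff_X_pow, if_neg this, mul_zero]
  · simp

/-! ### Reduction modulo `𝔭` and integrality of the torsion points. -/

namespace DrinfeldModule

open TwistedPoly

section Reduction

variable {𝔽q : Type*} [Field 𝔽q] [Fintype 𝔽q] (v : HeightOneSpectrum 𝔽q[X])
  {F : Type*} [Field F] [Algebra 𝔽q F] [Algebra 𝔽q[X] F] [IsScalarTower 𝔽q 𝔽q[X] F]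
  [IsFractionRing 𝔽q[X] F] {r : ℕ}

theorem mk_ne_zero_of_notMem {s : 𝔽q[X]} (hs : s ∉ v.asIdeal) :
    Ideal.Quotient.mk v.asIdeal s ≠ 0 := by
  rwa [Ne, Ideal.Quotient.eq_zero_iff_mem]

theorem exists_fraction_of_valuation_le_one {x : F} (hx : v.valuation F x ≤ 1) :
    ∃ a s : 𝔽q[X], s ∉ v.asIdeal ∧ x * algebraMap 𝔽q[X] F s = algebraMap 𝔽q[X] F a ∧
      reduceElt v x * Ideal.Quotient.mk v.asIdeal s = Ideal.Quotient.mk v.asIdeal a := by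
  have hmul : algebraMap 𝔽q[X] F (IsFractionRing.num 𝔽q[X] x) =
      x * algebraMap 𝔽q[X] F (IsFractionRing.den 𝔽q[X] x : 𝔽q[X]) :=
    (IsFractionRing.num_mul_den_eq_num_iff_eq.mpr rfl).symm
  have hden : (IsFractionRing.den 𝔽q[X] x : 𝔽q[X]) ∉ v.asIdeal := by
    intro hd
    have hn : IsFractionRing.num 𝔽q[X] x ∈ v.asIdeal := by
      have h := congrArg (v.valuation F) hmul
      rw [map_mul] at h
      rw [← v.valuation_lt_one_iff_mem (K := F)]
      exact h.trans_lt ((mul_le_of_le_one_left' hx).trans_lt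
        ((v.valuation_lt_one_iff_mem _).mpr hd))
    obtain ⟨a, ha⟩ := (IsPrincipalIdealRing.principal v.asIdeal).principal
    have hau : IsUnit a := by
      rw [ha] at hn hd
      exact IsFractionRing.num_den_reduced 𝔽q[X] x (Ideal.mem_span_singleton.mp hn)
        (Ideal.mem_span_singleton.mp hd)
    exact v.isPrime.ne_top (ha.trans (Ideal.span_singleton_eq_top.mpr hau))
  exact ⟨_, _, hden, hmul.symm, div_mul_cancel₀ _ (mk_ne_zero_of_notMem v hden)⟩

/-- Any fraction with denominator prime to `𝔭` computes the reduction, not only the one in lowest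
terms. This makes the reduction additive and multiplicative. -/
theorem reduceElt_of_mul_eq {x : F} {a s : 𝔽q[X]} (hs : s ∉ v.asIdeal)
    (h : x * algebraMap 𝔽q[X] F s = algebraMap 𝔽q[X] F a) : v.valuation F x ≤ 1 ∧
      reduceElt v x * Ideal.Quotient.mk v.asIdeal s = Ideal.Quotient.mk v.asIdeal a := by
  have hvs : v.valuation F (algebraMap 𝔽q[X] F s) = 1 :=
    le_antisymm (v.valuation_le_one s)
      (not_lt.mp fun h' => hs ((v.valuation_lt_one_iff_mem _).mp h'))
  have hx : v.valuation F x ≤ 1 := by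
    have := congrArg (v.valuation F) h
    rw [map_mul, hvs, mul_one] at this
    rw [this]
    exact v.valuation_le_one a
  refine ⟨hx, ?_⟩
  obtain ⟨a', s', hs', h', hred⟩ := exists_fraction_of_valuation_le_one v hx
  have h1 : a * s' = a' * s := by
    apply IsFractionRing.injective 𝔽q[X] F
    rw [map_mul, map_mul, ← h, ← h']
    ring
  refine mul_right_cancel₀ (mk_ne_zero_of_notMem v hs') ?_
  rw [← map_mul, h1, map_mul, ← hred]
  ring

/-- The reduction map of the valuation ring of `𝔭`. -/
def reduceHom : (v.valuation F).integer →+* 𝔽q[X] ⧸ v.asIdeal where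
  toFun x := reduceElt v (x : F)
  map_one' := by
    have := reduceElt_algebraMap (F := F) v 1
    rwa [map_one, map_one] at this
  map_zero' := by
    have := reduceElt_algebraMap (F := F) v 0
    rwa [map_zero, map_zero] at this
  map_mul' x y := by
    obtain ⟨a, s, hs, h, hr⟩ := exists_fraction_of_valuation_le_one v x.2
    obtain ⟨a', s', hs', h', hr'⟩ := exists_fraction_of_valuation_le_one v y.2
    have hss : s * s' ∉ v.asIdeal := fun h0 => (v.isPrime.mem_or_mem h0).elim hs hs'
    have := (reduceElt_of_mul_eq v (x := (x * y : F)) (a := a * a') hss (by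
      rw [map_mul, map_mul, ← h, ← h']
      ring)).2
    refine mul_right_cancel₀ (mk_ne_zero_of_notMem v hss) (this.trans ?_)
    rw [map_mul, map_mul, ← hr, ← hr']
    ring
  map_add' x y := by
    obtain ⟨a, s, hs, h, hr⟩ := exists_fraction_of_valuation_le_one v x.2
    obtain ⟨a', s', hs', h', hr'⟩ := exists_fraction_of_valuation_le_one v y.2
    have hss : s * s' ∉ v.asIdeal := fun h0 => (v.isPrime.mem_or_mem h0).elim hs hs'
    have := (reduceElt_of_mul_eq v (x := (x + y : F)) (a := a * s' + a' * s) hss (by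
      rw [map_mul, map_add, map_mul, map_mul, ← h, ← h']
      ring)).2
    refine mul_right_cancel₀ (mk_ne_zero_of_notMem v hss) (this.trans ?_)
    rw [map_add, map_mul, map_mul, map_mul, ← hr, ← hr']
    ring

/-- The coefficients of `w` are the reductions of the coefficients of `u`. -/
def IsReductionOf (u : TwistedPoly 𝔽q F) (w : TwistedPoly 𝔽q (𝔽q[X] ⧸ v.asIdeal)) : Prop :=
  ∀ i, ∃ y : (v.valuation F).integer, (y : F) = u.coeff i ∧ reduceHom v y = w.coeff i

variable {v}

theorem IsReductionOf.add {u u' : TwistedPoly 𝔽q F} {w w' : TwistedPoly 𝔽q (𝔽q[X] ⧸ v.asIdeal)}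
    (h : IsReductionOf v u w) (h' : IsReductionOf v u' w') : IsReductionOf v (u + u') (w + w') := by
  intro i
  obtain ⟨y, hy, hy'⟩ := h i
  obtain ⟨z, hz, hz'⟩ := h' i
  exact ⟨y + z, by rw [TwistedPoly.coeff_add, ← hy, ← hz]; rfl,
    by rw [TwistedPoly.coeff_add, map_add, hy', hz']⟩

theorem IsReductionOf.mul {u u' : TwistedPoly 𝔽q F} {w w' : TwistedPoly 𝔽q (𝔽q[X] ⧸ v.asIdeal)}
    (h : IsReductionOf v u w) (h' : IsReductionOf v u' w') : IsReductionOf v (u * u') (w * w') := by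
  intro i
  choose y hy hy' using h
  choose z hz hz' using h'
  refine ⟨∑ p ∈ Finset.HasAntidiagonal.antidiagonal i,
      y p.1 * z p.2 ^ Fintype.card 𝔽q ^ p.1, ?_, ?_⟩
  · rw [TwistedPoly.coeff_mul]
    push_cast
    exact Finset.sum_congr rfl fun p _ => by rw [hy, hz]
  · rw [TwistedPoly.coeff_mul, map_sum]
    exact Finset.sum_congr rfl fun p _ => by rw [map_mul, map_pow, hy', hz']

theorem isReductionOf_algebraMap (c : 𝔽q) :
    IsReductionOf v (algebraMap 𝔽q (TwistedPoly 𝔽q F) c)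
      (algebraMap 𝔽q (TwistedPoly 𝔽q (𝔽q[X] ⧸ v.asIdeal)) c) := by
  intro i
  by_cases hi : 0 = i
  · refine ⟨⟨algebraMap 𝔽q[X] F (C c), v.valuation_le_one _⟩, ?_, ?_⟩
    · rw [coeff_algebraMap, if_pos hi]
      exact (IsScalarTower.algebraMap_apply 𝔽q 𝔽q[X] F c).symm
    · rw [coeff_algebraMap, if_pos hi]
      exact reduceElt_algebraMap v (C c)
  · exact ⟨0, by rw [coeff_algebraMap, if_neg hi]; rfl,
      by rw [coeff_algebraMap, if_neg hi, map_zero]⟩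

theorem coeff_reduction_X (Φ : DrinfeldModule 𝔽q F r) (hv : HasGoodReduction v Φ) (j : ℕ) :
    ((reduction v Φ hv).toAlgHom X).coeff j = if j < r + 1 then reduceElt v (Φ.g j) else 0 := by
  change (aeval (∑ i ∈ Finset.range (r + 1), (TwistedPoly.monomial i (reduceElt v (Φ.g i)) :
    TwistedPoly 𝔽q (𝔽q[X] ⧸ v.asIdeal))) (X : 𝔽q[X])).coeff j = _
  rw [aeval_X, TwistedPoly.coeff_sum]
  simp only [TwistedPoly.coeff_monomial, Finset.sum_ite_eq', Finset.mem_range]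

theorem isReductionOf_toAlgHom (Φ : DrinfeldModule 𝔽q F r) (hv : HasGoodReduction v Φ)
    (a : 𝔽q[X]) : IsReductionOf v (Φ.toAlgHom a) ((reduction v Φ hv).toAlgHom a) := by
  have hX : IsReductionOf v (Φ.toAlgHom X) ((reduction v Φ hv).toAlgHom X) := by
    intro i
    rw [coeff_reduction_X]
    rcases lt_trichotomy i r with hi | rfl | hi
    · have hle : v.valuation F (Φ.g i) ≤ 1 := by
        -- Good reduction does not mention the constant coefficient, but this is `T`, an element of
        -- `A`.
        rcases Nat.eq_zero_or_pos i with rfl | h0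
        · rw [g, Φ.coeff_zero]
          exact v.valuation_le_one X
        · exact hv.1 i h0 hi
      exact ⟨⟨Φ.g i, hle⟩, rfl, (if_pos (by omega)).symm⟩
    · exact ⟨⟨Φ.g i, hv.2.le⟩, rfl, (if_pos (by omega)).symm⟩
    · exact ⟨0, by rw [Φ.coeff_gt i hi]; rfl, by rw [if_neg (by omega), map_zero]⟩
  induction a using Polynomial.induction_on with
  | C c =>
    have h1 : Φ.toAlgHom (C c) = algebraMap 𝔽q _ c := Φ.toAlgHom.commutes c
    have h2 : (reduction v Φ hv).toAlgHom (C c) = algebraMap 𝔽q _ c :=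
      (reduction v Φ hv).toAlgHom.commutes c
    rw [h1, h2]
    exact isReductionOf_algebraMap c
  | add p q hp hq =>
    rw [map_add, map_add]
    exact hp.add hq
  | monomial n c ih =>
    rw [pow_succ, ← mul_assoc, map_mul Φ.toAlgHom (C c * X ^ n),
      map_mul (reduction v Φ hv).toAlgHom (C c * X ^ n)]
    exact ih.mul hX

/-- Up to a denominator prime to `𝔭`, the `n`-torsion points are integral over `A`. -/
theorem exists_smul_isIntegral (Φ : DrinfeldModule 𝔽q F r) (hv : HasGoodReduction v Φ)
    {n : 𝔽q[X]} (hn : n ≠ 0) {Ω : Type*} [Field Ω] [Algebra 𝔽q Ω] [Algebra F Ω]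
    [IsScalarTower 𝔽q F Ω] [Algebra 𝔽q[X] Ω] [IsScalarTower 𝔽q[X] F Ω]
    [IsScalarTower 𝔽q 𝔽q[X] Ω] {x : Ω} (hx : eval Ω (Φ.toAlgHom n) x = 0) :
    ∃ s : 𝔽q[X], s ∉ v.asIdeal ∧ IsIntegral 𝔽q[X] (s • x) := by
  have hred := isReductionOf_toAlgHom Φ hv n
  set N := n.natDegree * r
  have hdeg := Φ.hasDegree_toAlgHom hn
  have hdeg' := (reduction v Φ hv).hasDegree_toAlgHom hn
  -- A common denominator `d`, prime to `𝔭`, for the coefficients of `Φ_n`.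
  have hden : ∀ M : ℕ, ∃ d : 𝔽q[X], d ∉ v.asIdeal ∧ ∀ i < M, ∃ a : 𝔽q[X],
      algebraMap 𝔽q[X] F a = (Φ.toAlgHom n).coeff i * algebraMap 𝔽q[X] F d := by
    intro M
    induction M with
    | zero => exact ⟨1, fun h => v.isPrime.ne_top ((Ideal.eq_top_iff_one _).mpr h), fun i hi =>
        absurd hi (Nat.not_lt_zero i)⟩
    | succ M ih =>
      obtain ⟨d, hd, h⟩ := ih
      obtain ⟨y, hy, -⟩ := hred M
      obtain ⟨a, s, hs, hya, -⟩ := exists_fraction_of_valuation_le_one v y.2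
      refine ⟨d * s, fun h0 => (v.isPrime.mem_or_mem h0).elim hd hs, fun i hi => ?_⟩
      rcases (Nat.lt_succ_iff.mp hi).eq_or_lt with rfl | hlt
      · exact ⟨a * d, by rw [map_mul, ← hya, hy, map_mul]; ring⟩
      · obtain ⟨b, hb⟩ := h i hlt
        exact ⟨b * s, by rw [map_mul, hb, map_mul]; ring⟩
  obtain ⟨d, hd, h⟩ := hden (N + 1)
  choose! a ha using h
  let w : TwistedPoly 𝔽q 𝔽q[X] := ∑ i ∈ Finset.range (N + 1), TwistedPoly.monomial i (a i)
  have hw : ∀ i, w.coeff i = if i < N + 1 then a i else 0 := fun i => by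
    simp only [w, TwistedPoly.coeff_sum, TwistedPoly.coeff_monomial, Finset.sum_ite_eq',
      Finset.mem_range]
  -- The reduction of `Φ_n` still has degree `N`, so the leading coefficient of `d Φ_n` is prime to
  -- `𝔭`. Its product with a root is integral.
  have haN : a N ∉ v.asIdeal := by
    intro h0
    obtain ⟨y, hy, hy'⟩ := hred N
    have h1 := (reduceElt_of_mul_eq v hd (ha N (by omega)).symm).2
    rw [(Ideal.Quotient.eq_zero_iff_mem (I := v.asIdeal)).mpr h0] at h1
    have h2 : reduceElt v ((Φ.toAlgHom n).coeff N) ≠ 0 := by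
      rw [← hy]
      change reduceHom v y ≠ 0
      rw [hy']
      exact hdeg'.2
    exact (mul_ne_zero h2 (mk_ne_zero_of_notMem v hd)) h1
  have hwN : w.coeff N = a N := by rw [hw, if_pos (Nat.lt_succ_self N)]
  have hwN0 : w.coeff N ≠ 0 := by
    rw [hwN]
    intro h0
    rw [h0] at haN
    exact haN (zero_mem _)
  refine ⟨a N, haN, ?_⟩
  rw [← hwN, ← leadingCoeff_toPolynomial hwN0]
  refine isIntegral_leadingCoeff_smul _ _ ?_
  have hwdeg : w ∈ degreeLE 𝔽q 𝔽q[X] N := fun i hi => by rw [hw, if_neg (by omega)]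
  rw [aeval_toPolynomial hwdeg, eval_eq_sum hwdeg]
  rw [eval_eq_sum hdeg.1] at hx
  have h3 := congrArg (algebraMap F Ω (algebraMap 𝔽q[X] F d) * ·) hx
  simp only [mul_zero, Finset.mul_sum] at h3
  rw [← h3]
  refine Finset.sum_congr rfl fun i hi => ?_
  rw [hw, if_pos (Finset.mem_range.mp hi), IsScalarTower.algebraMap_apply 𝔽q[X] F Ω,
    ha i (Finset.mem_range.mp hi), map_mul]
  ring

end Reduction

end DrinfeldModule

/-! ### Extending a homomorphism to fractions, and primes as kernels. -/

section Place

variable {B K Ω : Type*} [CommRing B] [Field K] [Algebra B K] [FaithfulSMul B K] [Field Ω]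
  (ψ : B →+* Ω)

variable (K) in
/-- The subring of the fractions whose denominator is not in the kernel of `ψ`. -/
def placeRing : Subring K where
  carrier := {x | ∃ b s : B, ψ s ≠ 0 ∧ x * algebraMap B K s = algebraMap B K b}
  one_mem' := ⟨1, 1, by simp, by simp⟩
  zero_mem' := ⟨0, 1, by simp, by simp⟩
  mul_mem' := by
    rintro x y ⟨b, s, hs, h⟩ ⟨b', s', hs', h'⟩
    exact ⟨b * b', s * s', by rw [map_mul]; exact mul_ne_zero hs hs', by
      rw [map_mul, map_mul, ← h, ← h']; ring⟩
  add_mem' := by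
    rintro x y ⟨b, s, hs, h⟩ ⟨b', s', hs', h'⟩
    exact ⟨b * s' + b' * s, s * s', by rw [map_mul]; exact mul_ne_zero hs hs', by
      rw [map_mul, map_add, map_mul, map_mul, ← h, ← h']; ring⟩
  neg_mem' := by
    rintro x ⟨b, s, hs, h⟩
    exact ⟨-b, s, hs, by rw [map_neg, ← h]; ring⟩

variable {ψ}

/-- The value at `x` of the extension of `ψ`. -/
def placeVal (x : placeRing K ψ) : Ω := ψ x.2.choose / ψ x.2.choose_spec.choose

/-- The value does not depend on the fraction chosen to represent `x`. -/
theorem placeVal_mul {x : placeRing K ψ} {b s : B}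
    (h : (x : K) * algebraMap B K s = algebraMap B K b) : placeVal x * ψ s = ψ b := by
  obtain ⟨hs', h'⟩ := x.2.choose_spec.choose_spec
  set b' := x.2.choose with hb
  set s' := x.2.choose_spec.choose with hsd
  have h1 : b * s' = b' * s := by
    apply FaithfulSMul.algebraMap_injective B K
    rw [map_mul, map_mul, ← h, ← h']
    ring
  have h2 : placeVal x = ψ b' / ψ s' := rfl
  rw [h2, div_mul_eq_mul_div, div_eq_iff hs', ← map_mul, ← map_mul, h1]

variable (K ψ) in
/-- The extension of `ψ` to fractions. -/
def placeHom : placeRing K ψ →+* Ω where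
  toFun := placeVal
  map_one' := by simpa using placeVal_mul (K := K) (ψ := ψ) (x := 1) (b := 1) (s := 1) (by simp)
  map_zero' := by simpa using placeVal_mul (K := K) (ψ := ψ) (x := 0) (b := 0) (s := 1) (by simp)
  map_mul' x y := by
    obtain ⟨b, s, hs, h⟩ := x.2
    obtain ⟨b', s', hs', h'⟩ := y.2
    have := placeVal_mul (x := x * y) (b := b * b') (s := s * s') (by
      rw [map_mul, map_mul, ← h, ← h']
      push_cast
      ring)
    rw [map_mul, map_mul, ← placeVal_mul h, ← placeVal_mul h'] at this
    refine mul_right_cancel₀ (mul_ne_zero hs hs') (this.trans ?_)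
    ring
  map_add' x y := by
    obtain ⟨b, s, hs, h⟩ := x.2
    obtain ⟨b', s', hs', h'⟩ := y.2
    have := placeVal_mul (x := x + y) (b := b * s' + b' * s) (s := s * s') (by
      rw [map_mul, map_add, map_mul, map_mul, ← h, ← h']
      push_cast
      ring)
    rw [map_mul, map_add, map_mul, map_mul, ← placeVal_mul h, ← placeVal_mul h'] at this
    refine mul_right_cancel₀ (mul_ne_zero hs hs') (this.trans ?_)
    ring

theorem placeHom_mul {x : placeRing K ψ} {b s : B}
    (h : (x : K) * algebraMap B K s = algebraMap B K b) : placeHom K ψ x * ψ s = ψ b :=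
  placeVal_mul h

end Place

/-- A prime of an integral extension is the kernel of a homomorphism to an algebraic closure of
the residue field below. -/
theorem exists_ringHom_algebraicClosure {A B : Type*} [CommRing A] [CommRing B] [Algebra A B]
    [Algebra.IsIntegral A B] (p : Ideal A) [p.IsMaximal] (𝔓 : Ideal B) [𝔓.IsPrime]
    (h : 𝔓.under A = p) {k : Type*} [Field k] [Algebra A k] (hk : RingHom.ker (algebraMap A k) = p)
    (hs : Function.Surjective (algebraMap A k)) :
    ∃ ψ : B →+* AlgebraicClosure k, RingHom.ker ψ = 𝔓 ∧
      ∀ a, ψ (algebraMap A B a) = algebraMap k (AlgebraicClosure k) (algebraMap A k a) := by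
  have : 𝔓.LiesOver p := ⟨h.symm⟩
  have : 𝔓.IsMaximal := Ideal.IsMaximal.of_liesOver_isMaximal 𝔓 p
  let := Ideal.Quotient.field 𝔓
  let e : (A ⧸ p) ≃+* k :=
    (Ideal.quotEquivOfEq hk.symm).trans (RingHom.quotientKerEquivOfSurjective hs)
  let i : k →+* B ⧸ 𝔓 := (algebraMap (A ⧸ p) (B ⧸ 𝔓)).comp e.symm.toRingHom
  let := i.toAlgebra
  have hi : ∀ a, algebraMap k (B ⧸ 𝔓) (algebraMap A k a) =
      Ideal.Quotient.mk 𝔓 (algebraMap A B a) := by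
    intro a
    have : e.symm (algebraMap A k a) = Ideal.Quotient.mk p a := by
      rw [RingEquiv.symm_apply_eq]
      rfl
    change algebraMap (A ⧸ p) (B ⧸ 𝔓) (e.symm (algebraMap A k a)) = _
    rw [this]
    rfl
  -- The integral equations over `A` reduce to monic equations over `k`, so `B/𝔓` embeds in an
  -- algebraic closure of `k`.
  have : Algebra.IsAlgebraic k (B ⧸ 𝔓) := by
    refine ⟨fun x => ?_⟩
    obtain ⟨b, rfl⟩ := Ideal.Quotient.mk_surjective x
    obtain ⟨P, hP, hb⟩ := Algebra.IsIntegral.isIntegral (R := A) b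
    refine IsIntegral.isAlgebraic ⟨P.map (algebraMap A k), hP.map _, ?_⟩
    rw [eval₂_map]
    have h1 : (algebraMap k (B ⧸ 𝔓)).comp (algebraMap A k) =
        (Ideal.Quotient.mk 𝔓).comp (algebraMap A B) := RingHom.ext hi
    rw [h1, ← hom_eval₂, hb, map_zero]
  let g : B ⧸ 𝔓 →ₐ[k] AlgebraicClosure k := IsAlgClosed.lift
  refine ⟨(g : B ⧸ 𝔓 →+* AlgebraicClosure k).comp (Ideal.Quotient.mk 𝔓), ?_, fun a => ?_⟩
  · ext b
    rw [RingHom.mem_ker, RingHom.comp_apply]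
    change g (Ideal.Quotient.mk 𝔓 b) = 0 ↔ _
    rw [map_eq_zero_iff g g.injective, Ideal.Quotient.eq_zero_iff_mem]
  · change g (Ideal.Quotient.mk 𝔓 (algebraMap A B a)) = _
    rw [← hi, AlgHom.commutes]

/-! ### Values of `Φ_a` at a place above `𝔭`. -/

namespace DrinfeldModule

open TwistedPoly

variable {𝔽q : Type*} [Field 𝔽q] [Fintype 𝔽q] {v : HeightOneSpectrum 𝔽q[X]}
  {F : Type*} [Field F] [Algebra 𝔽q F] [Algebra 𝔽q[X] F] [IsScalarTower 𝔽q 𝔽q[X] F]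
  [IsFractionRing 𝔽q[X] F] {r : ℕ}

theorem smul_fieldToPoints {L : Type*} [Field L] [Algebra 𝔽q L] [Algebra 𝔽q[X] L]
    [IsScalarTower 𝔽q 𝔽q[X] L] (φ : DrinfeldModule 𝔽q L r) {n : 𝔽q[X]} (a : 𝔽q[X])
    (y : φ.divisionField n) :
    a • φ.fieldToPoints n y = φ.fieldToPoints n (eval (φ.divisionField n) (φ.toAlgHom a) y) :=
  (TwistedPoly.eval_algEquiv (φ.divisionField n).val (φ.toAlgHom a) y).symm

section PlaceEval

variable {Φ : DrinfeldModule 𝔽q F r} (hv : HasGoodReduction v Φ)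
  {K Ω B : Type*} [Field K] [Algebra 𝔽q K] [Algebra F K] [IsScalarTower 𝔽q F K]
  [Algebra 𝔽q[X] K] [IsScalarTower 𝔽q[X] F K] [CommRing B] [Algebra B K] [FaithfulSMul B K]
  [Algebra 𝔽q[X] B] [IsScalarTower 𝔽q[X] B K]
  [Field Ω] [Algebra 𝔽q Ω] [Algebra (𝔽q[X] ⧸ v.asIdeal) Ω]
  [IsScalarTower 𝔽q (𝔽q[X] ⧸ v.asIdeal) Ω] {ψ : B →+* Ω}
  (hψ : ∀ a, ψ (algebraMap 𝔽q[X] B a) = algebraMap (𝔽q[X] ⧸ v.asIdeal) Ω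
    (Ideal.Quotient.mk v.asIdeal a))

include hψ in
/-- The coefficients of `Φ_a` lie in the ring of a place above `𝔭`. -/
theorem exists_placeRing_coeff (a : 𝔽q[X]) (i : ℕ) :
    ∃ z : placeRing K ψ, (z : K) = algebraMap F K ((Φ.toAlgHom a).coeff i) ∧
      placeHom K ψ z = algebraMap _ Ω (((reduction v Φ hv).toAlgHom a).coeff i) := by
  obtain ⟨y, hy, hy'⟩ := isReductionOf_toAlgHom Φ hv a i
  obtain ⟨c, s, hs, h, hr⟩ := exists_fraction_of_valuation_le_one v y.2
  have hs0 : ψ (algebraMap 𝔽q[X] B s) ≠ 0 := by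
    rw [hψ]
    exact (_root_.map_ne_zero _).mpr (mk_ne_zero_of_notMem v hs)
  have hz : algebraMap F K y * algebraMap B K (algebraMap 𝔽q[X] B s) =
      algebraMap B K (algebraMap 𝔽q[X] B c) := by
    rw [← IsScalarTower.algebraMap_apply, ← IsScalarTower.algebraMap_apply,
      IsScalarTower.algebraMap_apply 𝔽q[X] F K, IsScalarTower.algebraMap_apply 𝔽q[X] F K,
      ← map_mul, h]
  refine ⟨⟨algebraMap F K y, _, _, hs0, hz⟩, by rw [← hy], ?_⟩
  refine mul_right_cancel₀ hs0 ((placeHom_mul hz).trans ?_)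
  rw [hψ, hψ, ← map_mul, ← hy']
  exact congrArg _ hr.symm

include hψ in
/-- Reduction of the values of `Φ_a` at the points of a place above `𝔭`. -/
theorem placeHom_eval (a : 𝔽q[X]) (x : placeRing K ψ) :
    ∃ h : eval K (Φ.toAlgHom a) (x : K) ∈ placeRing K ψ,
      placeHom K ψ ⟨_, h⟩ = eval Ω ((reduction v Φ hv).toAlgHom a) (placeHom K ψ x) := by
  choose z hz hz' using exists_placeRing_coeff (K := K) hv hψ a
  obtain ⟨N, hN⟩ := exists_mem_degreeLE (Φ.toAlgHom a)
  have hN' : (reduction v Φ hv).toAlgHom a ∈ degreeLE 𝔽q _ N := by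
    intro i hi
    obtain ⟨y, hy, hy'⟩ := isReductionOf_toAlgHom Φ hv a i
    have h0 : y = 0 := Subtype.ext (hy.trans (hN i hi))
    rw [← hy', h0, map_zero]
  have hval : ((∑ i ∈ Finset.range (N + 1), z i * x ^ Fintype.card 𝔽q ^ i : placeRing K ψ) : K) =
      eval K (Φ.toAlgHom a) (x : K) := by
    rw [eval_eq_sum hN]
    push_cast
    exact Finset.sum_congr rfl fun i _ => by rw [hz]
  refine ⟨hval ▸ (∑ i ∈ Finset.range (N + 1), z i * x ^ Fintype.card 𝔽q ^ i :
    placeRing K ψ).2, ?_⟩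
  refine (congrArg (placeHom K ψ) (Subtype.ext hval.symm)).trans ?_
  rw [map_sum, eval_eq_sum hN']
  exact Finset.sum_congr rfl fun i _ => by rw [map_mul, map_pow, hz']

include hv hψ in
/-- A torsion point of order prime to `𝔭` that reduces to zero is zero. -/
theorem eq_zero_of_placeHom_eq_zero {n : 𝔽q[X]} (hn : n ∉ v.asIdeal) (x : placeRing K ψ)
    (hx : eval K (Φ.toAlgHom n) (x : K) = 0) (h0 : placeHom K ψ x = 0) : x = 0 := by
  choose z hz hz' using exists_placeRing_coeff (K := K) hv hψ n
  obtain ⟨N, hN⟩ := exists_mem_degreeLE (Φ.toAlgHom n)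
  have hq : ∀ i, 1 < Fintype.card 𝔽q ^ (i + 1) := fun i =>
    Nat.one_lt_pow (Nat.succ_ne_zero i) Fintype.one_lt_card
  -- Factor `Φ_n(x)` as `x` times `n` plus terms divisible by `x`. If `x` reduces to zero, the
  -- second factor reduces to `n` modulo `𝔭`, which is nonzero, so `x` itself vanishes.
  have hval : x * (z 0 + ∑ i ∈ Finset.range N,
      z (i + 1) * x ^ (Fintype.card 𝔽q ^ (i + 1) - 1)) = 0 := by
    have : (∑ i ∈ Finset.range (N + 1), z i * x ^ Fintype.card 𝔽q ^ i : placeRing K ψ) = 0 := by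
      apply Subtype.ext
      rw [eval_eq_sum hN] at hx
      push_cast
      refine Eq.trans (Finset.sum_congr rfl fun i _ => ?_) hx
      rw [hz]
    rw [Finset.sum_range_succ', pow_zero, pow_one] at this
    rw [← this, mul_add, add_comm, Finset.mul_sum, mul_comm x]
    refine congrArg (· + _) (Finset.sum_congr rfl fun i _ => ?_)
    rw [mul_left_comm, ← pow_succ', Nat.sub_add_cancel (hq i).le]
  refine (mul_eq_zero.mp hval).resolve_right fun h => ?_
  have h' := congrArg (placeHom K ψ) h
  rw [map_add, map_sum, map_zero, Finset.sum_eq_zero, add_zero, hz', coeff_zero_toAlgHom] at h'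
  · exact mk_ne_zero_of_notMem v hn ((map_eq_zero (algebraMap _ Ω)).mp h')
  · intro i _
    rw [map_mul, map_pow, h0, zero_pow (Nat.sub_ne_zero_of_lt (hq i)), mul_zero]

end PlaceEval

end DrinfeldModule

/-! ### The Galois-compatible isomorphism of `Φ[n]` with `φ[n]`. -/

namespace DrinfeldModule

open TwistedPoly

variable {𝔽q : Type*} [Field 𝔽q] [Fintype 𝔽q] {v : HeightOneSpectrum 𝔽q[X]}
  {F : Type*} [Field F] [Algebra 𝔽q F] [Algebra 𝔽q[X] F] [IsScalarTower 𝔽q 𝔽q[X] F]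
  [IsFractionRing 𝔽q[X] F] {r : ℕ} {Φ : DrinfeldModule 𝔽q F r} {n : 𝔽q[X]}

theorem eval_torsionToField {L : Type*} [Field L] [Algebra 𝔽q L] [Algebra 𝔽q[X] L]
    [IsScalarTower 𝔽q 𝔽q[X] L] (φ : DrinfeldModule 𝔽q L r) (a : 𝔽q[X]) (x : φ.torsion n) :
    eval (φ.divisionField n) (φ.toAlgHom a) (φ.torsionToField x) = φ.torsionToField (a • x) :=
  Subtype.ext (φ.smul_fieldToPoints a (φ.torsionToField x)).symm

theorem torsionToField_galRep {L : Type*} [Field L] [Algebra 𝔽q L] [Algebra 𝔽q[X] L]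
    [IsScalarTower 𝔽q 𝔽q[X] L] (φ : DrinfeldModule 𝔽q L r)
    (σ : φ.divisionField n ≃ₐ[L] φ.divisionField n) (x : φ.torsion n) :
    φ.torsionToField (φ.galRep n σ x) = σ (φ.torsionToField x) := rfl

/-- Reduction modulo a prime above a prime `𝔭` of good reduction not containing `n` identifies the
`n`-torsion points of `Φ` with those of its reduction. -/
theorem exists_torsion_reduction (hv : HasGoodReduction v Φ) (hn : n ∉ v.asIdeal)
    (𝔓 : Ideal (integralClosure 𝔽q[X] (Φ.divisionField n))) [𝔓.IsPrime]
    (h𝔓 : 𝔓.under 𝔽q[X] = v.asIdeal) :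
    ∃ e : Φ.torsion n ≃ₗ[𝔽q[X] ⧸ Ideal.span {n}] (reduction v Φ hv).torsion n,
      ∀ (σ : Φ.divisionField n ≃ₐ[F] Φ.divisionField n) (j : ℕ),
        (∀ b : integralClosure 𝔽q[X] (Φ.divisionField n),
          σ • b - b ^ Fintype.card 𝔽q ^ j ∈ 𝔓) →
        ∀ x, (e (Φ.galRep n σ x) : (reduction v Φ hv).Points) =
          (TwistedPoly.monomial j 1 : TwistedPoly 𝔽q (𝔽q[X] ⧸ v.asIdeal)) •
            (e x : (reduction v Φ hv).Points) := by
  have hn0 : n ≠ 0 := by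
    rintro rfl
    exact hn v.asIdeal.zero_mem
  have hnF : algebraMap 𝔽q[X] F n ≠ 0 := by
    rwa [Ne, map_eq_zero_iff _ (IsFractionRing.injective 𝔽q[X] F)]
  have hnk : algebraMap 𝔽q[X] (𝔽q[X] ⧸ v.asIdeal) n ≠ 0 := mk_ne_zero_of_notMem v hn
  have := v.isMaximal
  obtain ⟨ψ, hker, hψ⟩ := exists_ringHom_algebraicClosure (k := 𝔽q[X] ⧸ v.asIdeal)
    v.asIdeal 𝔓 h𝔓 Ideal.mk_ker Ideal.Quotient.mk_surjective
  have : IsScalarTower 𝔽q 𝔽q[X] (Φ.divisionField n) := IsScalarTower.of_algebraMap_eq fun c => by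
    rw [IsScalarTower.algebraMap_apply 𝔽q F, IsScalarTower.algebraMap_apply 𝔽q 𝔽q[X] F,
      ← IsScalarTower.algebraMap_apply]
  have hzero : ∀ x : Φ.torsion n,
      eval (Φ.divisionField n) (Φ.toAlgHom n) (Φ.torsionToField x) = 0 := by
    intro x
    rw [eval_torsionToField]
    have : n • x = 0 := Subtype.ext (Φ.mem_torsion_iff.mp x.2)
    rw [this]
    rfl
  -- Torsion points are fractions `b/s` with `s ∈ A` outside `𝔭`, so the place is defined at them.
  -- The denominator in `A` is also fixed by the Galois group, which is needed for the action of
  -- `σ`.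
  have hint : ∀ x : Φ.torsion n, ∃ (b : integralClosure 𝔽q[X] (Φ.divisionField n)) (s : 𝔽q[X]),
      ψ (algebraMap 𝔽q[X] (integralClosure 𝔽q[X] (Φ.divisionField n)) s) ≠ 0 ∧
      Φ.torsionToField x * algebraMap (integralClosure 𝔽q[X] (Φ.divisionField n))
        (Φ.divisionField n)
        (algebraMap 𝔽q[X] (integralClosure 𝔽q[X] (Φ.divisionField n)) s) =
          algebraMap (integralClosure 𝔽q[X] (Φ.divisionField n)) (Φ.divisionField n) b := by
    intro x
    obtain ⟨s, hs, h⟩ := exists_smul_isIntegral Φ hv hn0 (hzero x)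
    refine ⟨⟨_, h⟩, s, ?_, ?_⟩
    · rw [hψ]
      exact (_root_.map_ne_zero _).mpr (mk_ne_zero_of_notMem v hs)
    · rw [mul_comm, ← IsScalarTower.algebraMap_apply, ← Algebra.smul_def]
      rfl
  have hmem : ∀ x : Φ.torsion n, Φ.torsionToField x ∈ placeRing (Φ.divisionField n) ψ := fun x => by
    obtain ⟨b, s, hs, h⟩ := hint x
    exact ⟨b, _, hs, h⟩
  let ρ : Φ.torsion n → AlgebraicClosure (𝔽q[X] ⧸ v.asIdeal) := fun x =>
    placeHom (Φ.divisionField n) ψ ⟨Φ.torsionToField x, hmem x⟩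
  have hρs : ∀ (a : 𝔽q[X]) x, (reduction v Φ hv).toPoints (ρ (a • x)) =
      a • (reduction v Φ hv).toPoints (ρ x) := by
    intro a x
    obtain ⟨h, h'⟩ := placeHom_eval (K := Φ.divisionField n) hv hψ a ⟨Φ.torsionToField x, hmem x⟩
    refine congrArg (reduction v Φ hv).toPoints (Eq.trans ?_ h')
    exact congrArg (placeHom (Φ.divisionField n) ψ) (Subtype.ext (Φ.eval_torsionToField a x).symm)
  have hρa : ∀ x y, ρ (x + y) = ρ x + ρ y := fun x y => by
    rw [← map_add]
    rfl
  have hρ0 : ρ 0 = 0 := by simpa using hρa 0 0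
  let e₀ : Φ.torsion n →ₗ[𝔽q[X] ⧸ Ideal.span {n}] (reduction v Φ hv).torsion n :=
    { toFun := fun x => ⟨(reduction v Φ hv).toPoints (ρ x), by
        rw [mem_torsion_iff, ← hρs]
        have : n • x = 0 := Subtype.ext (Φ.mem_torsion_iff.mp x.2)
        rw [this, hρ0, map_zero]⟩
      map_add' := fun x y => Subtype.ext (hρa x y)
      map_smul' := fun a x => Subtype.ext (by
        obtain ⟨a, rfl⟩ := Ideal.Quotient.mk_surjective a
        exact hρs a x) }
  have hinj : Function.Injective e₀ := by
    refine (injective_iff_map_eq_zero e₀).mpr fun x hx => ?_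
    have h0 : ρ x = 0 := congrArg Subtype.val hx
    have := eq_zero_of_placeHom_eq_zero (K := Φ.divisionField n) hv hψ hn ⟨_, hmem x⟩ (hzero x) h0
    exact Subtype.ext (congrArg (fun y : placeRing (Φ.divisionField n) ψ =>
      ((y : Φ.divisionField n) : AlgebraicClosure F)) this)
  have := Φ.finite_torsion hnF
  have := (reduction v Φ hv).finite_torsion hnk
  -- Both torsion groups have `q ^ (r deg n)` elements, so injectivity is enough.
  have hbij : Function.Bijective e₀ :=
    (Nat.bijective_iff_injective_and_card e₀).mpr
      ⟨hinj, by rw [Φ.card_torsion hnF, (reduction v Φ hv).card_torsion hnk]⟩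
  refine ⟨LinearEquiv.ofBijective e₀ hbij, fun σ j hσ x => ?_⟩
  rw [LinearEquiv.ofBijective_apply, LinearEquiv.ofBijective_apply]
  refine Eq.trans (b := (reduction v Φ hv).toPoints (ρ x ^ Fintype.card 𝔽q ^ j)) ?_ ?_
  · refine congrArg (reduction v Φ hv).toPoints ?_
    -- Write `x = b/s`. As `σ` fixes `s`, the congruence gives `ψ(s) = ψ(s) ^ (q^j)`, and the rule
    -- `ψ(σ b) = ψ(b) ^ (q^j)` passes to the quotient.
    obtain ⟨b, s, hs, h⟩ := hint x
    have h1 : ρ x * ψ (algebraMap 𝔽q[X] (integralClosure 𝔽q[X] (Φ.divisionField n)) s) = ψ b :=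
      placeHom_mul h
    have h2 : ρ (Φ.galRep n σ x) *
        ψ (algebraMap 𝔽q[X] (integralClosure 𝔽q[X] (Φ.divisionField n)) s) = ψ (σ • b) := by
      refine placeHom_mul ?_
      have := congrArg σ h
      rw [map_mul] at this
      refine Eq.trans ?_ this
      rw [← IsScalarTower.algebraMap_apply,
        IsScalarTower.algebraMap_apply 𝔽q[X] F (Φ.divisionField n),
        AlgEquiv.commutes]
      rfl
    have h3 : ψ (σ • b) = ψ b ^ Fintype.card 𝔽q ^ j := by
      have := hσ b
      rwa [← hker, RingHom.mem_ker, map_sub, map_pow, sub_eq_zero] at this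
    have h4 : ψ (σ • algebraMap 𝔽q[X] (integralClosure 𝔽q[X] (Φ.divisionField n)) s) =
        ψ (algebraMap 𝔽q[X] (integralClosure 𝔽q[X] (Φ.divisionField n)) s) ^
          Fintype.card 𝔽q ^ j := by
      have := hσ (algebraMap 𝔽q[X] (integralClosure 𝔽q[X] (Φ.divisionField n)) s)
      rwa [← hker, RingHom.mem_ker, map_sub, map_pow, sub_eq_zero] at this
    have h5 : σ • algebraMap 𝔽q[X] (integralClosure 𝔽q[X] (Φ.divisionField n)) s =
        algebraMap 𝔽q[X] (integralClosure 𝔽q[X] (Φ.divisionField n)) s :=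
      Subtype.ext (by
        change σ (algebraMap 𝔽q[X] (Φ.divisionField n) s) = algebraMap 𝔽q[X] (Φ.divisionField n) s
        rw [IsScalarTower.algebraMap_apply 𝔽q[X] F (Φ.divisionField n), AlgEquiv.commutes])
    rw [h5] at h4
    refine mul_right_cancel₀ hs ?_
    rw [h2, h3, ← h1, mul_pow, ← h4]
  · change _ = TwistedPoly.monomial j 1 • (reduction v Φ hv).toPoints (ρ x)
    rw [smul_toPoints, TwistedPoly.eval_monomial, map_one, one_mul]

end DrinfeldModule

/-! ### Unramifiedness and the Frobenius class. -/

namespace DrinfeldModule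

open TwistedPoly

variable {𝔽q : Type*} [Field 𝔽q] [Fintype 𝔽q] {v : HeightOneSpectrum 𝔽q[X]}
  {F : Type*} [Field F] [Algebra 𝔽q F] [Algebra 𝔽q[X] F] [IsScalarTower 𝔽q 𝔽q[X] F]
  [IsFractionRing 𝔽q[X] F] {r : ℕ} {Φ : DrinfeldModule 𝔽q F r} {n : 𝔽q[X]}

/-- The division field of order prime to `𝔭` is unramified at a prime `𝔭` of good reduction. -/
theorem isUnramifiedAt_divisionField (hv : HasGoodReduction v Φ) (hn : n ∉ v.asIdeal)
    (𝔓 : Ideal (integralClosure 𝔽q[X] (Φ.divisionField n))) [𝔓.IsPrime]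
    (h𝔓 : 𝔓.under 𝔽q[X] = v.asIdeal) : Algebra.IsUnramifiedAt 𝔽q[X] 𝔓 := by
  have hn0 : n ≠ 0 := by
    rintro rfl
    exact hn v.asIdeal.zero_mem
  have hnF : algebraMap 𝔽q[X] F n ≠ 0 := by
    rwa [Ne, map_eq_zero_iff _ (IsFractionRing.injective 𝔽q[X] F)]
  have := Φ.finiteDimensional_divisionField hn0
  have := Φ.isGalois_divisionField hnF
  have := IsIntegralClosure.isDedekindDomain 𝔽q[X] F (Φ.divisionField n)
    (integralClosure 𝔽q[X] (Φ.divisionField n))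
  have := IsIntegralClosure.isFractionRing_of_finite_extension 𝔽q[X] F (Φ.divisionField n)
    (integralClosure 𝔽q[X] (Φ.divisionField n))
  have := IsIntegralClosure.finite 𝔽q[X] F (Φ.divisionField n)
    (integralClosure 𝔽q[X] (Φ.divisionField n))
  have : IsGaloisGroup (Φ.divisionField n ≃ₐ[F] Φ.divisionField n) 𝔽q[X]
      (integralClosure 𝔽q[X] (Φ.divisionField n)) :=
    IsGaloisGroup.of_isFractionRing _ _ _ F (Φ.divisionField n)
  obtain ⟨e, he⟩ := exists_torsion_reduction hv hn 𝔓 h𝔓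
  -- An inertia element satisfies the congruence with `j = 0`, so it acts trivially on `φ[n]`, hence
  -- on `Φ[n]`, which generates the field.
  have hin : 𝔓.inertia (Φ.divisionField n ≃ₐ[F] Φ.divisionField n) = ⊥ := by
    refine (Subgroup.eq_bot_iff_forall _).mpr fun σ hσ => Φ.eq_one_of_torsion_fixed fun x => ?_
    have h := he σ 0 (fun b => by simpa using hσ b) x
    rw [TwistedPoly.monomial_zero_one, one_smul] at h
    have h' : Φ.galRep n σ x = x := e.injective (Subtype.ext h)
    rw [← torsionToField_galRep, h']
  have hmax : (𝔓.under 𝔽q[X]).IsMaximal := h𝔓 ▸ v.isMaximal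
  have : Finite (𝔽q[X] ⧸ 𝔓.under 𝔽q[X]) := by
    rw [h𝔓]
    infer_instance
  have : Finite (𝔓.under 𝔽q[X]).ResidueField :=
    Finite.of_surjective _ (Ideal.bijective_algebraMap_quotient_residueField (𝔓.under 𝔽q[X])).2
  have : Module.IsTorsionFree 𝔽q[X] (integralClosure 𝔽q[X] (Φ.divisionField n)) := by
    refine Module.IsTorsionFree.of_smul_eq_zero fun a b hab => ?_
    have hab' : a • (b : Φ.divisionField n) = 0 := congrArg Subtype.val hab
    rw [← algebraMap_smul F a, smul_eq_zero,
      map_eq_zero_iff _ (IsFractionRing.injective 𝔽q[X] F)] at hab'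
    exact hab'.imp_right fun hb => Subtype.ext hb
  have : Module.Free 𝔽q[X] (integralClosure 𝔽q[X] (Φ.divisionField n)) :=
    Module.free_of_finite_type_torsion_free'
  have : Module.Flat 𝔽q[X] (integralClosure 𝔽q[X] (Φ.divisionField n)) := Module.Flat.of_free
  have : 𝔓.LiesOver (𝔓.under 𝔽q[X]) := ⟨rfl⟩
  -- In this Galois situation the ramification index is the order of the inertia group.
  rw [← Ideal.ramificationIdx_eq_one_iff, ← Ideal.ramificationIdxIn_eq_ramificationIdx
    (𝔓.under 𝔽q[X]) 𝔓 (Φ.divisionField n ≃ₐ[F] Φ.divisionField n),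
    ← Ideal.card_inertia_eq_ramificationIdxIn (𝔓.under 𝔽q[X]) 𝔓
      (G := Φ.divisionField n ≃ₐ[F] Φ.divisionField n), hin, Subgroup.card_bot]

/-- If the torsion of order `n` is generated by one point over the endomorphism ring, the matrix of
the Frobenius endomorphism is its matrix in some basis of the torsion. -/
theorem exists_torsion_basis_frob {L : Type*} [Field L] [Finite L] [Algebra 𝔽q L]
    [Algebra 𝔽q[X] L] [IsScalarTower 𝔽q 𝔽q[X] L] {φ : DrinfeldModule 𝔽q L r}
    (D : φ.FrobeniusBasis) (hn : algebraMap 𝔽q[X] L n ≠ 0)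
    (h : ∀ ℓ : 𝔽q[X], ℓ.Monic → Irreducible ℓ → ℓ ∣ n → φ.TateModuleIsFreeOfRankOne ℓ) :
    ∃ β : Module.Basis (Fin r) (𝔽q[X] ⧸ Ideal.span {n}) (φ.torsion n), ∀ j,
      φ.frob • (β j : φ.Points) = ∑ i, D.matrix i j • (β i : φ.Points) := by
  obtain ⟨w, hw, hgen⟩ := φ.exists_end_generator (ne_zero_of_algebraMap_ne_zero hn) h
  have := φ.finite_torsion hn
  have := finite_quotient_span_singleton (ne_zero_of_algebraMap_ne_zero hn)
  have hmem : ∀ u : φ.End, u • w ∈ φ.torsion n := fun u => by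
    rw [mem_torsion_iff, ← smul_comm, hw, smul_zero]
  -- The map `u ↦ u w` from `End` onto `φ[n]` sends the chosen `A`-basis to `r` generators, which
  -- form a basis by counting. It commutes with `π`, so the matrix is unchanged.
  obtain ⟨β, hβ⟩ := exists_basis_of_card_eq_pow (φ.card_torsion_eq_card_quotient_pow hn)
    (fun i => (⟨D.basis i • w, hmem _⟩ : φ.torsion n)) (Or.inr fun x => by
      obtain ⟨u, hu⟩ := hgen x (φ.mem_torsion_iff.mp x.2)
      refine ⟨fun i => Ideal.Quotient.mk _ (D.basis.repr u i), Subtype.ext ?_⟩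
      simp only [mk_smul_torsion]
      rw [hu]
      conv_rhs => rw [← D.basis.sum_repr u, Finset.sum_smul]
      simp [smul_assoc])
  refine ⟨β, fun j => ?_⟩
  simp only [hβ]
  rw [← mul_smul, D.frob_mul_basis, Finset.sum_smul]
  exact Finset.sum_congr rfl fun i _ => smul_assoc _ _ _

/-- The matrices of an automorphism in two bases of the torsion are conjugate. -/
theorem isConj_galMatrixRep {L : Type*} [Field L] [Algebra 𝔽q L] [Algebra 𝔽q[X] L]
    [IsScalarTower 𝔽q 𝔽q[X] L] (φ : DrinfeldModule 𝔽q L r)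
    (β β' : Module.Basis (Fin r) (𝔽q[X] ⧸ Ideal.span {n}) (φ.torsion n))
    (σ : φ.divisionField n ≃ₐ[L] φ.divisionField n) :
    IsConj (φ.galMatrixRep β σ) (φ.galMatrixRep β' σ) := by
  rw [isConj_iff]
  refine ⟨⟨β'.toMatrix β, β.toMatrix β', β'.toMatrix_mul_toMatrix_flip β,
    β.toMatrix_mul_toMatrix_flip β'⟩, ?_⟩
  rw [mul_inv_eq_iff_eq_mul]
  apply Units.ext
  change β'.toMatrix β * LinearMap.toMatrix β β (φ.galRep n σ) =
    LinearMap.toMatrix β' β' (φ.galRep n σ) * β'.toMatrix β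
  rw [basis_toMatrix_mul_linearMap_toMatrix, linearMap_toMatrix_mul_basis_toMatrix]

/-- The matrix of the Frobenius endomorphism of the reduction represents the Frobenius class. -/
theorem exists_isConj_frobenius (hv : HasGoodReduction v Φ) (hn : n ∉ v.asIdeal)
    (h : ∀ ℓ : 𝔽q[X], ℓ.Monic → Irreducible ℓ → ℓ ∣ n →
      (reduction v Φ hv).TateModuleIsFreeOfRankOne ℓ)
    (D : (reduction v Φ hv).FrobeniusBasis)
    (β : Module.Basis (Fin r) (𝔽q[X] ⧸ Ideal.span {n}) (Φ.torsion n))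
    (𝔓 : Ideal (integralClosure 𝔽q[X] (Φ.divisionField n))) [𝔓.IsPrime]
    (h𝔓 : 𝔓.under 𝔽q[X] = v.asIdeal) {σ : Φ.divisionField n ≃ₐ[F] Φ.divisionField n}
    (hσ : Φ.IsFrobeniusAt σ 𝔓) :
    ∃ M : GL (Fin r) (𝔽q[X] ⧸ Ideal.span {n}),
      (M : Matrix (Fin r) (Fin r) (𝔽q[X] ⧸ Ideal.span {n})) =
        D.matrix.map (Ideal.Quotient.mk (Ideal.span {n})) ∧
      IsConj (Φ.galMatrixRep β σ) M := by
  obtain ⟨e, he⟩ := exists_torsion_reduction hv hn 𝔓 h𝔓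
  obtain ⟨β', hβ'⟩ := exists_torsion_basis_frob D (mk_ne_zero_of_notMem v hn) h
  refine ⟨Φ.galMatrixRep (β'.map e.symm) σ, ?_, Φ.isConj_galMatrixRep _ _ _⟩
  have hfrob : ∀ x, (e (Φ.galRep n σ x) : (reduction v Φ hv).Points) =
      (reduction v Φ hv).frob • (e x : (reduction v Φ hv).Points) := by
    -- Here `j = [𝔽_𝔭 : 𝔽q]`, so that `q ^ j = #(A/𝔭)` and `τ ^ j` is `π`.
    refine he σ _ fun b => ?_
    rw [← card_eq_pow, ← h𝔓]
    exact hσ b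
  change LinearMap.toMatrix (β'.map e.symm) (β'.map e.symm) (Φ.galRep n σ) = _
  ext i j
  have key : Φ.galRep n σ (β'.map e.symm j) =
      ∑ i, Ideal.Quotient.mk (Ideal.span {n}) (D.matrix i j) • β'.map e.symm i := by
    apply e.injective
    apply Subtype.ext
    rw [hfrob, map_sum]
    simp only [Module.Basis.map_apply, map_smul, LinearEquiv.apply_symm_apply]
    rw [hβ']
    simp [mk_smul_torsion]
  rw [LinearMap.toMatrix_apply, key, Module.Basis.repr_sum_self]
  rfl

end DrinfeldModule

end

/-! ### The main theorem. -/

theorem mainTheorem2 {𝔽q F : Type*} [Field 𝔽q] [Fintype 𝔽q] [Field F] [Algebra 𝔽q F]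
    [Algebra 𝔽q[X] F] [IsScalarTower 𝔽q 𝔽q[X] F] [IsFractionRing 𝔽q[X] F]
    (r : ℕ) (Φ : DrinfeldModule 𝔽q F r) (v : HeightOneSpectrum 𝔽q[X])
    (hv : DrinfeldModule.HasGoodReduction v Φ) (n : 𝔽q[X]) (hn : n ∉ v.asIdeal) :
    -- `F(Φ[n])/F` is a finite Galois extension, unramified at `𝔭`
    (FiniteDimensional F (Φ.divisionField n) ∧ IsGalois F (Φ.divisionField n) ∧
      ∀ (𝔓 : Ideal (integralClosure 𝔽q[X] (Φ.divisionField n))) [𝔓.IsPrime],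
        𝔓.under 𝔽q[X] = v.asIdeal → Algebra.IsUnramifiedAt 𝔽q[X] 𝔓) ∧
    -- `Φ[n] ≅ (A/nA)^r`, so that the action on `Φ[n]` embeds `Gal(F(Φ[n])/F)` in `GL_r(A/nA)`
    Nonempty (Module.Basis (Fin r) (𝔽q[X] ⧸ Ideal.span {n}) (Φ.torsion n)) ∧
    (∀ β : Module.Basis (Fin r) (𝔽q[X] ⧸ Ideal.span {n}) (Φ.torsion n),
      Function.Injective (Φ.galMatrixRep β)) ∧
    -- the integral matrix of the Frobenius exists, and it has the displayed shape
    Nonempty (DrinfeldModule.reduction v Φ hv).FrobeniusBasis ∧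
    (∀ D : (DrinfeldModule.reduction v Φ hv).FrobeniusBasis, D.HasExplicitShape) ∧
    -- its reduction modulo `n` represents the Frobenius class at `𝔭`
    ((∀ ℓ : 𝔽q[X], ℓ.Monic → Irreducible ℓ → ℓ ∣ n →
        (DrinfeldModule.reduction v Φ hv).TateModuleIsFreeOfRankOne ℓ) →
      ∀ (D : (DrinfeldModule.reduction v Φ hv).FrobeniusBasis)
        (β : Module.Basis (Fin r) (𝔽q[X] ⧸ Ideal.span {n}) (Φ.torsion n))
        (𝔓 : Ideal (integralClosure 𝔽q[X] (Φ.divisionField n))) [𝔓.IsPrime],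
        𝔓.under 𝔽q[X] = v.asIdeal →
        ∀ σ : Φ.divisionField n ≃ₐ[F] Φ.divisionField n, Φ.IsFrobeniusAt σ 𝔓 →
          ∃ M : GL (Fin r) (𝔽q[X] ⧸ Ideal.span {n}),
            (M : Matrix (Fin r) (Fin r) (𝔽q[X] ⧸ Ideal.span {n})) =
              D.matrix.map (Ideal.Quotient.mk (Ideal.span {n})) ∧
            IsConj (Φ.galMatrixRep β σ) M) := by
  have hn0 : n ≠ 0 := by
    rintro rfl
    exact hn v.asIdeal.zero_mem
  have hnF : algebraMap 𝔽q[X] F n ≠ 0 := by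
    rwa [Ne, map_eq_zero_iff _ (IsFractionRing.injective 𝔽q[X] F)]
  have hA : Function.Surjective (algebraMap 𝔽q[X] (𝔽q[X] ⧸ v.asIdeal)) :=
    Ideal.Quotient.mk_surjective
  exact ⟨⟨Φ.finiteDimensional_divisionField hn0, Φ.isGalois_divisionField hnF,
      fun 𝔓 _ h => DrinfeldModule.isUnramifiedAt_divisionField hv hn 𝔓 h⟩,
    Φ.nonempty_basis_torsion hnF, fun β => Φ.galMatrixRep_injective β,
    DrinfeldModule.nonempty_frobeniusBasis _ hA,
    DrinfeldModule.FrobeniusBasis.hasExplicitShape hA,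
    fun h D β 𝔓 _ h𝔓 σ hσ => DrinfeldModule.exists_isConj_frobenius hv hn h D β 𝔓 h𝔓 hσ⟩
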